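/- Let $P_1,P_2$ be closed (compact, without boundary, not necessarily connected) smooth manifolds of dimensions $p_1,p_2$ with $p_1+p_2\ge 1$, put $N=\mathbb{R}^{p_1+p_2+1}$, and let $f_1:P_1\to N$, $f_2:P_2\to N$ be smooth maps with disjoint images. *Classical linking number.* Let $G:P_1\times P_2\to S^{p_1+p_2}$, $G(x_1,x_2)=\frac{f_2(x_2)-f_1(x_1)}{\|f_2(x_2)-f_1(x_1)\|}$ be the Gauss map. If $P_1$ and $P_2$ are oriented, the classical linking number is the degree of $G$: the number of points of $G^{-1}(x)$, for any regular value $x$, where $(x_1,x_2)$ is counted with sign $\pm1$ according to whether $DG:T_{x_1}P_1\oplus T_{x_2}P_2\to T_xS^{p_1+p_2}$ preserves or reverses orientation ($S^{p_1+p_2}$ is oriented as the boundary of the unit ball, outward normal first). Without orientations it is the number of points of $G^{-1}(x)$ mod $2$. *Linking manifold.* Let $(g_1,g_2)$ be an unlink: smooth maps $g_i:P_i\to N$ whose images lie in disjoint open balls. A lift $\alpha$ of $(f_1,f_2)$ to the homotopy fiber over $(g_1,g_2)$ of $\mathrm{Link}(P_1,P_2;N)\to\mathrm{map}(P_1,N)\times\mathrm{map}(P_2,N)$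 is a pair of smooth homotopies $f_{1,t},f_{2,t}$, $t\in[0,1]$, with $f_{i,0}=g_i$ and $f_{i,1}=f_i$. It is transverse if $F_\alpha:[0,1]\times P_1\times P_2\to N\times N$, $F_\alpha(t,x_1,x_2)=(f_{1,t}(x_1),f_{2,t}(x_2))$ is transverse to the diagonal $\Delta_N$. The linking manifold $l_2(\alpha)$ of a transverse lift is $L_\alpha=F_\alpha^{-1}(\Delta_N)$, with its map to $E_{12}=\{(x_1,x_2,\omega)\mid \omega:[-1,1]\to N,\ \omega(-1)=g_1(x_1),\ \omega(1)=g_2(x_2)\}$ that sends $(t,x_1,x_2)$ to $x_1$, $x_2$ and the path $\omega(s)=f_{1,(1+s)t}(x_1)$ for $s\le 0$, $\omega(s)=f_{2,(1-s)t}(x_2)$ for $s\ge0$, and with the framing $D(f_{2,t}(x_2)-f_{1,t}(x_1)):\mathbb{R}\oplus T_{x_1}P_1\oplus T_{x_2}P_2\to N$ of its normal bundle. If $P_1,P_2$ are oriented, the sign of a point of $L_\alpha$ is $\pm1$ according to whether this framing preserves or reverses orientation. For an arbitrary lift one uses the transverse lifts that are homotopic to it relative to its ends. **Theorem.** 1.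 For every regular value $x$ of $G$, let $L=G^{-1}(x)$ and $L_3=\{(t,x_1,x_2)\in[0,\infty)\times P_1\times P_2\mid f_1(x_1)=f_2(x_2)-tx\}$. The projection $(t,x_1,x_2)\mapsto(x_1,x_2)$ is a bijection $L_3\to L$, and if $P_1$ and $P_2$ are oriented, it preserves signs, where the sign of a point of $L_3$ is that of the isomorphism $D(f_2(x_2)-tx-f_1(x_1))$, with $[0,\infty)$ oriented towards $0$ (i.e. from the unlink to the link). 2. Over every unlink $(g_1,g_2)$ in disjoint balls there is a lift of $(f_1,f_2)$, and every lift is homotopic relative to its ends to a transverse one. For every transverse lift $\alpha$, $L_\alpha$ is a closed framed $0$-manifold: a finite set of points, at each of which the framing is an isomorphism. 3. $G$ has a regular value, the inverse image of every regular value is finite, and its number of points mod $2$ does not depend on the regular value. For every unlink $(g_1,g_2)$ in disjoint balls and every transverse lift $\alpha$, the number of points of $L_\alpha$ is congruent to it mod $2$. 4. If $P_1$ and $P_2$ are oriented, the number of points of $G^{-1}(x)$, counted with signs, does not depend on the regular value $x$, and for every unlink $(g_1,g_2)$ in disjoint balls and every transverse lift $\alpha$ the number of points of $L_\alpha$, counted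 with signs, is equal to it. Hence the linking number defined by $l_2$ agrees with the classical one (in $\mathbb{Z}$ if $P_1$ and $P_2$ are oriented, and in $\mathbb{Z}/2$ in general), and it does not depend on the chosen lift or on the chosen unlink. -/

import Mathlib

open Set Topology Metric
open scoped Manifold ContDiff

noncomputable section

namespace LinkMaps

universe u v

/-- The ambient Euclidean space `ℝ ^ (p₁ + p₂ + 1)` in which manifolds of dimensions
`p₁` and `p₂` link. -/
abbrev Amb (p₁ p₂ : ℕ) : Type := EuclideanSpace ℝ (Fin (p₁ + p₂ + 1))

/-- The unit sphere `S ^ (p₁ + p₂)` in `ℝ ^ (p₁ + p₂ + 1)`. -/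
abbrev UnitSphere (p₁ p₂ : ℕ) : Type := sphere (0 : Amb p₁ p₂) 1

/-! ### Orientations and signs -/

section Orientations

variable {p : ℕ} {M : Type u} [TopologicalSpace M] [ChartedSpace (EuclideanSpace ℝ (Fin p)) M]

/-- The basis of `T_x M` given by the coordinates that Mathlib uses for `T_x M`. It serves only as
a reference: the signs below do not depend on it. -/
def tangentBasis (x : M) : Module.Basis (Fin p) ℝ (TangentSpace (𝓡 p) x) :=
  (EuclideanSpace.basisFun (Fin p) ℝ).toBasis

/-- An orientation of a smooth `p`-manifold: an orientation of every tangent space, locally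
constant with respect to the local trivializations of the tangent bundle. If `p = 0` this is
a choice of a sign at every point. -/
structure ManifoldOrientation (p : ℕ) (M : Type u) [TopologicalSpace M]
    [ChartedSpace (EuclideanSpace ℝ (Fin p)) M] [IsManifold (𝓡 p) ∞ M] where
  /-- the orientation of the tangent space at a point -/
  atPoint : ∀ x : M, Orientation ℝ (TangentSpace (𝓡 p) x) (Fin p)
  locallyConstant : ∀ x₀ : M, ∀ᶠ x in 𝓝 x₀,
    ∀ (hx₀ : x₀ ∈ (trivializationAt (EuclideanSpace ℝ (Fin p))
        (TangentSpace (𝓡 p) : M → Type) x₀).baseSet)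
      (hx : x ∈ (trivializationAt (EuclideanSpace ℝ (Fin p))
        (TangentSpace (𝓡 p) : M → Type) x₀).baseSet),
      Orientation.map (Fin p)
          ((trivializationAt (EuclideanSpace ℝ (Fin p))
            (TangentSpace (𝓡 p) : M → Type) x₀).continuousLinearEquivAt ℝ x hx).toLinearEquiv
          (atPoint x) =
        Orientation.map (Fin p)
          ((trivializationAt (EuclideanSpace ℝ (Fin p))
            (TangentSpace (𝓡 p) : M → Type) x₀).continuousLinearEquivAt ℝ x₀ hx₀).toLinearEquiv
          (atPoint x₀)

/-- `+1` if the reference basis of `T_x M` is positively oriented, and `-1` otherwise. -/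
def basisSign (x : M) (o : Orientation ℝ (TangentSpace (𝓡 p) x) (Fin p)) : ℤ :=
  open Classical in if (tangentBasis x).orientation = o then 1 else -1

end Orientations

section TwoManifolds

variable {p₁ p₂ : ℕ}
  {P₁ : Type u} [TopologicalSpace P₁] [ChartedSpace (EuclideanSpace ℝ (Fin p₁)) P₁]
  {P₂ : Type v} [TopologicalSpace P₂] [ChartedSpace (EuclideanSpace ℝ (Fin p₂)) P₂]

/-- Let `v` and `w` be positively oriented bases of `T_{x₁} P₁` and `T_{x₂} P₂`, `e` a vector of
`ℝ ^ (p₁ + p₂ + 1)` and `A : T_{x₁} P₁ × T_{x₂} P₂ → ℝ ^ (p₁ + p₂ + 1)` a linear map. This is the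
sign of the determinant of the vectors `e, A (v₁, 0), …, A (0, w₁), …`, in this order. (The bases
used are the reference bases, corrected by their signs, so that dimension `0` is covered.) -/
def frameSign (x₁ : P₁) (x₂ : P₂)
    (o₁ : Orientation ℝ (TangentSpace (𝓡 p₁) x₁) (Fin p₁))
    (o₂ : Orientation ℝ (TangentSpace (𝓡 p₂) x₂) (Fin p₂))
    (e : Amb p₁ p₂)
    (A : TangentSpace (𝓡 p₁) x₁ × TangentSpace (𝓡 p₂) x₂ →ₗ[ℝ] Amb p₁ p₂) : ℤ :=
  basisSign x₁ o₁ * basisSign x₂ o₂ *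
    (SignType.sign ((EuclideanSpace.basisFun (Fin (p₁ + p₂ + 1)) ℝ).toBasis.det
      (Fin.cons e (Fin.append (fun i => A (tangentBasis x₁ i, 0))
        (fun j => A (0, tangentBasis x₂ j))))) : ℤ)

/-! ### Link maps, the Gauss map, and its degree -/

/-- A smooth link map: two smooth maps with disjoint images. -/
structure IsLinkMap (f₁ : P₁ → Amb p₁ p₂) (f₂ : P₂ → Amb p₁ p₂) : Prop where
  smooth₁ : ContMDiff (𝓡 p₁) 𝓘(ℝ, Amb p₁ p₂) ∞ f₁
  smooth₂ : ContMDiff (𝓡 p₂) 𝓘(ℝ, Amb p₁ p₂) ∞ f₂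
  disjoint : Disjoint (range f₁) (range f₂)

/-- An unlink in disjoint balls: two smooth maps whose images lie in disjoint open balls. -/
structure IsUnlink (g₁ : P₁ → Amb p₁ p₂) (g₂ : P₂ → Amb p₁ p₂) : Prop where
  smooth₁ : ContMDiff (𝓡 p₁) 𝓘(ℝ, Amb p₁ p₂) ∞ g₁
  smooth₂ : ContMDiff (𝓡 p₂) 𝓘(ℝ, Amb p₁ p₂) ∞ g₂
  balls : ∃ (c₁ c₂ : Amb p₁ p₂) (r₁ r₂ : ℝ), Disjoint (ball c₁ r₁) (ball c₂ r₂) ∧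
    range g₁ ⊆ ball c₁ r₁ ∧ range g₂ ⊆ ball c₂ r₂

theorem IsLinkMap.sub_ne_zero {f₁ : P₁ → Amb p₁ p₂} {f₂ : P₂ → Amb p₁ p₂}
    (hf : IsLinkMap f₁ f₂) (x₁ : P₁) (x₂ : P₂) : f₂ x₂ - f₁ x₁ ≠ 0 := fun h =>
  Set.disjoint_left.mp hf.disjoint (mem_range_self x₁)
    (sub_eq_zero.mp h ▸ mem_range_self x₂)

/-- The Gauss map `(x₁, x₂) ↦ (f₂ x₂ - f₁ x₁) / ‖f₂ x₂ - f₁ x₁‖` of a link map. -/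
def gaussMap {f₁ : P₁ → Amb p₁ p₂} {f₂ : P₂ → Amb p₁ p₂} (hf : IsLinkMap f₁ f₂) (q : P₁ × P₂) :
    UnitSphere p₁ p₂ :=
  ⟨‖f₂ q.2 - f₁ q.1‖⁻¹ • (f₂ q.2 - f₁ q.1), by
    have h : ‖f₂ q.2 - f₁ q.1‖ ≠ 0 := norm_ne_zero_iff.mpr (hf.sub_ne_zero q.1 q.2)
    rw [mem_sphere_zero_iff_norm, norm_smul, norm_inv, norm_norm, inv_mul_cancel₀ h]⟩

/-- `x` is a regular value of `G : P₁ × P₂ → S ^ (p₁ + p₂)`. -/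
def IsRegularValue (G : P₁ × P₂ → UnitSphere p₁ p₂) (x : UnitSphere p₁ p₂) : Prop :=
  ∀ q, G q = x → Function.Surjective (mfderiv ((𝓡 p₁).prod (𝓡 p₂)) (𝓡 (p₁ + p₂)) G q)

/-- The derivative of `G : P₁ × P₂ → S ^ (p₁ + p₂)` at a point, followed by the inclusion of the
tangent space of the sphere into the ambient Euclidean space. -/
def sphereDeriv (G : P₁ × P₂ → UnitSphere p₁ p₂) (q : P₁ × P₂) :
    TangentSpace (𝓡 p₁) q.1 × TangentSpace (𝓡 p₂) q.2 →ₗ[ℝ] Amb p₁ p₂ :=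
  (mfderiv (𝓡 (p₁ + p₂)) 𝓘(ℝ, Amb p₁ p₂) (fun y : UnitSphere p₁ p₂ => (y : Amb p₁ p₂)) (G q)
    ).toLinearMap ∘ₗ (mfderiv ((𝓡 p₁).prod (𝓡 p₂)) (𝓡 (p₁ + p₂)) G q).toLinearMap

variable [IsManifold (𝓡 p₁) ∞ P₁] [IsManifold (𝓡 p₂) ∞ P₂]

/-- The sign at `q` of a map `G` to the sphere, i.e. `+1` or `-1` according to whether the derivative
of `G` at `q` preserves or reverses orientation. The sphere is oriented as the boundary of the unit
ball: a basis `b` of `T_x S` is positive if the outward normal `x` followed by `b` is positive. -/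
def sphereSign (o₁ : ManifoldOrientation p₁ P₁) (o₂ : ManifoldOrientation p₂ P₂)
    (G : P₁ × P₂ → UnitSphere p₁ p₂) (q : P₁ × P₂) : ℤ :=
  frameSign q.1 q.2 (o₁.atPoint q.1) (o₂.atPoint q.2) (G q) (sphereDeriv G q)

/-- `G : P₁ × P₂ → S ^ (p₁ + p₂)` has degree `d`: there are regular values, and the inverse image
of every regular value is finite and has `d` points when these are counted with signs. -/
def HasDegree (o₁ : ManifoldOrientation p₁ P₁) (o₂ : ManifoldOrientation p₂ P₂)
    (G : P₁ × P₂ → UnitSphere p₁ p₂) (d : ℤ) : Prop :=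
  (∃ x, IsRegularValue G x) ∧
    ∀ x, IsRegularValue G x → (G ⁻¹' {x}).Finite ∧ ∑ᶠ q ∈ G ⁻¹' {x}, sphereSign o₁ o₂ G q = d

/-- The mod `2` analogue of `HasDegree`, which needs no orientations. -/
def HasDegreeModTwo {p₁ p₂ : ℕ}
    {P₁ : Type u} [TopologicalSpace P₁] [ChartedSpace (EuclideanSpace ℝ (Fin p₁)) P₁]
    {P₂ : Type v} [TopologicalSpace P₂] [ChartedSpace (EuclideanSpace ℝ (Fin p₂)) P₂]
    (G : P₁ × P₂ → UnitSphere p₁ p₂) (d : ZMod 2) : Prop :=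
  (∃ x, IsRegularValue G x) ∧
    ∀ x, IsRegularValue G x → (G ⁻¹' {x}).Finite ∧ ((G ⁻¹' {x}).ncard : ZMod 2) = d

end TwoManifolds

/-! ### The homotopy pullback and framed `0`-manifolds over it -/

section Framed

variable {p₁ p₂ : ℕ}
  {P₁ : Type u} [TopologicalSpace P₁] [ChartedSpace (EuclideanSpace ℝ (Fin p₁)) P₁]
  {P₂ : Type v} [TopologicalSpace P₂] [ChartedSpace (EuclideanSpace ℝ (Fin p₂)) P₂]

/-- The homotopy pullback `E₁₂` of `g₁ : P₁ → N ← P₂ : g₂`, where `N = ℝ ^ (p₁ + p₂ + 1)`: points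
`x₁`, `x₂` with a path `ω : [-1, 1] → N` from `g₁ x₁` to `g₂ x₂`. -/
structure HomotopyPullback (g₁ : P₁ → Amb p₁ p₂) (g₂ : P₂ → Amb p₁ p₂) where
  fst : P₁
  snd : P₂
  path : C(Icc (-1 : ℝ) 1, Amb p₁ p₂)
  source : path ⟨-1, by norm_num⟩ = g₁ fst
  target : path ⟨1, by norm_num⟩ = g₂ snd

/-- Data of a framed `0`-manifold over `E₁₂`, a vertex of `Ω C₂(P₁, P₂; N)`: a set of
points of `[0, 1] × P₁ × P₂`, a reference map to `E₁₂`, and over every point a linear map from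
`ℝ ⊕ T P₁ ⊕ T P₂` (where `ℝ` is the loop direction) to `T N = N`, which is the framing. -/
structure FramedPoints (g₁ : P₁ → Amb p₁ p₂) (g₂ : P₂ → Amb p₁ p₂) where
  carrier : Set (ℝ × P₁ × P₂)
  ref : carrier → HomotopyPullback g₁ g₂
  framing : ∀ w : carrier,
    ℝ × TangentSpace (𝓡 p₁) (ref w).fst × TangentSpace (𝓡 p₂) (ref w).snd →ₗ[ℝ] Amb p₁ p₂

namespace FramedPoints

variable {g₁ : P₁ → Amb p₁ p₂} {g₂ : P₂ → Amb p₁ p₂}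

/-- The points form a closed (compact, without boundary) framed manifold of dimension `0`: there
are finitely many of them, and all framings are isomorphisms. -/
def IsClosedFramed (W : FramedPoints g₁ g₂) : Prop :=
  W.carrier.Finite ∧ ∀ w, Function.Bijective (W.framing w)

/-- The number of points mod `2`. -/
def countModTwo (W : FramedPoints g₁ g₂) : ZMod 2 := (W.carrier.ncard : ZMod 2)

variable [IsManifold (𝓡 p₁) ∞ P₁] [IsManifold (𝓡 p₂) ∞ P₂]

/-- The sign of a framed point: `+1` or `-1` according to whether the framing
`ℝ ⊕ T P₁ ⊕ T P₂ → ℝ ^ (p₁ + p₂ + 1)` preserves or reverses orientation. -/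
def sign (o₁ : ManifoldOrientation p₁ P₁) (o₂ : ManifoldOrientation p₂ P₂)
    (W : FramedPoints g₁ g₂) (w : W.carrier) : ℤ :=
  frameSign (W.ref w).fst (W.ref w).snd (o₁.atPoint _) (o₂.atPoint _)
    (W.framing w (1, 0)) (W.framing w ∘ₗ LinearMap.inr ℝ ℝ _)

/-- The number of points, counted with signs. -/
def signedCount (o₁ : ManifoldOrientation p₁ P₁) (o₂ : ManifoldOrientation p₂ P₂)
    (W : FramedPoints g₁ g₂) : ℤ :=
  ∑ᶠ w : W.carrier, W.sign o₁ o₂ w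

end FramedPoints

/-- The derivative of `F₂ - F₁`, relative to a set `s`, for a map `F = (F₁, F₂)` from `ℝ × P₁ × P₂`
to `N × N`: the derivative of `F` followed by the projection `(v₁, v₂) ↦ v₂ - v₁` to the normal
bundle of the diagonal, which is identified with `T N` in this way. -/
def normalDeriv (F : ℝ × P₁ × P₂ → Amb p₁ p₂ × Amb p₁ p₂) (s : Set (ℝ × P₁ × P₂))
    (q : ℝ × P₁ × P₂) :
    ℝ × TangentSpace (𝓡 p₁) q.2.1 × TangentSpace (𝓡 p₂) q.2.2 →ₗ[ℝ] Amb p₁ p₂ :=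
  (LinearMap.snd ℝ (Amb p₁ p₂) (Amb p₁ p₂) - LinearMap.fst ℝ (Amb p₁ p₂) (Amb p₁ p₂)) ∘ₗ
    (mfderivWithin (𝓘(ℝ, ℝ).prod ((𝓡 p₁).prod (𝓡 p₂))) 𝓘(ℝ, Amb p₁ p₂ × Amb p₁ p₂) F s
      q).toLinearMap

/-- `F`, restricted to `s`, is transverse to the diagonal of `N × N`. -/
def IsTransverseToDiagonal (F : ℝ × P₁ × P₂ → Amb p₁ p₂ × Amb p₁ p₂)
    (s : Set (ℝ × P₁ × P₂)) : Prop :=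
  ∀ q ∈ s, F q ∈ diagonal (Amb p₁ p₂) →
    LinearMap.range (show ℝ × TangentSpace (𝓡 p₁) q.2.1 × TangentSpace (𝓡 p₂) q.2.2 →ₗ[ℝ]
        Amb p₁ p₂ × Amb p₁ p₂ from
      (mfderivWithin (𝓘(ℝ, ℝ).prod ((𝓡 p₁).prod (𝓡 p₂))) 𝓘(ℝ, Amb p₁ p₂ × Amb p₁ p₂) F s
        q).toLinearMap) ⊔
      LinearMap.range (LinearMap.prod (LinearMap.id : Amb p₁ p₂ →ₗ[ℝ] Amb p₁ p₂) LinearMap.id) = ⊤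

/-! ### Points of the homotopy fiber and their linking manifolds -/

/-- A point `α` of the homotopy fiber over `(g₁, g₂)` of
`Link(P₁, P₂; N) → map(P₁, N) × map(P₂, N)` that ends at `(f₁, f₂)`: smooth homotopies, with
parameter in `[0, 1]`, from `g₁` to `f₁` and from `g₂` to `f₂`. (In the theorem `(f₁, f₂)` is
a link map. Values at parameters outside `[0, 1]` are irrelevant.) -/
structure Lift (g₁ f₁ : P₁ → Amb p₁ p₂) (g₂ f₂ : P₂ → Amb p₁ p₂) where
  map₁ : ℝ → P₁ → Amb p₁ p₂
  map₂ : ℝ → P₂ → Amb p₁ p₂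
  smooth₁ : ContMDiffOn (𝓘(ℝ, ℝ).prod (𝓡 p₁)) 𝓘(ℝ, Amb p₁ p₂) ∞
    (fun q : ℝ × P₁ => map₁ q.1 q.2) (Icc 0 1 ×ˢ univ)
  smooth₂ : ContMDiffOn (𝓘(ℝ, ℝ).prod (𝓡 p₂)) 𝓘(ℝ, Amb p₁ p₂) ∞
    (fun q : ℝ × P₂ => map₂ q.1 q.2) (Icc 0 1 ×ˢ univ)
  map₁_zero : map₁ 0 = g₁
  map₂_zero : map₂ 0 = g₂
  map₁_one : map₁ 1 = f₁
  map₂_one : map₂ 1 = f₂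

namespace Lift

variable {g₁ f₁ : P₁ → Amb p₁ p₂} {g₂ f₂ : P₂ → Amb p₁ p₂}

/-- The cylinder `[0, 1] × P₁ × P₂`. -/
def cylinder (P₁ : Type u) (P₂ : Type v) : Set (ℝ × P₁ × P₂) := Icc 0 1 ×ˢ univ

/-- The map `(t, x₁, x₂) ↦ (f_{1,t} x₁, f_{2,t} x₂)` of a lift. -/
def total (α : Lift g₁ f₁ g₂ f₂) (q : ℝ × P₁ × P₂) : Amb p₁ p₂ × Amb p₁ p₂ :=
  (α.map₁ q.1 q.2.1, α.map₂ q.1 q.2.2)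

/-- The map of a lift is transverse to the diagonal. -/
def IsTransverse (α : Lift g₁ f₁ g₂ f₂) : Prop :=
  IsTransverseToDiagonal α.total (cylinder P₁ P₂)

/-- The underlying set of the linking manifold: the inverse image of the diagonal. -/
def linkingSet (α : Lift g₁ f₁ g₂ f₂) : Set (ℝ × P₁ × P₂) :=
  {q | q ∈ cylinder P₁ P₂ ∧ α.total q ∈ diagonal (Amb p₁ p₂)}

theorem continuousOn_map₁ (α : Lift g₁ f₁ g₂ f₂) (x : P₁) :
    ContinuousOn (fun t => α.map₁ t x) (Icc 0 1) :=
  α.smooth₁.continuousOn.comp (f := fun t : ℝ => (t, x)) (by fun_prop) (fun t ht => ⟨ht, mem_univ _⟩)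

theorem continuousOn_map₂ (α : Lift g₁ f₁ g₂ f₂) (x : P₂) :
    ContinuousOn (fun t => α.map₂ t x) (Icc 0 1) :=
  α.smooth₂.continuousOn.comp (f := fun t : ℝ => (t, x)) (by fun_prop) (fun t ht => ⟨ht, mem_univ _⟩)

/-- The path `[-1, 1] → N` at a point `(t, x₁, x₂)` of the linking manifold: `s ↦ f_{1,(1+s)t} x₁`
for `s ≤ 0` and `s ↦ f_{2,(1-s)t} x₂` for `s ≥ 0`. -/
def linkingPath (α : Lift g₁ f₁ g₂ f₂) (w : α.linkingSet) : C(Icc (-1 : ℝ) 1, Amb p₁ p₂) where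
  toFun s := if (s : ℝ) ≤ 0 then α.map₁ ((1 + s) * w.1.1) w.1.2.1
    else α.map₂ ((1 - s) * w.1.1) w.1.2.2
  continuous_toFun := by
    obtain ⟨⟨t, x₁, x₂⟩, ⟨ht, -⟩, hd⟩ := w
    simp only [mem_Icc] at ht
    refine continuous_if_le continuous_subtype_val continuous_const ?_ ?_ ?_
    · refine (α.continuousOn_map₁ x₁).comp (f := fun s : Icc (-1 : ℝ) 1 => (1 + (s : ℝ)) * t)
        (by fun_prop) ?_
      rintro ⟨s, h1, h2⟩ (h3 : s ≤ 0)
      constructor <;> dsimp only <;> nlinarith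
    · refine (α.continuousOn_map₂ x₂).comp (f := fun s : Icc (-1 : ℝ) 1 => (1 - (s : ℝ)) * t)
        (by fun_prop) ?_
      rintro ⟨s, h1, h2⟩ (h3 : 0 ≤ s)
      constructor <;> dsimp only <;> nlinarith
    · intro s hs
      have h : α.map₁ t x₁ = α.map₂ t x₂ := hd
      simpa [hs] using h

/-- The linking manifold `l₂(α)` of a transverse lift `α`: the inverse image of the diagonal, with its
reference map to `E₁₂` and the framing of its normal bundle given by transversality. -/
def linkingManifold (α : Lift g₁ f₁ g₂ f₂) : FramedPoints g₁ g₂ where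
  carrier := α.linkingSet
  ref w :=
    { fst := w.1.2.1
      snd := w.1.2.2
      path := α.linkingPath w
      source := by simp [linkingPath, α.map₁_zero]
      target := by simp [linkingPath, α.map₂_zero, not_le.mpr (zero_lt_one' ℝ)] }
  framing w := normalDeriv α.total (cylinder P₁ P₂) w.1

/-- Two lifts with the same ends are homotopic relative to these ends, by smooth homotopies
with parameters `(s, t) ∈ [0, 1] × [0, 1]`. -/
def Homotopic (α β : Lift g₁ f₁ g₂ f₂) : Prop :=
  ∃ (H₁ : ℝ × ℝ → P₁ → Amb p₁ p₂) (H₂ : ℝ × ℝ → P₂ → Amb p₁ p₂),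
    ContMDiffOn (𝓘(ℝ, ℝ × ℝ).prod (𝓡 p₁)) 𝓘(ℝ, Amb p₁ p₂) ∞
      (fun q : (ℝ × ℝ) × P₁ => H₁ q.1 q.2) ((Icc 0 1 ×ˢ Icc 0 1) ×ˢ univ) ∧
    ContMDiffOn (𝓘(ℝ, ℝ × ℝ).prod (𝓡 p₂)) 𝓘(ℝ, Amb p₁ p₂) ∞
      (fun q : (ℝ × ℝ) × P₂ => H₂ q.1 q.2) ((Icc 0 1 ×ˢ Icc 0 1) ×ˢ univ) ∧
    (∀ t ∈ Icc (0 : ℝ) 1, H₁ (0, t) = α.map₁ t ∧ H₂ (0, t) = α.map₂ t ∧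
      H₁ (1, t) = β.map₁ t ∧ H₂ (1, t) = β.map₂ t) ∧
    ∀ s ∈ Icc (0 : ℝ) 1, H₁ (s, 0) = g₁ ∧ H₂ (s, 0) = g₂ ∧ H₁ (s, 1) = f₁ ∧ H₂ (s, 1) = f₂

/-- The linking number mod `2` of a lift `α`, obtained from `l₂`, is `k`: `α` is homotopic to
a transverse lift, and every transverse lift homotopic to `α` has a closed framed linking manifold
with `k` points mod `2`. -/
def HasLinkingNumberModTwo (α : Lift g₁ f₁ g₂ f₂) (k : ZMod 2) : Prop :=
  (∃ β : Lift g₁ f₁ g₂ f₂, α.Homotopic β ∧ β.IsTransverse) ∧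
    ∀ β : Lift g₁ f₁ g₂ f₂, α.Homotopic β → β.IsTransverse →
      β.linkingManifold.IsClosedFramed ∧ β.linkingManifold.countModTwo = k

/-- The linking number of a lift `α`, obtained from `l₂`, is `k`: `α` is homotopic to
a transverse lift, and every transverse lift homotopic to `α` has a closed framed linking manifold
with `k` points when these are counted with signs. -/
def HasLinkingNumber [IsManifold (𝓡 p₁) ∞ P₁] [IsManifold (𝓡 p₂) ∞ P₂]
    (o₁ : ManifoldOrientation p₁ P₁) (o₂ : ManifoldOrientation p₂ P₂)
    (α : Lift g₁ f₁ g₂ f₂) (k : ℤ) : Prop :=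
  (∃ β : Lift g₁ f₁ g₂ f₂, α.Homotopic β ∧ β.IsTransverse) ∧
    ∀ β : Lift g₁ f₁ g₂ f₂, α.Homotopic β → β.IsTransverse →
      β.linkingManifold.IsClosedFramed ∧ β.linkingManifold.signedCount o₁ o₂ = k

end Lift

/-! ### Moving `f₂` away along a ray -/

/-- The map `(t, x₁, x₂) ↦ (f₁ x₁, f₂ x₂ - t x)`. -/
def rayMap (f₁ : P₁ → Amb p₁ p₂) (f₂ : P₂ → Amb p₁ p₂) (x : Amb p₁ p₂) (q : ℝ × P₁ × P₂) :
    Amb p₁ p₂ × Amb p₁ p₂ :=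
  (f₁ q.2.1, f₂ q.2.2 - q.1 • x)

/-- The domain `[0, ∞) × P₁ × P₂`. -/
def halfCylinder (P₁ : Type u) (P₂ : Type v) : Set (ℝ × P₁ × P₂) := Ici 0 ×ˢ univ

/-- The inverse image `L₃` of the diagonal in `[0, ∞) × P₁ × P₂` under `rayMap`. -/
def raySet (f₁ : P₁ → Amb p₁ p₂) (f₂ : P₂ → Amb p₁ p₂) (x : Amb p₁ p₂) : Set (ℝ × P₁ × P₂) :=
  {q | q ∈ halfCylinder P₁ P₂ ∧ rayMap f₁ f₂ x q ∈ diagonal (Amb p₁ p₂)}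

/-- The sign of a point of `L₃`. Here `[0, ∞)` is oriented towards `0`, because the link is at
`t = 0`, while lifts run from the unlink to the link. -/
def raySign [IsManifold (𝓡 p₁) ∞ P₁] [IsManifold (𝓡 p₂) ∞ P₂]
    (o₁ : ManifoldOrientation p₁ P₁) (o₂ : ManifoldOrientation p₂ P₂)
    (f₁ : P₁ → Amb p₁ p₂) (f₂ : P₂ → Amb p₁ p₂) (x : Amb p₁ p₂) (q : ℝ × P₁ × P₂) : ℤ :=
  frameSign q.2.1 q.2.2 (o₁.atPoint _) (o₂.atPoint _)
    (normalDeriv (rayMap f₁ f₂ x) (halfCylinder P₁ P₂) q (-1, 0))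
    (normalDeriv (rayMap f₁ f₂ x) (halfCylinder P₁ P₂) q ∘ₗ LinearMap.inr ℝ ℝ _)

end Framed

end LinkMaps

end

/-! The difference D(t, x₁, x₂) = f_{2,t}(x₂) - f_{1,t}(x₁) of a lift is a map between manifolds of
the same dimension p₁ + p₂ + 1, and it has no zeros at t = 0 and t = 1, where the images are
disjoint. The linking points are the zeros of D in the open cylinder, transversality means that they
are regular, and their signed number is a local degree of D at 0. The theorem follows from the
homotopy invariance of this degree and one explicit family of lifts.

The explicit lifts are the `rayLift`s: f₁ rests, and f₂ comes in along a ray from f₂ - T x, where T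
exceeds all distances between the images. A zero occurs over (x₁, x₂) exactly if f₂(x₂) - f₁(x₁) is
a positive multiple of x, that is, if G(x₁, x₂) = x, and the Jacobian there is a positive multiple
of the determinant of the frame (x, DG) (`jac_scaled`). So the ray lift counts the inverse image of
x under G (`zeroCount_rayLift`).

For a lift over an unlink, g₂ - g₁ takes values in an open half-space ⟨·, u⟩ > 0. If ⟨x, u⟩ < 0 and
T is large, the start of the ray lift does the same. Half-spaces are convex, so the linear homotopy
between the two difference maps has no zeros at the ends, and the counts agree
(`zeroCount_eq_degreeCount`). Comparing two ray lifts in this way shows that regular values which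
are not antipodal have the same count; antipodal ones are joined through a third value, which needs
p₁ + p₂ ≥ 1 (`degreeCount_eq`).

Homotopy invariance is obtained by integration. In Euclidean space, for φ concentrated near 0, the
integral of φ(F) det DF counts the zeros of F with signs (`setIntegral_comp_mul_det_eq`), and a
compactly supported change of F changes the integrand by a divergence
(`integral_comp_mul_det_sub_eq_zero`). On a manifold, a linear homotopy is cut into finitely many
changes, each supported in a coordinate neighbourhood, and a generic small translation keeps all
intermediate zeros regular (`zeroCount_eq_of_linear_homotopy`). Signs are weighted by a coherent
function with values in a ring, so that ℤ with orientations and ℤ/2 with weight 1 are treated at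
once. -/

/-! ### The determinant of the derivative is a null Lagrangian -/

namespace LinkMaps

section NullLagrangian

open MeasureTheory

variable {E : Type*} [NormedAddCommGroup E] [NormedSpace ℝ E] {ι : Type*} [Fintype ι]
  [DecidableEq ι]

theorem two_le_infty : (2 : WithTop ℕ∞) ≤ ∞ :=
  WithTop.coe_le_coe.mpr (le_top : (2 : ℕ∞) ≤ ⊤)

theorem one_add_one_le_infty : (1 + 1 : WithTop ℕ∞) ≤ ∞ :=
  one_add_one_eq_two.trans_le two_le_infty

/-- The terms cancel in pairs: exchanging j and k swaps two arguments of an alternating form, while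
`w` is symmetric. With second derivatives for `w`, this says that the cofactors of a derivative are
divergence free. -/
theorem sum_alternating_update_eq_zero (vol : E [⋀^ι]→ₗ[ℝ] ℝ) (A : ι → E) (h : E) (w : ι → ι → E)
    (hw : ∀ j k, w j k = w k j) :
    ∑ j, ∑ k ∈ Finset.univ.erase j,
      vol (Function.update (Function.update A j h) k (w j k)) = 0 := by
  have key : ∀ j k, j ≠ k → vol (Function.update (Function.update A j h) k (w j k)) =
      -vol (Function.update (Function.update A k h) j (w k j)) := by
    intro j k hjk
    rw [← vol.map_swap _ hjk, hw j k]
    congr 1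
    ext i
    rcases eq_or_ne i j with rfl | hij
    · simp [Function.update_of_ne hjk, Function.update_of_ne hjk.symm]
    rcases eq_or_ne i k with rfl | hik
    · simp
    · simp [Function.update_of_ne, hij, hik, Equiv.swap_apply_of_ne_of_ne]
  have h1 : ∀ (f : ι → ι → ℝ), ∑ j, ∑ k ∈ Finset.univ.erase j, f j k
      = ∑ j, ∑ k, if j = k then 0 else f j k := by
    intro f
    refine Finset.sum_congr rfl fun j _ => ?_
    rw [← Finset.sum_erase Finset.univ (a := j) (by simp)]
    refine Finset.sum_congr rfl fun k hk => ?_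
    rw [if_neg (Finset.ne_of_mem_erase hk).symm]
  rw [h1]
  set g : ι → ι → ℝ := fun j k =>
    if j = k then 0 else vol (Function.update (Function.update A j h) k (w j k)) with hg
  have h2 : ∀ j k, g j k = -g k j := by
    intro j k
    simp only [hg]
    by_cases hjk : j = k
    · simp [hjk]
    · rw [if_neg hjk, if_neg (Ne.symm hjk), key j k hjk]
  have h3 : ∑ j, ∑ k, g j k = -∑ j, ∑ k, g j k := by
    conv_lhs => rw [Finset.sum_comm]
    rw [← Finset.sum_neg_distrib]
    refine Finset.sum_congr rfl fun j _ => ?_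
    rw [← Finset.sum_neg_distrib]
    exact Finset.sum_congr rfl fun k _ => h2 k j
  linarith

/-- Cramer's rule, applied to the matrix with columns `A` and the right-hand side `v`. -/
theorem sum_det_update_smul (b : Module.Basis ι ℝ E) (A : ι → E) (v : E) :
    ∑ j, b.det (Function.update A j v) • A j = b.det A • v := by
  apply b.ext_elem
  intro i
  have := congrFun (Matrix.mulVec_cramer (b.toMatrix A) (b.repr v)) i
  simp only [Matrix.mulVec, dotProduct, Matrix.cramer_apply, Pi.smul_apply, smul_eq_mul] at this
  simp only [map_sum, map_smul, Finsupp.coe_finsetSum, Finset.sum_apply, Finsupp.smul_apply,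
    smul_eq_mul, Module.Basis.det_apply]
  rw [← this]
  refine Finset.sum_congr rfl fun j _ => ?_
  rw [mul_comm, Module.Basis.toMatrix_update]
  rfl

/-- The determinant relative to a basis, as a continuous multilinear map. -/
noncomputable def detMap [FiniteDimensional ℝ E] (b : Module.Basis ι ℝ E) :
    ContinuousMultilinearMap ℝ (fun _ : ι => E) ℝ where
  toMultilinearMap := b.det.toMultilinearMap
  cont := by
    change Continuous fun A : ι → E => b.det A
    simp only [Module.Basis.det_apply]
    refine Continuous.matrix_det (continuous_pi fun i => continuous_pi fun j => ?_)
    exact (b.coord i).continuous_of_finiteDimensional.comp (continuous_apply j)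

variable [FiniteDimensional ℝ E]

theorem detMap_apply (b : Module.Basis ι ℝ E) (A : ι → E) : detMap b A = b.det A := rfl

theorem detMap_comp (b : Module.Basis ι ℝ E) (A : E →L[ℝ] E) :
    detMap b (fun i => A (b i)) = A.det := by
  have := b.det_comp (A : E →ₗ[ℝ] E) b
  rw [b.det_self, mul_one] at this
  exact this

/-- The divergence of the cofactor field of a variation `h` is the derivative of φ(F + s h) det D(F
+ s h) at s = 0. The second derivatives of `F` cancel by `sum_alternating_update_eq_zero`, and the
terms with the derivative of φ are collected by `sum_det_update_smul`. -/
theorem sum_deriv_cofactor_field (b : Module.Basis ι ℝ E) {F h : E → E} {φ : E → ℝ}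
    (hF : ContDiff ℝ ∞ F) (hh : ContDiff ℝ ∞ h) (hφ : ContDiff ℝ ∞ φ) (x : E) :
    ∑ j, fderiv ℝ (fun x => φ (F x) *
        detMap b (Function.update (fun k => fderiv ℝ F x (b k)) j (h x))) x (b j) =
      fderiv ℝ φ (F x) (h x) * detMap b (fun k => fderiv ℝ F x (b k)) +
      φ (F x) * ∑ j, detMap b (Function.update (fun k => fderiv ℝ F x (b k)) j
        (fderiv ℝ h x (b j))) := by
  set A : ι → E := fun k => fderiv ℝ F x (b k) with hA
  have hF1 : HasFDerivAt F (fderiv ℝ F x) x := (hF.differentiable (by simp) x).hasFDerivAt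
  have hh1 : HasFDerivAt h (fderiv ℝ h x) x := (hh.differentiable (by simp) x).hasFDerivAt
  have hφ1 : HasFDerivAt φ (fderiv ℝ φ (F x)) (F x) :=
    (hφ.differentiable (by simp) _).hasFDerivAt
  have hF2 : HasFDerivAt (fderiv ℝ F) (fderiv ℝ (fderiv ℝ F) x) x :=
    ((hF.fderiv_right (m := 1) one_add_one_le_infty).differentiable (by simp) x).hasFDerivAt
  have hsymm : ∀ u v, fderiv ℝ (fderiv ℝ F) x u v = fderiv ℝ (fderiv ℝ F) x v u := by
    intro u v
    exact (hF.contDiffAt.isSymmSndFDerivAt (x := x) (by simpa using two_le_infty)).eq u v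
  have hcol : ∀ k, HasFDerivAt (fun x => fderiv ℝ F x (b k))
      ((fderiv ℝ (fderiv ℝ F) x).flip (b k)) x := by
    intro k
    have := hF2.clm_apply (hasFDerivAt_const (b k) x)
    simpa using this
  have hd : ∀ j, HasFDerivAt (fun x => φ (F x) *
        detMap b (Function.update (fun k => fderiv ℝ F x (b k)) j (h x)))
      (φ (F x) • (∑ i, (detMap b).toContinuousLinearMap (Function.update A j (h x)) i ∘SL
        (if i = j then fderiv ℝ h x else (fderiv ℝ (fderiv ℝ F) x).flip (b i))) +
        detMap b (Function.update A j (h x)) • (fderiv ℝ φ (F x) ∘SL fderiv ℝ F x)) x := by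
    intro j
    refine (hφ1.comp x hF1).mul ?_
    exact HasFDerivAt.multilinear_comp (detMap b)
      (g := fun i x => Function.update (fun k => fderiv ℝ F x (b k)) j (h x) i) (x := x)
      (g' := fun i => if i = j then fderiv ℝ h x else (fderiv ℝ (fderiv ℝ F) x).flip (b i))
      (by
        intro i
        rcases eq_or_ne i j with rfl | hij
        · simpa using hh1
        · simpa [hij] using hcol i)
  have hsum : ∀ j, fderiv ℝ (fun x => φ (F x) *
        detMap b (Function.update (fun k => fderiv ℝ F x (b k)) j (h x))) x (b j) =
      φ (F x) * detMap b (Function.update A j (fderiv ℝ h x (b j))) +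
      φ (F x) * (∑ i ∈ Finset.univ.erase j, detMap b (Function.update (Function.update A j (h x)) i
        (fderiv ℝ (fderiv ℝ F) x (b j) (b i)))) +
      fderiv ℝ φ (F x) (b.det (Function.update A j (h x)) • A j) := by
    intro j
    rw [(hd j).fderiv]
    simp only [add_apply, smul_apply, sum_apply, ContinuousLinearMap.comp_apply, smul_eq_mul,
      ContinuousMultilinearMap.toContinuousLinearMap_apply, map_smul]
    rw [← Finset.add_sum_erase Finset.univ _ (Finset.mem_univ j), mul_add]
    congr 1
    congr 1
    · simp
    · congr 1
      refine Finset.sum_congr rfl fun i hi => ?_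
      rw [if_neg (Finset.ne_of_mem_erase hi)]
      rfl
  simp only [hsum, Finset.sum_add_distrib, ← Finset.mul_sum]
  have hz := sum_alternating_update_eq_zero b.det A (h x)
    (fun j k => fderiv ℝ (fderiv ℝ F) x (b j) (b k)) (fun j k => hsymm _ _)
  simp only [detMap_apply]
  rw [hz, ← map_sum (fderiv ℝ φ (F x)), sum_det_update_smul, map_smul, smul_eq_mul]
  ring

variable [MeasurableSpace E] [BorelSpace E] (μ : Measure E) [μ.IsAddHaarMeasure]

/-- Integration by parts against the constant function 1. -/
theorem integral_fderiv_apply_eq_zero {g : E → ℝ} (hg : ContDiff ℝ 1 g) (hc : HasCompactSupport g)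
    (v : E) : ∫ x, fderiv ℝ g x v ∂μ = 0 := by
  have h := integral_mul_fderiv_eq_neg_fderiv_mul_of_integrable (μ := μ) (f := fun _ : E => (1 : ℝ))
    (g := g) (v := v) (by simp)
    (by
      simp only [one_mul]
      refine Continuous.integrable_of_hasCompactSupport ?_ (hc.fderiv_apply (𝕜 := ℝ) v)
      exact (hg.continuous_fderiv (by simp)).clm_apply continuous_const)
    (by
      simp only [one_mul]
      exact hg.continuous.integrable_of_hasCompactSupport hc)
    (fun _ _ => differentiableAt_const _) (fun x _ => hg.differentiable (by simp) x)
  simpa using h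

/-- The integral of `φ ∘ F * det DF` does not change when `F` is changed on a compact set. -/
theorem integral_comp_mul_det_sub_eq_zero {F₀ F₁ : E → E} {φ : E → ℝ} (h₀ : ContDiff ℝ ∞ F₀)
    (h₁ : ContDiff ℝ ∞ F₁) (hφ : ContDiff ℝ ∞ φ) (hc : HasCompactSupport (F₁ - F₀)) :
    ∫ x, (φ (F₁ x) * (fderiv ℝ F₁ x).det - φ (F₀ x) * (fderiv ℝ F₀ x).det) ∂μ = 0 := by
  let b := Module.finBasis ℝ E
  set h : E → E := F₁ - F₀ with hh
  have hhs : ContDiff ℝ ∞ h := h₁.sub h₀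
  let F : ℝ → E → E := fun s x => F₀ x + s • h x
  have hFs : ∀ s, ContDiff ℝ ∞ (F s) := fun s => h₀.add (contDiff_const.smul hhs)
  have hDF : ∀ s x, fderiv ℝ (F s) x = fderiv ℝ F₀ x + s • fderiv ℝ h x := by
    intro s x
    have := ((h₀.differentiable (by simp) x).hasFDerivAt).add
      (((hhs.differentiable (by simp) x).hasFDerivAt).const_smul s)
    exact this.fderiv
  let A : ℝ → E → Fin (Module.finrank ℝ E) → E := fun s x k =>
    fderiv ℝ F₀ x (b k) + s • fderiv ℝ h x (b k)
  have hA : ∀ s x, (fun k => fderiv ℝ (F s) x (b k)) = A s x := by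
    intro s x; ext1 k; simp [hDF, A]
  let q : ℝ → E → ℝ := fun s x => φ (F s x) * detMap b (A s x)
  -- This is ∂q/∂s, written like the right-hand side of `sum_deriv_cofactor_field`; hence it is a
  -- divergence with compact support, and its integral vanishes.
  let q' : ℝ → E → ℝ := fun s x => fderiv ℝ φ (F s x) (h x) * detMap b (A s x) +
      φ (F s x) * ∑ j, detMap b (Function.update (A s x) j (fderiv ℝ h x (b j)))
  have hcF₀ : Continuous F₀ := h₀.continuous
  have hch : Continuous h := hhs.continuous
  have hcdF₀ : ∀ k, Continuous fun x => fderiv ℝ F₀ x (b k) := fun k =>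
    (h₀.continuous_fderiv (by simp)).clm_apply continuous_const
  have hcdh : ∀ k, Continuous fun x => fderiv ℝ h x (b k) := fun k =>
    (hhs.continuous_fderiv (by simp)).clm_apply continuous_const
  have hcφ : Continuous φ := hφ.continuous
  have hcdφ : Continuous (fderiv ℝ φ) := hφ.continuous_fderiv (by simp)
  have hcF : Continuous fun p : ℝ × E => F p.1 p.2 := by fun_prop
  have hcA : ∀ k, Continuous fun p : ℝ × E => A p.1 p.2 k := by
    intro k
    exact ((hcdF₀ k).comp continuous_snd).add (continuous_fst.smul ((hcdh k).comp continuous_snd))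
  have hcdA : Continuous fun p : ℝ × E => detMap b (A p.1 p.2) :=
    (detMap b).cont.comp (continuous_pi hcA)
  have hcq : Continuous fun p : ℝ × E => q p.1 p.2 := (hcφ.comp hcF).mul hcdA
  have hcq' : Continuous fun p : ℝ × E => q' p.1 p.2 := by
    refine Continuous.add (Continuous.mul ?_ hcdA) ((hcφ.comp hcF).mul ?_)
    · exact (hcdφ.comp hcF).clm_apply (hch.comp continuous_snd)
    · refine continuous_finsetSum _ fun j _ => (detMap b).cont.comp ?_
      exact (continuous_pi hcA).update j ((hcdh j).comp continuous_snd)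
  have hderiv : ∀ s x, HasDerivAt (fun s => q s x) (q' s x) s := by
    intro s x
    have hF' : HasDerivAt (fun s => F s x) (h x) s := by
      simpa only [id, one_smul] using! ((hasDerivAt_id s).smul_const (h x)).const_add (F₀ x)
    have hφ1 : HasFDerivAt φ (fderiv ℝ φ (F s x)) (F s x) :=
      (hφ.differentiable (by simp) _).hasFDerivAt
    have hA' : ∀ k, HasFDerivAt (fun s => A s x k)
        (ContinuousLinearMap.toSpanSingleton ℝ (fderiv ℝ h x (b k))) s := by
      intro k
      have : HasDerivAt (fun s => A s x k) (fderiv ℝ h x (b k)) s := by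
        simpa only [id, one_smul] using! ((hasDerivAt_id s).smul_const (fderiv ℝ h x (b k))).const_add
          (fderiv ℝ F₀ x (b k))
      exact this.hasFDerivAt
    have hd := (HasFDerivAt.multilinear_comp (detMap b) (x := s) hA').hasDerivAt
    have := (hφ1.comp_hasDerivAt s hF').mul hd
    convert! this using 1
    simp [q', Finset.mul_sum]
  have hzero : ∀ s x, x ∉ tsupport h → q' s x = 0 := by
    intro s x hx
    have e1 : h x = 0 := image_eq_zero_of_notMem_tsupport hx
    have e2 : fderiv ℝ h x = 0 :=
      image_eq_zero_of_notMem_tsupport (fun hx' => hx (tsupport_fderiv_subset ℝ hx'))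
    have e3 : ∀ j, detMap b (Function.update (A s x) j 0) = 0 := fun j =>
      (detMap b).toMultilinearMap.map_coord_zero j (by simp)
    simp [q', e1, e2, e3]
  have hint : ∀ s, ∫ x, q' s x ∂μ = 0 := by
    intro s
    have e : ∀ x, q' s x = ∑ j, fderiv ℝ (fun x => φ (F s x) *
        detMap b (Function.update (fun k => fderiv ℝ (F s) x (b k)) j (h x))) x (b j) := by
      intro x
      rw [sum_deriv_cofactor_field b (hFs s) hhs hφ x]
      simp only [hA]; rfl
    have hsm : ∀ j, ContDiff ℝ 1 (fun x => φ (F s x) *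
        detMap b (Function.update (fun k => fderiv ℝ (F s) x (b k)) j (h x))) := by
      intro j
      refine ((hφ.comp (hFs s)).of_le (mod_cast le_top)).mul ((detMap b).contDiff.comp ?_)
      rw [contDiff_pi]
      intro i
      rcases eq_or_ne i j with rfl | hij
      · simpa using hhs.of_le (mod_cast le_top)
      · simpa [hij] using ((hFs s).fderiv_right (m := 1) one_add_one_le_infty).clm_apply contDiff_const
    have hcs : ∀ j, HasCompactSupport (fun x => φ (F s x) *
        detMap b (Function.update (fun k => fderiv ℝ (F s) x (b k)) j (h x))) := by
      intro j
      refine hc.mono' fun x hx => ?_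
      by_contra hx'
      refine hx ?_
      have : h x = 0 := image_eq_zero_of_notMem_tsupport hx'
      simp only [this, mul_eq_zero]
      exact Or.inr ((detMap b).toMultilinearMap.map_coord_zero j (by simp))
    simp only [e]
    rw [integral_finsetSum]
    · exact Finset.sum_eq_zero fun j _ => integral_fderiv_apply_eq_zero μ (hsm j) (hcs j) _
    · intro j _
      refine Continuous.integrable_of_hasCompactSupport ?_ ((hcs j).fderiv_apply (𝕜 := ℝ) _)
      exact ((hsm j).continuous_fderiv (by simp)).clm_apply continuous_const
  have hq0 : ∀ s x, x ∉ tsupport h → q s x = q 0 x := by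
    intro s x hx
    have e1 : h x = 0 := image_eq_zero_of_notMem_tsupport hx
    have e2 : fderiv ℝ h x = 0 :=
      image_eq_zero_of_notMem_tsupport (fun hx' => hx (tsupport_fderiv_subset ℝ hx'))
    simp [q, A, F, e1, e2]
  have hcont1 : ∀ s, Continuous fun x => q s x - q 0 x := fun s =>
    (hcq.comp (by fun_prop : Continuous fun x : E => (s, x))).sub
      (hcq.comp (by fun_prop : Continuous fun x : E => ((0 : ℝ), x)))
  have hcont2 : ∀ s, Continuous fun x => q' s x := fun s =>
    hcq'.comp (by fun_prop : Continuous fun x : E => (s, x))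
  -- The density `q s` alone need not be integrable; the difference `q s - q 0` vanishes outside of
  -- the support of `h`.
  have hG : ∀ s, HasDerivAt (fun s => ∫ x, (q s x - q 0 x) ∂μ) (∫ x, q' s x ∂μ) s := by
    intro s
    obtain ⟨C, hC⟩ := ((isCompact_Icc (a := s - 1) (b := s + 1)).prod hc).exists_bound_of_continuousOn
      hcq'.continuousOn
    refine (hasDerivAt_integral_of_dominated_loc_of_deriv_le (μ := μ) (x₀ := s)
      (F := fun s x => q s x - q 0 x) (F' := q')
      (bound := (tsupport h).indicator fun _ => C)
      (Icc_mem_nhds (by linarith : s - 1 < s) (by linarith : s < s + 1)) ?_ ?_ ?_ ?_ ?_ ?_).2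
    · exact Filter.Eventually.of_forall fun s => (hcont1 s).aestronglyMeasurable
    · refine (hcont1 s).integrable_of_hasCompactSupport (hc.mono' fun x hx => ?_)
      by_contra hx'
      exact hx (sub_eq_zero.mpr (hq0 s x hx'))
    · exact (hcont2 s).aestronglyMeasurable
    · refine Filter.Eventually.of_forall fun x s' hs' => ?_
      by_cases hx : x ∈ tsupport h
      · rw [indicator_of_mem hx]
        exact hC (s', x) ⟨hs', hx⟩
      · rw [indicator_of_notMem hx, hzero _ _ hx, norm_zero]
    · exact (integrable_indicator_iff (isClosed_tsupport h).measurableSet).mpr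
        (integrableOn_const (IsCompact.measure_lt_top hc).ne)
    · exact Filter.Eventually.of_forall fun x s' _ => (hderiv s' x).sub_const _
  have hconst := is_const_of_deriv_eq_zero (f := fun s => ∫ x, (q s x - q 0 x) ∂μ)
    (fun s => (hG s).differentiableAt) (fun s => by rw [(hG s).deriv, hint s]) 1 0
  simp only [sub_self, integral_zero] at hconst
  rw [← hconst]
  have hF1 : F 1 = F₁ := by ext x; simp [F, hh]
  have hF0 : F 0 = F₀ := by ext x; simp [F]
  have hdet : ∀ s x, detMap b (A s x) = (fderiv ℝ (F s) x).det := by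
    intro s x
    rw [← detMap_comp b, hA]
  simp only [q, hdet, hF1, hF0]

end NullLagrangian
end LinkMaps

namespace LinkMaps

/-! ### Regular zeros and the local degree -/

section Stack

variable {X : Type*} [TopologicalSpace X] {V : Type*} [NormedAddCommGroup V] {F : X → V} {K : Set X}

/-- If the zeros of `F` in a compact set are isolated, they are finite in number. -/
theorem finite_zeros_of_isolated (hK : IsCompact K) (hF : ContinuousOn F K)
    (h : ∀ z ∈ K, F z = 0 → ∃ s ∈ 𝓝 z, InjOn F s) : {x ∈ K | F x = 0}.Finite := by
  refine hK.induction_on (p := fun S => {x ∈ S | F x = 0}.Finite) (by simp)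
    (fun s t hst ht => ht.subset fun x hx => ⟨hst hx.1, hx.2⟩)
    (fun s t hs ht => (hs.union ht).subset ?_) fun z hz => ?_
  · rintro x ⟨hx | hx, h0⟩
    exacts [Or.inl ⟨hx, h0⟩, Or.inr ⟨hx, h0⟩]
  · by_cases h0 : F z = 0
    · obtain ⟨s, hs, hinj⟩ := h z hz h0
      refine ⟨s, mem_nhdsWithin_of_mem_nhds hs, Set.Subsingleton.finite ?_⟩
      exact fun x hx y hy => hinj hx.1 hy.1 (hx.2.trans hy.2.symm)
    · refine ⟨{x | F x ≠ 0}, (hF z hz).eventually_ne h0, ?_⟩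
      simp

/-- Around finitely many zeros at which `F` is open there are disjoint neighbourhoods whose images
contain a fixed ball, and outside of them `F` is bounded away from `0`. -/
theorem exists_stack [T2Space X] (hK : IsCompact K) (hF : ContinuousOn F K) {Z : Set X}
    (hZ : Z.Finite) (hZK : ∀ x ∈ K, F x = 0 → x ∈ Z) (N : X → Set X) (hN : ∀ z ∈ Z, N z ∈ 𝓝 z)
    (hopen : ∀ z ∈ Z, ∀ s ∈ 𝓝 z, F '' s ∈ 𝓝 0) :
    ∃ r > 0, ∃ B : X → Set X,
      (∀ z ∈ Z, IsOpen (B z) ∧ z ∈ B z ∧ B z ⊆ N z ∧ ball 0 r ⊆ F '' B z) ∧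
      Z.PairwiseDisjoint B ∧ ∀ x ∈ K, (∀ z ∈ Z, x ∉ B z) → r ≤ ‖F x‖ := by
  obtain ⟨U, hU, hUd⟩ := hZ.t2_separation
  let B : X → Set X := fun z => U z ∩ interior (N z)
  have hBo : ∀ z, IsOpen (B z) := fun z => (hU z).2.inter isOpen_interior
  have hBz : ∀ z ∈ Z, z ∈ B z := fun z hz =>
    ⟨(hU z).1, mem_interior_iff_mem_nhds.mpr (hN z hz)⟩
  have h1 : ∀ᶠ r in 𝓝[>] (0 : ℝ), ∀ z ∈ Z, ball 0 r ⊆ F '' B z := by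
    rw [Filter.eventually_all_finite hZ]
    intro z hz
    obtain ⟨ε, hε, hb⟩ := Metric.mem_nhds_iff.mp
      (hopen z hz (B z) ((hBo z).mem_nhds (hBz z hz)))
    filter_upwards [Ioo_mem_nhdsGT hε] with r hr
    exact (ball_subset_ball hr.2.le).trans hb
  have h2 : ∀ᶠ r in 𝓝[>] (0 : ℝ), ∀ x ∈ K, (∀ z ∈ Z, x ∉ B z) → r ≤ ‖F x‖ := by
    have hK' : IsCompact (K \ ⋃ z ∈ Z, B z) :=
      hK.diff (isOpen_biUnion fun z _ => hBo z)
    have hc : ContinuousOn (fun x => ‖F x‖) (K \ ⋃ z ∈ Z, B z) := (hF.mono sdiff_subset).norm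
    rcases (K \ ⋃ z ∈ Z, B z).eq_empty_or_nonempty with he | hne
    · refine Filter.Eventually.of_forall fun r x hx hxz => ?_
      have : x ∈ K \ ⋃ z ∈ Z, B z := ⟨hx, by simpa using hxz⟩
      rw [he] at this
      exact this.elim
    · obtain ⟨x₀, hx₀, hmin⟩ := hK'.exists_isMinOn hne hc
      have hpos : 0 < ‖F x₀‖ := by
        rw [norm_pos_iff]
        intro h0
        have hz := hZK x₀ hx₀.1 h0
        exact hx₀.2 (mem_biUnion hz (hBz _ hz))
      filter_upwards [Ioo_mem_nhdsGT hpos] with r hr x hx hxz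
      exact hr.2.le.trans (hmin ⟨hx, by simpa using hxz⟩)
  obtain ⟨r, hr1, hr2, hr3⟩ := (h1.and (h2.and self_mem_nhdsWithin)).exists
  exact ⟨r, hr3, B, fun z hz => ⟨hBo z, hBz z hz, inter_subset_right.trans interior_subset,
    hr1 z hz⟩, hUd.mono_on fun z _ => inter_subset_left, hr2⟩

end Stack

/-! ### Signed zeros in Euclidean space as an integral. -/

section Euclidean

open MeasureTheory

variable {E : Type*} [NormedAddCommGroup E] [NormedSpace ℝ E] [FiniteDimensional ℝ E]

theorem hasStrictFDerivAt_equiv_of_det_ne_zero {F : E → E} {z : E} (hF : ContDiffAt ℝ ∞ F z)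
    (hz : (fderiv ℝ F z).det ≠ 0) :
    HasStrictFDerivAt F
      ((fderiv ℝ F z).toContinuousLinearEquivOfDetNeZero hz : E →L[ℝ] E) z := by
  rw [ContinuousLinearMap.coe_toContinuousLinearEquivOfDetNeZero]
  exact hF.hasStrictFDerivAt (by simp)

theorem exists_injOn_of_det_ne_zero {F : E → E} {z : E} (hF : ContDiffAt ℝ ∞ F z)
    (hz : (fderiv ℝ F z).det ≠ 0) : ∃ s ∈ 𝓝 z, InjOn F s := by
  have : CompleteSpace E := FiniteDimensional.complete ℝ E
  have h := hasStrictFDerivAt_equiv_of_det_ne_zero hF hz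
  exact ⟨(h.toOpenPartialHomeomorph F).source,
    (h.toOpenPartialHomeomorph F).open_source.mem_nhds h.mem_toOpenPartialHomeomorph_source,
    (h.toOpenPartialHomeomorph F).injOn⟩

theorem map_nhds_eq_of_det_ne_zero {F : E → E} {z : E} (hF : ContDiffAt ℝ ∞ F z)
    (hz : (fderiv ℝ F z).det ≠ 0) : Filter.map F (𝓝 z) = 𝓝 (F z) := by
  have : CompleteSpace E := FiniteDimensional.complete ℝ E
  exact (hasStrictFDerivAt_equiv_of_det_ne_zero hF hz).map_nhds_eq_of_equiv

theorem eventually_sign_eq {X : Type*} [TopologicalSpace X] {f : X → ℝ} {x : X}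
    (hf : ContinuousAt f x) (hx : f x ≠ 0) :
    ∀ᶠ y in 𝓝 x, SignType.sign (f y) = SignType.sign (f x) := by
  rcases lt_or_gt_of_ne hx with h | h
  · filter_upwards [hf.eventually_lt_const h] with y hy
    rw [sign_neg hy, sign_neg h]
  · filter_upwards [hf.eventually_const_lt h] with y hy
    rw [sign_pos hy, sign_pos h]

theorem continuousAt_det_fderiv {E : Type*} [NormedAddCommGroup E] [NormedSpace ℝ E] {F : E → E} {z : E} (hF : ContDiffAt ℝ ∞ F z) :
    ContinuousAt (fun x => (fderiv ℝ F x).det) z :=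
  ContinuousLinearMap.continuous_det.continuousAt.comp
    (hF.fderiv_right (m := 0) (by simp)).continuousAt

variable [MeasurableSpace E] [BorelSpace E] (μ : Measure E) [μ.IsAddHaarMeasure]

/-- If `φ` is concentrated near `0`, then the integral of `φ ∘ F * det DF` counts the zeros of `F`
with signs. -/
theorem setIntegral_comp_mul_det_eq {F : E → E} (hF : ContDiff ℝ ∞ F) {S : Set E} (hS : IsOpen S)
    (hcS : IsCompact (closure S)) {Z : Finset E}
    (hZS : ∀ z ∈ Z, z ∈ S ∧ F z = 0 ∧ (fderiv ℝ F z).det ≠ 0)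
    (hZ : ∀ x ∈ closure S, F x = 0 → x ∈ Z) :
    ∃ r > 0, ∀ φ : E → ℝ, Continuous φ → Function.support φ ⊆ ball 0 r →
      ∫ x in S, φ (F x) * (fderiv ℝ F x).det ∂μ =
        ((∑ z ∈ Z, (SignType.sign (fderiv ℝ F z).det : ℤ) : ℤ) : ℝ) * ∫ x, φ x ∂μ := by
  -- Near a regular zero `F` is injective and the sign of its Jacobian is constant, so that the
  -- change of variables formula applies and yields the signed determinant.
  have hN : ∀ z ∈ Z, ∃ N ∈ 𝓝 z, N ⊆ S ∧ InjOn F N ∧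
      ∀ x ∈ N, SignType.sign (fderiv ℝ F x).det = SignType.sign (fderiv ℝ F z).det := by
    intro z hz
    obtain ⟨h1, h2, h3⟩ := hZS z hz
    obtain ⟨s, hs, hinj⟩ := exists_injOn_of_det_ne_zero hF.contDiffAt h3
    have h4 := eventually_sign_eq (continuousAt_det_fderiv hF.contDiffAt) h3
    exact ⟨S ∩ (s ∩ {x | SignType.sign (fderiv ℝ F x).det = SignType.sign (fderiv ℝ F z).det}),
      Filter.inter_mem (hS.mem_nhds h1) (Filter.inter_mem hs h4), inter_subset_left,
      hinj.mono (inter_subset_right.trans inter_subset_left), fun x hx => hx.2.2⟩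
  choose! N hN1 hN2 hN3 hN4 using hN
  obtain ⟨r, hr, B, hB, hBd, hBK⟩ := exists_stack (Z := (Z : Set E)) hcS hF.continuous.continuousOn
    Z.finite_toSet (fun x hx h0 => hZ x hx h0) N hN1 (by
      intro z hz s hs
      obtain ⟨h1, h2, h3⟩ := hZS z hz
      have := Filter.image_mem_map (m := F) hs
      rwa [map_nhds_eq_of_det_ne_zero hF.contDiffAt h3, h2] at this)
  refine ⟨r, hr, fun φ hφ hsupp => ?_⟩
  have hcont : Continuous fun x => φ (F x) * (fderiv ℝ F x).det :=
    (hφ.comp hF.continuous).mul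
      (ContinuousLinearMap.continuous_det.comp (hF.continuous_fderiv (by simp)))
  have hφ0 : ∀ y, r ≤ ‖y‖ → φ y = 0 := by
    intro y hy
    by_contra h0
    have := hsupp h0
    rw [mem_ball_zero_iff] at this
    linarith
  have hBS : ∀ z ∈ Z, B z ⊆ S := fun z hz => (hB z hz).2.2.1.trans (hN2 z hz)
  have hU : (⋃ z ∈ Z, B z) ⊆ S := iUnion₂_subset hBS
  -- Outside of the neighbourhoods `B z` the norm of `F` is at least r, so φ ∘ F vanishes there.
  have hrestr : ∫ x in S, φ (F x) * (fderiv ℝ F x).det ∂μ =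
      ∫ x in ⋃ z ∈ Z, B z, φ (F x) * (fderiv ℝ F x).det ∂μ :=
    setIntegral_eq_of_subset_of_forall_sdiff_eq_zero hS.measurableSet hU (fun x hx => by
      rw [hφ0 _ (hBK x (subset_closure hx.1) fun z hz hxz => hx.2 (mem_biUnion hz hxz)), zero_mul])
  rw [hrestr,
    integral_biUnion_finset Z (fun z hz => (hB z hz).1.measurableSet) hBd
      (fun z hz => (hcont.continuousOn.integrableOn_compact hcS).mono_set
        ((hBS z hz).trans subset_closure))]
  rw [Int.cast_sum, Finset.sum_mul]
  refine Finset.sum_congr rfl fun z hz => ?_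
  -- Each `F '' B z` contains the ball of radius r and thus the support of φ, so every zero
  -- contributes the full integral of φ, up to sign.
  have himg : ∫ x in F '' B z, φ x ∂μ = ∫ x, φ x ∂μ := by
    refine setIntegral_eq_integral_of_forall_compl_eq_zero fun x hx => hφ0 x ?_
    by_contra hlt
    exact hx ((hB z hz).2.2.2 (mem_ball_zero_iff.mpr (not_le.mp hlt)))
  rw [← himg, integral_image_eq_integral_abs_det_fderiv_smul μ (hB z hz).1.measurableSet
    (f' := fderiv ℝ F)
    (fun x _ => (hF.differentiable (by simp) x).hasFDerivAt.hasFDerivWithinAt)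
    ((hN3 z hz).mono (hB z hz).2.2.1), ← integral_const_mul]
  refine setIntegral_congr_fun (hB z hz).1.measurableSet fun x hx => ?_
  have hs : SignType.sign (fderiv ℝ F x).det = SignType.sign (fderiv ℝ F z).det :=
    hN4 z hz x ((hB z hz).2.2.1 hx)
  have e : ((SignType.sign (fderiv ℝ F z).det : ℤ) : ℝ) * |(fderiv ℝ F x).det| =
      (fderiv ℝ F x).det := by
    rw [← hs]
    have := sign_mul_abs (fderiv ℝ F x).det
    rcases lt_trichotomy (fderiv ℝ F x).det 0 with h | h | h
    · simp [sign_neg h, abs_of_neg h]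
    · simp [h]
    · simp [sign_pos h, abs_of_pos h]
  simp only [smul_eq_mul]
  conv_lhs => rw [← e]
  ring

end Euclidean

/-! ### Invariance of signed zero counts under compactly supported changes. -/

section Euclidean

open MeasureTheory

variable {E : Type*} [NormedAddCommGroup E] [NormedSpace ℝ E] [FiniteDimensional ℝ E]

/-- Two maps with regular zeros that agree outside of a compact subset `T` of an open set have the
same number of zeros in `T`, counted with signs. -/
theorem finsum_sign_eq_of_eqOn_compl {F₀ F₁ : E → E} {U T : Set E} (hU : IsOpen U)
    (hT : IsCompact T) (hTU : T ⊆ U) (h₀ : ContDiffOn ℝ ∞ F₀ U) (h₁ : ContDiffOn ℝ ∞ F₁ U)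
    (heq : EqOn F₀ F₁ (U \ T)) (hf₀ : {x ∈ U | F₀ x = 0}.Finite) (hf₁ : {x ∈ U | F₁ x = 0}.Finite)
    (hr₀ : ∀ x ∈ U, F₀ x = 0 → (fderiv ℝ F₀ x).det ≠ 0)
    (hr₁ : ∀ x ∈ U, F₁ x = 0 → (fderiv ℝ F₁ x).det ≠ 0) :
    ∑ᶠ x ∈ {x ∈ T | F₀ x = 0}, (SignType.sign (fderiv ℝ F₀ x).det : ℤ) =
      ∑ᶠ x ∈ {x ∈ T | F₁ x = 0}, (SignType.sign (fderiv ℝ F₁ x).det : ℤ) := by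
  let _ : MeasurableSpace E := borel E
  have _ : BorelSpace E := ⟨rfl⟩
  let μ : Measure E := Measure.addHaar
  -- The zeros outside of `T` are finite in number, so removing them leaves an open set. A
  -- neighbourhood `S` of `T` with closure in `O` then sees no zeros except those in `T`.
  set O : Set E := U \ (({x ∈ U | F₀ x = 0} ∪ {x ∈ U | F₁ x = 0}) \ T) with hO
  have hOo : IsOpen O := hU.sdiff ((hf₀.union hf₁).sdiff).isClosed
  have hTO : T ⊆ O := fun x hx => ⟨hTU hx, fun h => h.2 hx⟩
  obtain ⟨S, hSo, hTS, hSO, hcS⟩ := exists_open_between_and_isCompact_closure hT hOo hTO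
  -- Multiplication by χ extends the maps smoothly to all of `E`, as the integral invariance
  -- requires, and does not alter them near the closure of `S`.
  obtain ⟨χ, hχ0, hχ1, -⟩ := exists_contMDiffMap_zero_one_nhds_of_isClosed 𝓘(ℝ, E) (n := ⊤)
    hU.isClosed_compl isClosed_closure
    (disjoint_left.mpr fun x hx hx' => hx (hSO hx').1 : Disjoint Uᶜ (closure S))
  have hχs : ContDiff ℝ ∞ χ := χ.contMDiff.contDiff
  have hsm : ∀ F : E → E, ContDiffOn ℝ ∞ F U → ContDiff ℝ ∞ fun x => χ x • F x := by
    intro F hF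
    rw [contDiff_iff_contDiffAt]
    intro x
    by_cases hx : x ∈ U
    · exact hχs.contDiffAt.smul (hF.contDiffAt (hU.mem_nhds hx))
    · have : ∀ᶠ y in 𝓝 x, χ y = 0 := hχ0.filter_mono (nhds_le_nhdsSet hx)
      refine (contDiffAt_const (c := (0 : E))).congr_of_eventuallyEq ?_
      filter_upwards [this] with y hy
      simp [hy]
  have hloc : ∀ F : E → E, ∀ x ∈ closure S, (fun x => χ x • F x) =ᶠ[𝓝 x] F := by
    intro F x hx
    have : ∀ᶠ y in 𝓝 x, χ y = 1 := hχ1.filter_mono (nhds_le_nhdsSet hx)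
    filter_upwards [this] with y hy
    simp [hy]
  have main : ∀ F : E → E, ContDiffOn ℝ ∞ F U → {x ∈ U | F x = 0}.Finite →
      (∀ x ∈ U, F x = 0 → (fderiv ℝ F x).det ≠ 0) → (∀ x ∈ closure S, F x = 0 → x ∈ T) →
      ∃ r > 0, ∀ φ : E → ℝ, Continuous φ → Function.support φ ⊆ ball 0 r →
        ∫ x in S, φ (χ x • F x) * (fderiv ℝ (fun x => χ x • F x) x).det ∂μ =
        ((∑ᶠ x ∈ {x ∈ T | F x = 0}, (SignType.sign (fderiv ℝ F x).det : ℤ) : ℤ) : ℝ) *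
          ∫ x, φ x ∂μ := by
    intro F hF hfin hreg hcl
    have hfT : {x ∈ T | F x = 0}.Finite := hfin.subset fun x hx => ⟨hTU hx.1, hx.2⟩
    have hS : ∀ x ∈ hfT.toFinset, x ∈ S ∧ χ x • F x = 0 ∧
        (fderiv ℝ (fun x => χ x • F x) x).det ≠ 0 := by
      intro x hx
      rw [Set.Finite.mem_toFinset] at hx
      have hxS := hTS hx.1
      refine ⟨hxS, by simp [hx.2], ?_⟩
      rw [(hloc F x (subset_closure hxS)).fderiv_eq]
      exact hreg x (hTU hx.1) hx.2
    obtain ⟨r, hr, h⟩ := setIntegral_comp_mul_det_eq μ (hsm F hF) hSo hcS hS (by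
      intro x hx h0
      rw [Set.Finite.mem_toFinset]
      have : F x = 0 := by rw [← (hloc F x hx).self_of_nhds]; exact h0
      exact ⟨hcl x hx this, this⟩)
    refine ⟨r, hr, fun φ hφ hs => ?_⟩
    rw [h φ hφ hs, finsum_mem_eq_finite_toFinset_sum _ hfT]
    congr 2
    refine Finset.sum_congr rfl fun x hx => ?_
    rw [(hloc F x (subset_closure (hS x hx).1)).fderiv_eq]
  have hcl : ∀ x ∈ closure S, F₀ x = 0 ∨ F₁ x = 0 → x ∈ T := by
    intro x hx h
    by_contra hxT
    have hxO := hSO hx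
    refine hxO.2 ⟨?_, hxT⟩
    exact h.imp (fun h => ⟨hxO.1, h⟩) (fun h => ⟨hxO.1, h⟩)
  obtain ⟨r₀, hr₀p, H₀⟩ := main F₀ h₀ hf₀ hr₀ fun x hx h => hcl x hx (Or.inl h)
  obtain ⟨r₁, hr₁p, H₁⟩ := main F₁ h₁ hf₁ hr₁ fun x hx h => hcl x hx (Or.inr h)
  -- A bump small enough for both counting formulas; its integral is positive and can be cancelled
  -- at the end.
  let φ : ContDiffBump (0 : E) := ⟨min r₀ r₁ / 2, min r₀ r₁, by positivity, by
    have : 0 < min r₀ r₁ := by positivity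
    linarith⟩
  have hφs : Function.support φ = ball 0 (min r₀ r₁) := φ.support_eq
  have e₀ := H₀ φ φ.continuous (hφs ▸ ball_subset_ball (min_le_left _ _))
  have e₁ := H₁ φ φ.continuous (hφs ▸ ball_subset_ball (min_le_right _ _))
  have hout : ∀ x ∉ T, χ x • F₀ x = χ x • F₁ x := by
    intro x hx
    by_cases hxU : x ∈ U
    · rw [heq ⟨hxU, hx⟩]
    · have : χ x = 0 := hχ0.self_of_nhdsSet x hxU
      simp [this]
  have hnull := integral_comp_mul_det_sub_eq_zero μ (hsm F₀ h₀) (hsm F₁ h₁)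
    (φ := φ) (φ.contDiff) (HasCompactSupport.intro hT fun x hx => by
      simp [hout x hx])
  have hdet : ∀ x ∉ T, fderiv ℝ (fun x => χ x • F₁ x) x = fderiv ℝ (fun x => χ x • F₀ x) x := by
    intro x hx
    refine Filter.EventuallyEq.fderiv_eq ?_
    filter_upwards [hT.isClosed.isOpen_compl.mem_nhds hx] with y hy using (hout y hy).symm
  have hcont : ∀ F : E → E, ContDiffOn ℝ ∞ F U →
      Continuous fun x => φ (χ x • F x) * (fderiv ℝ (fun x => χ x • F x) x).det := fun F hF =>
    (φ.continuous.comp (hsm F hF).continuous).mul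
      (ContinuousLinearMap.continuous_det.comp ((hsm F hF).continuous_fderiv (by simp)))
  rw [← setIntegral_eq_integral_of_forall_compl_eq_zero (s := S) (fun x hx => by
    have hxT : x ∉ T := fun h => hx (hTS h)
    rw [hdet x hxT, hout x hxT, sub_self])] at hnull
  rw [integral_sub, e₀, e₁, ← sub_mul] at hnull
  · have hpos : 0 < ∫ x, φ x ∂μ := φ.integral_pos
    have := (mul_eq_zero.mp hnull).resolve_right hpos.ne'
    have := sub_eq_zero.mp this
    exact_mod_cast this.symm
  · exact ((hcont F₁ h₁).continuousOn.integrableOn_compact hcS).mono_set subset_closure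
  · exact ((hcont F₀ h₀).continuousOn.integrableOn_compact hcS).mono_set subset_closure

end Euclidean
end LinkMaps

namespace LinkMaps

/-! ### Counting zeros of equidimensional maps on manifolds -/

section Count

variable {E : Type*} [NormedAddCommGroup E] [NormedSpace ℝ E]
  {H : Type*} [TopologicalSpace H] (I : ModelWithCorners ℝ E H)
  {M : Type*} [TopologicalSpace M] [ChartedSpace H M] {R : Type*} [CommRing R]

/-- The Jacobian determinant of a map to the model space, in the coordinates that Mathlib uses for
the tangent space. -/
noncomputable def jac (D : M → E) (q : M) : ℝ :=
  ContinuousLinearMap.det (show E →L[ℝ] E from mfderiv I 𝓘(ℝ, E) D q)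

/-- The sign of the Jacobian determinant, corrected by a weight. -/
noncomputable def signAt (w : M → R) (D : M → E) (q : M) : R :=
  w q * ((SignType.sign (jac I D q) : ℤ) : R)

/-- The number of zeros of `D` in a set, counted with the signs `signAt`. -/
noncomputable def zeroCount (w : M → R) (D : M → E) (Ω : Set M) : R :=
  ∑ᶠ q ∈ {q ∈ Ω | D q = 0}, signAt I w D q

/-- A weight is coherent if it transforms like a local orientation. -/
def IsCoherent (w : M → R) : Prop :=
  ∀ q₀, ∀ᶠ q in 𝓝 q₀, w q * ((SignType.sign (jac I (extChartAt I q₀) q) : ℤ) : R) = w q₀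

variable {I}

theorem jac_congr {D D' : M → E} {q : M} (h : D =ᶠ[𝓝 q] D') : jac I D q = jac I D' q := by
  unfold jac
  congr 1
  exact h.mfderiv_eq

theorem jac_sub_const {D : M → E} {q : M} (y : E) :
    jac I (fun q => D q - y) q = jac I D q := by
  unfold jac
  congr 1
  by_cases hD : MDifferentiableAt I 𝓘(ℝ, E) D q
  · have h := hD.hasMFDerivAt.sub (hasMFDerivAt_const (I := I) (I' := 𝓘(ℝ, E)) y q)
    exact h.mfderiv.trans (sub_zero (show E →L[ℝ] E from mfderiv I 𝓘(ℝ, E) D q))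
  -- If `D` is not differentiable at `q`, neither is `D - y`, and both derivatives take the default
  -- value 0.
  · have hD' : ¬ MDifferentiableAt I 𝓘(ℝ, E) (fun q => D q - y) q := by
      intro h
      apply hD
      have := h.add (mdifferentiableAt_const (c := y))
      convert! this using 1
      ext x
      simp
    rw [mfderiv_zero_of_not_mdifferentiableAt hD, mfderiv_zero_of_not_mdifferentiableAt hD']
    rfl

theorem zeroCount_congr {w : M → R} {D D' : M → E} {Ω : Set M}
    (h : ∀ q ∈ Ω, D q = 0 ∨ D' q = 0 → D =ᶠ[𝓝 q] D') :
    zeroCount I w D Ω = zeroCount I w D' Ω := by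
  unfold zeroCount
  refine finsum_mem_congr ?_ fun q hq => ?_
  · ext q
    refine and_congr_right fun hq => ⟨fun h0 => ?_, fun h0 => ?_⟩
    · rw [← (h q hq (Or.inl h0)).self_of_nhds, h0]
    · rw [(h q hq (Or.inr h0)).self_of_nhds, h0]
  · rw [signAt, signAt, jac_congr (h q hq.1 (Or.inr hq.2))]

variable [IsManifold I ∞ M]

theorem jac_extChartAt_ne_zero {q₀ q : M} (hq : q ∈ (chartAt H q₀).source) :
    jac I (extChartAt I q₀) q ≠ 0 := by
  have hq' : q ∈ (extChartAt I q₀).source := by rwa [extChartAt_source]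
  have : IsManifold I 1 M := IsManifold.of_le (n := ∞) (WithTop.coe_le_coe.mpr le_top)
  obtain ⟨e, he⟩ := isInvertible_mfderiv_extChartAt (I := I) hq'
  unfold jac
  rw [← he]
  exact (LinearEquiv.isUnit_det' (show E ≃L[ℝ] E from e).toLinearEquiv).ne_zero

variable [I.Boundaryless]

theorem contDiffAt_comp_extChartAt_symm {D : M → E} {q₀ q : M} (hD : ContMDiffAt I 𝓘(ℝ, E) ∞ D q)
    (hq : q ∈ (chartAt H q₀).source) :
    ContDiffAt ℝ ∞ (D ∘ (extChartAt I q₀).symm) (extChartAt I q₀ q) := by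
  have hq' : q ∈ (extChartAt I q₀).source := by rwa [extChartAt_source]
  have hs : ContMDiffAt 𝓘(ℝ, E) I ∞ (extChartAt I q₀).symm (extChartAt I q₀ q) :=
    (contMDiffOn_extChartAt_symm q₀).contMDiffAt
      ((isOpen_extChartAt_target q₀).mem_nhds ((extChartAt I q₀).map_source hq'))
  rw [← contMDiffAt_iff_contDiffAt]
  refine ContMDiffAt.comp _ ?_ hs
  rwa [(extChartAt I q₀).left_inv hq']

/-- The chain rule for D = (D ∘ ψ⁻¹) ∘ ψ with ψ the chart at `q₀`. The second factor is the one that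
a coherent weight absorbs. -/
theorem jac_eq_det_mul {D : M → E} {q₀ q : M} (hD : ContMDiffAt I 𝓘(ℝ, E) ∞ D q)
    (hq : q ∈ (chartAt H q₀).source) :
    jac I D q = (fderiv ℝ (D ∘ (extChartAt I q₀).symm) (extChartAt I q₀ q)).det *
      jac I (extChartAt I q₀) q := by
  have hq' : q ∈ (extChartAt I q₀).source := by rwa [extChartAt_source]
  have : IsManifold I 1 M := IsManifold.of_le (n := ∞) (WithTop.coe_le_coe.mpr le_top)
  have h1 := ((contDiffAt_comp_extChartAt_symm hD hq).differentiableAt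
    (by simp)).hasFDerivAt.hasMFDerivAt
  have h2 := (mdifferentiableAt_extChartAt (I := I) hq).hasMFDerivAt
  have h3 := h1.comp q h2
  have h4 : D =ᶠ[𝓝 q] (D ∘ (extChartAt I q₀).symm) ∘ extChartAt I q₀ := by
    filter_upwards [extChartAt_source_mem_nhds' hq'] with x hx
    rw [Function.comp_apply, Function.comp_apply, (extChartAt I q₀).left_inv hx]
  have h5 := (h3.congr_of_eventuallyEq h4).mfderiv
  unfold jac
  rw [h5]
  exact LinearMap.det_comp _ _

theorem jac_ne_zero_iff {D : M → E} {q₀ q : M} (hD : ContMDiffAt I 𝓘(ℝ, E) ∞ D q)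
    (hq : q ∈ (chartAt H q₀).source) : jac I D q ≠ 0 ↔
      (fderiv ℝ (D ∘ (extChartAt I q₀).symm) (extChartAt I q₀ q)).det ≠ 0 := by
  rw [jac_eq_det_mul hD hq, mul_ne_zero_iff]
  exact and_iff_left (jac_extChartAt_ne_zero hq)

/-- At each point `jac` uses the coordinates of that point's own chart. Coherence cancels the sign
of the transition, so near `q₀` all signs can be read off in the single chart at `q₀`. The
neighbourhood does not depend on `D`. -/
theorem IsCoherent.eventually_signAt_eq {w : M → R} (hw : IsCoherent I w) (q₀ : M) :
    ∀ᶠ q in 𝓝 q₀, ∀ D : M → E, ContMDiffAt I 𝓘(ℝ, E) ∞ D q → signAt I w D q =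
      w q₀ * ((SignType.sign
        (fderiv ℝ (D ∘ (extChartAt I q₀).symm) (extChartAt I q₀ q)).det : ℤ) : R) := by
  filter_upwards [hw q₀, (chartAt H q₀).open_source.mem_nhds (mem_chart_source H q₀)]
    with q h1 hq D hD
  rw [signAt, jac_eq_det_mul hD hq, sign_mul, ← h1]
  push_cast
  ring

theorem eventually_signAt_eq_self {w : M → R} (hw : IsCoherent I w) {D : M → E} {q : M}
    (hD : ∀ᶠ x in 𝓝 q, ContMDiffAt I 𝓘(ℝ, E) ∞ D x) (h0 : jac I D q ≠ 0) :
    ∀ᶠ x in 𝓝 q, signAt I w D x = signAt I w D q := by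
  have hq := mem_chart_source H q
  have h1 := hw.eventually_signAt_eq q
  have hDq := hD.self_of_nhds
  have h2 := eventually_sign_eq (continuousAt_det_fderiv (contDiffAt_comp_extChartAt_symm hDq hq))
    ((jac_ne_zero_iff hDq hq).mp h0)
  have h3 := (continuousAt_extChartAt (I := I) q).eventually h2
  have hqs := h1.self_of_nhds D hDq
  filter_upwards [h1, h3, hD] with x hx1 hx3 hx4
  rw [hx1 D hx4, hqs, hx3]

variable [FiniteDimensional ℝ E]

theorem exists_injOn_of_jac_ne_zero {D : M → E} {q : M} (hD : ContMDiffAt I 𝓘(ℝ, E) ∞ D q)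
    (h0 : jac I D q ≠ 0) : ∃ s ∈ 𝓝 q, InjOn D s := by
  have hq := mem_chart_source H q
  have hd := (jac_ne_zero_iff hD hq).mp h0
  obtain ⟨s, hs, hinj⟩ := exists_injOn_of_det_ne_zero (contDiffAt_comp_extChartAt_symm hD hq) hd
  refine ⟨(extChartAt I q).source ∩ extChartAt I q ⁻¹' s,
    Filter.inter_mem (extChartAt_source_mem_nhds q) ((continuousAt_extChartAt q) hs), ?_⟩
  intro x hx y hy hxy
  refine (extChartAt I q).injOn hx.1 hy.1 (hinj hx.2 hy.2 ?_)
  rwa [Function.comp_apply, Function.comp_apply, (extChartAt I q).left_inv hx.1,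
    (extChartAt I q).left_inv hy.1]

theorem map_nhds_eq_of_jac_ne_zero {D : M → E} {q : M} (hD : ContMDiffAt I 𝓘(ℝ, E) ∞ D q)
    (h0 : jac I D q ≠ 0) : Filter.map D (𝓝 q) = 𝓝 (D q) := by
  have hq := mem_chart_source H q
  have hd := (jac_ne_zero_iff hD hq).mp h0
  have h := map_nhds_eq_of_det_ne_zero (contDiffAt_comp_extChartAt_symm hD hq) hd
  rw [← map_extChartAt_nhds_of_boundaryless, Filter.map_map, Function.comp_apply,
    extChartAt_to_inv] at h
  rw [← h]
  refine Filter.map_congr ?_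
  filter_upwards [extChartAt_source_mem_nhds (I := I) q] with x hx
  rw [Function.comp_apply, Function.comp_apply, (extChartAt I q).left_inv hx]

end Count
end LinkMaps

namespace LinkMaps

/-! ### Homotopy invariance of the number of zeros -/

section Homotopy

open MeasureTheory

variable {E : Type*} [NormedAddCommGroup E] [NormedSpace ℝ E] [FiniteDimensional ℝ E]
  {H : Type*} [TopologicalSpace H] {I : ModelWithCorners ℝ E H} [I.Boundaryless]
  {M : Type*} [TopologicalSpace M] [ChartedSpace H M] [IsManifold I ∞ M]
  {R : Type*} [CommRing R]

theorem finite_zeros_of_regular {D : M → E} {Ω K : Set M} (hΩ : IsOpen Ω) (hK : IsCompact K)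
    (hKΩ : K ⊆ Ω) (hD : ContMDiffOn I 𝓘(ℝ, E) ∞ D Ω) (h0 : ∀ q ∈ Ω, D q = 0 → q ∈ K)
    (hreg : ∀ q ∈ Ω, D q = 0 → jac I D q ≠ 0) : {q ∈ Ω | D q = 0}.Finite := by
  refine (finite_zeros_of_isolated hK (hD.continuousOn.mono hKΩ) fun z hz hz0 => ?_).subset
    fun x hx => ⟨h0 x hx.1 hx.2, hx.2⟩
  exact exists_injOn_of_jac_ne_zero (hD.contMDiffAt (hΩ.mem_nhds (hKΩ hz))) (hreg z (hKΩ hz) hz0)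

/-- The number of zeros does not change if a map is changed on a compact subset of a small
coordinate neighbourhood. -/
theorem zeroCount_eq_of_eqOn_compl [T2Space M] {w : M → R} {F F' : M → E} {Ω U T : Set M} {q₀ : M}
    (hΩ : IsOpen Ω) (hU : IsOpen U) (hUΩ : U ⊆ Ω) (hUq : U ⊆ (chartAt H q₀).source)
    (hw : ∀ q ∈ U, ∀ D : M → E, ContMDiffAt I 𝓘(ℝ, E) ∞ D q → signAt I w D q =
      w q₀ * ((SignType.sign
        (fderiv ℝ (D ∘ (extChartAt I q₀).symm) (extChartAt I q₀ q)).det : ℤ) : R))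
    (hT : IsCompact T) (hTU : T ⊆ U) (hF : ContMDiffOn I 𝓘(ℝ, E) ∞ F Ω)
    (hF' : ContMDiffOn I 𝓘(ℝ, E) ∞ F' Ω) (heq : EqOn F F' (Ω \ T))
    (hfin : {q ∈ Ω | F q = 0}.Finite) (hfin' : {q ∈ Ω | F' q = 0}.Finite)
    (hreg : ∀ q ∈ Ω, F q = 0 → jac I F q ≠ 0) (hreg' : ∀ q ∈ Ω, F' q = 0 → jac I F' q ≠ 0) :
    zeroCount I w F Ω = zeroCount I w F' Ω := by
  set ψ := extChartAt I q₀ with hψ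
  have hUs : U ⊆ ψ.source := by rwa [hψ, extChartAt_source]
  set V : Set E := ψ.target ∩ ψ.symm ⁻¹' U with hV
  have hVo : IsOpen V :=
    (continuousOn_extChartAt_symm q₀).isOpen_inter_preimage (isOpen_extChartAt_target q₀) hU
  have hVU : ∀ x ∈ V, ψ.symm x ∈ U ∧ ψ (ψ.symm x) = x := fun x hx => ⟨hx.2, ψ.right_inv hx.1⟩
  have hUV : ∀ q ∈ U, ψ q ∈ V ∧ ψ.symm (ψ q) = q := fun q hq =>
    ⟨⟨ψ.map_source (hUs hq), by rw [mem_preimage, ψ.left_inv (hUs hq)]; exact hq⟩,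
      ψ.left_inv (hUs hq)⟩
  have hTc : IsCompact (ψ '' T) :=
    hT.image_of_continuousOn ((continuousOn_extChartAt q₀).mono (hTU.trans hUs))
  have hTV : ψ '' T ⊆ V := by
    rintro _ ⟨q, hq, rfl⟩
    exact (hUV q (hTU hq)).1
  have key : ∀ D : M → E, ContMDiffOn I 𝓘(ℝ, E) ∞ D Ω → {q ∈ Ω | D q = 0}.Finite →
      (∀ q ∈ Ω, D q = 0 → jac I D q ≠ 0) →
      ContDiffOn ℝ ∞ (D ∘ ψ.symm) V ∧ {x ∈ V | (D ∘ ψ.symm) x = 0}.Finite ∧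
      (∀ x ∈ V, (D ∘ ψ.symm) x = 0 → (fderiv ℝ (D ∘ ψ.symm) x).det ≠ 0) ∧
      ∑ᶠ q ∈ {q ∈ T | D q = 0}, signAt I w D q = w q₀ *
        ((∑ᶠ x ∈ {x ∈ ψ '' T | (D ∘ ψ.symm) x = 0},
          (SignType.sign (fderiv ℝ (D ∘ ψ.symm) x).det : ℤ) : ℤ) : R) := by
    intro D hD hDf hDr
    have hDat : ∀ q ∈ U, ContMDiffAt I 𝓘(ℝ, E) ∞ D q := fun q hq =>
      hD.contMDiffAt (hΩ.mem_nhds (hUΩ hq))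
    refine ⟨fun x hx => ?_, ?_, fun x hx h0 => ?_, ?_⟩
    · obtain ⟨h1, h2⟩ := hVU x hx
      have := contDiffAt_comp_extChartAt_symm (hDat _ h1) (hUq h1)
      rw [← hψ, h2] at this
      exact this.contDiffWithinAt
    · refine (hDf.image ψ).subset fun x hx => ?_
      obtain ⟨h1, h2⟩ := hVU x hx.1
      exact ⟨ψ.symm x, ⟨hUΩ h1, hx.2⟩, h2⟩
    · obtain ⟨h1, h2⟩ := hVU x hx
      have := (jac_ne_zero_iff (hDat _ h1) (hUq h1)).mp (hDr _ (hUΩ h1) h0)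
      rwa [← hψ, h2] at this
    · have hfT : {x ∈ ψ '' T | (D ∘ ψ.symm) x = 0}.Finite := by
        refine (hDf.image ψ).subset ?_
        rintro _ ⟨⟨q, hq, rfl⟩, h0⟩
        refine ⟨q, ⟨hUΩ (hTU hq), ?_⟩, rfl⟩
        rwa [Function.comp_apply, (hUV q (hTU hq)).2] at h0
      rw [show w q₀ * ((∑ᶠ x ∈ {x ∈ ψ '' T | (D ∘ ψ.symm) x = 0},
          (SignType.sign (fderiv ℝ (D ∘ ψ.symm) x).det : ℤ) : ℤ) : R) =
          ∑ᶠ x ∈ {x ∈ ψ '' T | (D ∘ ψ.symm) x = 0},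
          w q₀ * ((SignType.sign (fderiv ℝ (D ∘ ψ.symm) x).det : ℤ) : R) from
          ((AddMonoidHom.mulLeft (w q₀)).comp
            (Int.castRingHom R).toAddMonoidHom).map_finsum_mem _ hfT]
      refine finsum_mem_eq_of_bijOn ψ ⟨?_, ?_, ?_⟩ ?_
      · rintro q ⟨hq, h0⟩
        refine ⟨mem_image_of_mem _ hq, ?_⟩
        rwa [Function.comp_apply, (hUV q (hTU hq)).2]
      · exact ψ.injOn.mono fun q hq => hUs (hTU hq.1)
      · rintro _ ⟨⟨q, hq, rfl⟩, h0⟩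
        rw [Function.comp_apply, (hUV q (hTU hq)).2] at h0
        exact ⟨q, ⟨hq, h0⟩, rfl⟩
      · rintro q ⟨hq, -⟩
        exact hw q (hTU hq) D (hDat q (hTU hq))
  obtain ⟨a1, a2, a3, a4⟩ := key F hF hfin hreg
  obtain ⟨b1, b2, b3, b4⟩ := key F' hF' hfin' hreg'
  have hloc := finsum_sign_eq_of_eqOn_compl hVo hTc hTV a1 b1 (by
    rintro x ⟨hx, hxT⟩
    obtain ⟨h1, h2⟩ := hVU x hx
    exact heq ⟨hUΩ h1, fun h => hxT ⟨_, h, h2⟩⟩) a2 b2 a3 b3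
  have hTΩ := hTU.trans hUΩ
  -- Outside of `T` the two maps agree near every zero; only the zeros in `T` need the Euclidean
  -- result.
  have split : ∀ D : M → E, {q ∈ Ω | D q = 0}.Finite → zeroCount I w D Ω =
      ∑ᶠ q ∈ {q ∈ T | D q = 0}, signAt I w D q +
        ∑ᶠ q ∈ {q ∈ Ω \ T | D q = 0}, signAt I w D q := by
    intro D hD
    have hs : {q ∈ Ω | D q = 0} = {q ∈ T | D q = 0} ∪ {q ∈ Ω \ T | D q = 0} := by
      ext q
      simp only [mem_ofPred_eq, mem_union, mem_sdiff]
      by_cases hq : q ∈ T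
      · simp [hq, hTΩ hq]
      · simp [hq]
    rw [zeroCount, hs, finsum_mem_union]
    · exact disjoint_left.mpr fun q hq hq' => hq'.1.2 hq.1
    · exact hD.subset fun q hq => ⟨hTΩ hq.1, hq.2⟩
    · exact hD.subset fun q hq => ⟨hq.1.1, hq.2⟩
  rw [split F hfin, split F' hfin', a4, b4, hloc]
  congr 1
  refine finsum_mem_congr ?_ fun q hq => ?_
  · ext q
    exact and_congr_right fun hq => by rw [heq hq]
  · have : F =ᶠ[𝓝 q] F' := by
      filter_upwards [(hΩ.sdiff hT.isClosed).mem_nhds hq.1] with x hx using heq hx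
    rw [signAt, signAt, jac_congr this]

/-- The number of zeros is the number of inverse images of a value close to `0`. -/
theorem exists_zeroCount_sub_eq [T2Space M] {w : M → R} (hw : IsCoherent I w) {D : M → E}
    {Ω K : Set M} (hΩ : IsOpen Ω) (hK : IsCompact K) (hKΩ : K ⊆ Ω)
    (hD : ContMDiffOn I 𝓘(ℝ, E) ∞ D Ω) {r : ℝ} (hr : 0 < r) (hDr : ∀ q ∈ Ω \ K, r ≤ ‖D q‖)
    (hreg : ∀ q ∈ Ω, D q = 0 → jac I D q ≠ 0) :
    ∃ ρ > 0, ∀ y, ‖y‖ < ρ → zeroCount I w (fun q => D q - y) Ω = zeroCount I w D Ω := by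
  have hK0 : ∀ q ∈ Ω, ‖D q‖ < r → q ∈ K := by
    intro q hq h
    by_contra hqK
    exact absurd (hDr q ⟨hq, hqK⟩) (not_le.mpr h)
  have hfin := finite_zeros_of_regular hΩ hK hKΩ hD
    (fun q hq h => hK0 q hq (by rwa [h, norm_zero])) hreg
  have hat : ∀ q ∈ Ω, ContMDiffAt I 𝓘(ℝ, E) ∞ D q := fun q hq => hD.contMDiffAt (hΩ.mem_nhds hq)
  have hN : ∀ z ∈ {q ∈ Ω | D q = 0}, ∃ N ∈ 𝓝 z, N ⊆ Ω ∧ InjOn D N ∧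
      ∀ x ∈ N, signAt I w D x = signAt I w D z := by
    rintro z ⟨hz, hz0⟩
    obtain ⟨s, hs, hinj⟩ := exists_injOn_of_jac_ne_zero (hat z hz) (hreg z hz hz0)
    have h1 := eventually_signAt_eq_self hw
      (Filter.eventually_of_mem (hΩ.mem_nhds hz) hat) (hreg z hz hz0)
    exact ⟨Ω ∩ (s ∩ {x | signAt I w D x = signAt I w D z}),
      Filter.inter_mem (hΩ.mem_nhds hz) (Filter.inter_mem hs h1), inter_subset_left,
      hinj.mono (inter_subset_right.trans inter_subset_left), fun x hx => hx.2.2⟩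
  choose! N hN1 hN2 hN3 hN4 using hN
  obtain ⟨r', hr', B, hB, hBd, hBK⟩ := exists_stack hK (hD.continuousOn.mono hKΩ) hfin
    (fun x hx h0 => ⟨hKΩ hx, h0⟩) N hN1 (by
      rintro z ⟨hz, hz0⟩ s hs
      have := Filter.image_mem_map (m := D) hs
      rwa [map_nhds_eq_of_jac_ne_zero (hat z hz) (hreg z hz hz0), hz0] at this)
  -- The bound r keeps the inverse images of y in `K`, and the bound r' puts exactly one of them
  -- into each `B z`.
  refine ⟨min r r', lt_min hr hr', fun y hy => ?_⟩
  have hg : ∀ z ∈ {q ∈ Ω | D q = 0}, ∃ x ∈ B z, D x = y := fun z hz =>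
    (hB z hz).2.2.2 (mem_ball_zero_iff.mpr (hy.trans_le (min_le_right _ _)))
  choose! g hgB hgy using hg
  symm
  refine finsum_mem_eq_of_bijOn g ⟨?_, ?_, ?_⟩ ?_
  · intro z hz
    exact ⟨hN2 z hz ((hB z hz).2.2.1 (hgB z hz)), sub_eq_zero.mpr (hgy z hz)⟩
  · intro z hz z' hz' h
    by_contra hne
    exact disjoint_left.mp (hBd hz hz' hne) (hgB z hz) (h ▸ hgB z' hz')
  · rintro x ⟨hx, hxy⟩
    have hxy : D x = y := sub_eq_zero.mp hxy
    have hxK : x ∈ K := hK0 x hx (hxy ▸ hy.trans_le (min_le_left _ _))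
    have : ∃ z ∈ {q ∈ Ω | D q = 0}, x ∈ B z := by
      by_contra! h
      have := hBK x hxK h
      rw [hxy] at this
      exact absurd (hy.trans_le (min_le_right _ _)) (not_lt.mpr this)
    obtain ⟨z, hz, hxz⟩ := this
    exact ⟨z, hz, hN3 z hz ((hB z hz).2.2.1 (hgB z hz)) ((hB z hz).2.2.1 hxz)
      ((hgy z hz).trans hxy.symm)⟩
  · intro z hz
    rw [← hN4 z hz (g z) ((hB z hz).2.2.1 (hgB z hz)), signAt, signAt, jac_sub_const]

/-- The critical values of a smooth map form a null set (equidimensional Sard theorem). -/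
theorem ae_regular [MeasurableSpace E] [BorelSpace E] (μ : Measure E) [μ.IsAddHaarMeasure]
    {D : M → E} {Ω K : Set M} (hΩ : IsOpen Ω) (hK : IsCompact K) (hKΩ : K ⊆ Ω)
    (hD : ContMDiffOn I 𝓘(ℝ, E) ∞ D Ω) :
    ∀ᵐ y ∂μ, ∀ q ∈ K, D q = y → jac I D q ≠ 0 := by
  refine hK.induction_on (p := fun S => ∀ᵐ y ∂μ, ∀ q ∈ S, D q = y → jac I D q ≠ 0) (by simp)
    (fun s t hst ht => ht.mono fun y hy q hq => hy q (hst hq)) (fun s t hs ht => ?_) fun q₀ hq₀ => ?_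
  · filter_upwards [hs, ht] with y h1 h2 q hq
    exact hq.elim (h1 q) (h2 q)
  · refine ⟨Ω ∩ (chartAt H q₀).source, mem_nhdsWithin_of_mem_nhds (Filter.inter_mem
      (hΩ.mem_nhds (hKΩ hq₀)) ((chartAt H q₀).open_source.mem_nhds (mem_chart_source H q₀))), ?_⟩
    set ψ := extChartAt I q₀ with hψ
    set f := D ∘ ψ.symm with hf
    let C : Set E := ψ '' {q | (q ∈ Ω ∧ q ∈ (chartAt H q₀).source) ∧ jac I D q = 0}
    have hnull : μ (f '' C) = 0 := by
      refine addHaar_image_eq_zero_of_det_fderivWithin_eq_zero μ (f' := fderiv ℝ f) ?_ ?_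
      · rintro _ ⟨q, ⟨⟨hqΩ, hq⟩, -⟩, rfl⟩
        exact ((contDiffAt_comp_extChartAt_symm (hD.contMDiffAt (hΩ.mem_nhds hqΩ))
          hq).differentiableAt (by simp)).hasFDerivAt.hasFDerivWithinAt
      · rintro _ ⟨q, ⟨⟨hqΩ, hq⟩, h0⟩, rfl⟩
        by_contra hne
        exact (jac_ne_zero_iff (hD.contMDiffAt (hΩ.mem_nhds hqΩ)) hq).mpr hne h0
    rw [ae_iff]
    refine measure_mono_null (fun y hy => ?_) hnull
    simp only [mem_ofPred_eq, not_forall, not_not] at hy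
    obtain ⟨q, hq, hqy, h0⟩ := hy
    refine ⟨ψ q, ⟨q, ⟨hq, h0⟩, rfl⟩, ?_⟩
    rw [hf, Function.comp_apply, ψ.left_inv (by rw [hψ, extChartAt_source]; exact hq.2), hqy]

end Homotopy
end LinkMaps

namespace LinkMaps

/-! ### Linear homotopies, decomposed into changes in coordinate neighbourhoods. -/

section LinearHomotopy

open MeasureTheory

variable {E : Type*} [NormedAddCommGroup E] [NormedSpace ℝ E]
  {H : Type*} [TopologicalSpace H] {I : ModelWithCorners ℝ E H}
  {M : Type*} [TopologicalSpace M] [ChartedSpace H M] {R : Type*} [CommRing R]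

/-- A function that is successively moved towards `1` with the help of cutoff functions. -/
noncomputable def blend {M : Type*} : List (M → ℝ) → M → ℝ
  | [], _ => 0
  | χ :: l, q => blend l q + χ q * (1 - blend l q)

theorem blend_contMDiff {l : List (M → ℝ)} (hl : ∀ χ ∈ l, ContMDiff I 𝓘(ℝ, ℝ) ∞ χ) :
    ContMDiff I 𝓘(ℝ, ℝ) ∞ (blend l) := by
  induction l with
  | nil => exact contMDiff_const
  | cons χ l ih =>
    have h := ih fun χ' h => hl χ' (List.mem_cons_of_mem _ h)
    exact h.add ((hl χ List.mem_cons_self).mul (contMDiff_const.sub h))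

theorem blend_mem_Icc {M : Type*} {l : List (M → ℝ)} (hl : ∀ χ ∈ l, ∀ q, χ q ∈ Icc (0 : ℝ) 1)
    (q : M) : blend l q ∈ Icc (0 : ℝ) 1 := by
  induction l with
  | nil => simp [blend]
  | cons χ l ih =>
    have h := ih fun χ' h => hl χ' (List.mem_cons_of_mem _ h)
    have h' := hl χ List.mem_cons_self q
    simp only [mem_Icc, blend] at *
    constructor <;> nlinarith

theorem blend_eq_one {M : Type*} {l : List (M → ℝ)} {χ : M → ℝ} (hχ : χ ∈ l) {q : M}
    (hq : χ q = 1) : blend l q = 1 := by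
  induction l with
  | nil => simp at hχ
  | cons χ' l ih =>
    rcases List.mem_cons.mp hχ with rfl | h
    · simp [blend, hq]
    · simp [blend, ih h]

variable [FiniteDimensional ℝ E] [I.Boundaryless] [IsManifold I ∞ M]

/-- These cutoff functions drive single steps of a homotopy: their supports lie in neighbourhoods of
the kind needed by `zeroCount_eq_of_eqOn_compl`. -/
theorem exists_cutoff [T2Space M] {w : M → R} (hw : IsCoherent I w) {Ω : Set M} (hΩ : IsOpen Ω)
    {c : M} (hc : c ∈ Ω) :
    ∃ χ : M → ℝ, χ =ᶠ[𝓝 c] 1 ∧ ContMDiff I 𝓘(ℝ, ℝ) ∞ χ ∧ (∀ q, χ q ∈ Icc (0 : ℝ) 1) ∧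
      HasCompactSupport χ ∧ ∃ U, IsOpen U ∧ tsupport χ ⊆ U ∧ U ⊆ Ω ∧ U ⊆ (chartAt H c).source ∧
      ∀ q ∈ U, ∀ D : M → E, ContMDiffAt I 𝓘(ℝ, E) ∞ D q → signAt I w D q =
        w c * ((SignType.sign
          (fderiv ℝ (D ∘ (extChartAt I c).symm) (extChartAt I c q)).det : ℤ) : R) := by
  obtain ⟨U, hU, hUo, hcU⟩ := eventually_nhds_iff.mp (hw.eventually_signAt_eq c)
  set U' := U ∩ (Ω ∩ (chartAt H c).source) with hU'
  have hU'o : IsOpen U' := hUo.inter (hΩ.inter (chartAt H c).open_source)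
  have hcU' : U' ∈ 𝓝 c := hU'o.mem_nhds ⟨hcU, hc, mem_chart_source H c⟩
  obtain ⟨χ, -, hχ⟩ := (SmoothBumpFunction.nhds_basis_tsupport (I := I) c).mem_iff.mp hcU'
  exact ⟨χ, χ.eventuallyEq_one, χ.contMDiff, fun q => χ.mem_Icc, χ.hasCompactSupport, U', hU'o, hχ,
    inter_subset_right.trans inter_subset_left, inter_subset_right.trans inter_subset_right,
    fun q hq D hD => hU q hq.1 D hD⟩

/-- Two maps with regular zeros that are joined by a linear homotopy without zeros outside of
a compact set have the same number of zeros. -/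
theorem zeroCount_eq_of_linear_homotopy [T2Space M] {w : M → R} (hw : IsCoherent I w)
    {D₀ D₁ : M → E} {Ω K : Set M} (hΩ : IsOpen Ω) (hK : IsCompact K) (hKΩ : K ⊆ Ω)
    (hD₀ : ContMDiffOn I 𝓘(ℝ, E) ∞ D₀ Ω) (hD₁ : ContMDiffOn I 𝓘(ℝ, E) ∞ D₁ Ω)
    {r : ℝ} (hr : 0 < r)
    (hbound : ∀ q ∈ Ω \ K, ∀ s ∈ Icc (0 : ℝ) 1, r ≤ ‖D₀ q + s • (D₁ q - D₀ q)‖)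
    (hreg₀ : ∀ q ∈ Ω, D₀ q = 0 → jac I D₀ q ≠ 0) (hreg₁ : ∀ q ∈ Ω, D₁ q = 0 → jac I D₁ q ≠ 0) :
    zeroCount I w D₀ Ω = zeroCount I w D₁ Ω := by
  let _ : MeasurableSpace E := borel E
  have _ : BorelSpace E := ⟨rfl⟩
  let μ : Measure E := Measure.addHaar
  -- At both ends a small translation does not change the count. This leaves room to choose y such
  -- that the intermediate maps, whose zeros may be degenerate, become regular after subtracting y.
  obtain ⟨ρ₀, hρ₀, h₀⟩ := exists_zeroCount_sub_eq hw hΩ hK hKΩ hD₀ hr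
    (fun q hq => by simpa using hbound q hq 0 (by simp)) hreg₀
  obtain ⟨ρ₁, hρ₁, h₁⟩ := exists_zeroCount_sub_eq hw hΩ hK hKΩ hD₁ hr
    (fun q hq => by simpa using hbound q hq 1 (by simp)) hreg₁
  let F : List (M → ℝ) → M → E := fun l q => D₀ q + blend l q • (D₁ q - D₀ q)
  let good : (M → ℝ) → Prop := fun χ => ContMDiff I 𝓘(ℝ, ℝ) ∞ χ ∧ (∀ q, χ q ∈ Icc (0 : ℝ) 1) ∧
      HasCompactSupport χ ∧ ∃ c U, IsOpen U ∧ tsupport χ ⊆ U ∧ U ⊆ Ω ∧ U ⊆ (chartAt H c).source ∧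
      ∀ q ∈ U, ∀ D : M → E, ContMDiffAt I 𝓘(ℝ, E) ∞ D q → signAt I w D q =
        w c * ((SignType.sign
          (fderiv ℝ (D ∘ (extChartAt I c).symm) (extChartAt I c q)).det : ℤ) : R)
  have hFs : ∀ l, (∀ χ ∈ l, good χ) → ContMDiffOn I 𝓘(ℝ, E) ∞ (F l) Ω := fun l hl =>
    hD₀.add ((blend_contMDiff fun χ h => (hl χ h).1).contMDiffOn.smul (hD₁.sub hD₀))
  -- Each `F l q` lies on the segment from `D₀ q` to `D₁ q`, because `blend` has values in [0, 1];
  -- off `K` its norm is therefore at least r.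
  have hFr : ∀ l, (∀ χ ∈ l, good χ) → ∀ y, ‖y‖ < r → ∀ q ∈ Ω, F l q - y = 0 → q ∈ K := by
    intro l hl y hy q hq h0
    by_contra hqK
    have := hbound q ⟨hq, hqK⟩ _ (blend_mem_Icc (fun χ h => (hl χ h).2.1) q)
    rw [show D₀ q + blend l q • (D₁ q - D₀ q) = y from sub_eq_zero.mp h0] at this
    linarith
  have hreg : ∀ l, (∀ χ ∈ l, good χ) → ∀ᵐ y ∂μ, ‖y‖ < r →
      (∀ q ∈ Ω, F l q - y = 0 → jac I (fun q => F l q - y) q ≠ 0) ∧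
      {q ∈ Ω | F l q - y = 0}.Finite := by
    intro l hl
    filter_upwards [ae_regular μ hΩ hK hKΩ (hFs l hl)] with y hy hyr
    have h1 : ∀ q ∈ Ω, F l q - y = 0 → jac I (fun q => F l q - y) q ≠ 0 := by
      intro q hq h0
      rw [jac_sub_const]
      exact hy q (hFr l hl y hyr q hq h0) (sub_eq_zero.mp h0)
    exact ⟨h1, finite_zeros_of_regular hΩ hK hKΩ ((hFs l hl).sub contMDiffOn_const)
      (hFr l hl y hyr) h1⟩
  -- One more cutoff χ changes `F l` only on the support of χ. Each step excludes a null set of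
  -- translations y, where one of the two maps is not regular.
  have main : ∀ l, (∀ χ ∈ l, good χ) → ∀ᵐ y ∂μ, ‖y‖ < r →
      zeroCount I w (fun q => F l q - y) Ω = zeroCount I w (fun q => D₀ q - y) Ω := by
    intro l
    induction l with
    | nil =>
      intro _
      refine Filter.Eventually.of_forall fun y _ => ?_
      simp [F, blend]
    | cons χ l ih =>
      intro hl
      have hl' : ∀ χ ∈ l, good χ := fun χ' h => hl χ' (List.mem_cons_of_mem _ h)
      filter_upwards [ih hl', hreg l hl', hreg _ hl] with y h1 h2 h3 hy
      rw [← h1 hy]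
      obtain ⟨-, -, hχc, c, U, hUo, hχU, hUΩ, hUc, hUw⟩ := hl χ List.mem_cons_self
      refine zeroCount_eq_of_eqOn_compl hΩ hUo hUΩ hUc hUw hχc hχU
        ((hFs _ hl).sub contMDiffOn_const) ((hFs l hl').sub contMDiffOn_const) ?_
        (h3 hy).2 (h2 hy).2 (h3 hy).1 (h2 hy).1
      rintro q ⟨-, hq⟩
      simp [F, blend, image_eq_zero_of_notMem_tsupport hq]
  have hcut : ∀ c ∈ K, ∃ χ, χ =ᶠ[𝓝 c] 1 ∧ good χ := by
    intro c hc
    obtain ⟨χ, h1, h2, h3, h4, U, h5⟩ := exists_cutoff hw hΩ (hKΩ hc)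
    exact ⟨χ, h1, h2, h3, h4, c, U, h5⟩
  choose! χ hχ1 hχg using hcut
  -- Finitely many cutoffs suffice for one of them to equal 1 near each point of `K`. The resulting
  -- blend equals 1 near `K`, so `F l` agrees there with `D₁`, and off `K` there are no zeros to
  -- compare.
  obtain ⟨t, htK, ht⟩ := hK.elim_nhds_subcover (fun c => {q | χ c =ᶠ[𝓝 q] 1})
    fun c hc => eventually_eventually_nhds.mpr (hχ1 c hc)
  let l := t.toList.map χ
  have hl : ∀ χ ∈ l, good χ := by
    intro χ' h
    obtain ⟨c, hc, rfl⟩ := List.mem_map.mp h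
    exact hχg c (htK c (Finset.mem_toList.mp hc))
  have hend : ∀ y, ‖y‖ < r →
      zeroCount I w (fun q => F l q - y) Ω = zeroCount I w (fun q => D₁ q - y) Ω := by
    intro y hy
    refine zeroCount_congr fun q hq h => ?_
    have hqK : q ∈ K := by
      rcases h with h | h
      · exact hFr l hl y hy q hq h
      · by_contra hqK
        have := hbound q ⟨hq, hqK⟩ 1 (by simp)
        rw [one_smul, add_sub_cancel, sub_eq_zero.mp h] at this
        linarith
    obtain ⟨c, hc, hqc⟩ := mem_iUnion₂.mp (ht hqK)
    have hqc : χ c =ᶠ[𝓝 q] 1 := hqc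
    filter_upwards [hqc] with x hx
    have : blend l x = 1 := blend_eq_one
      (List.mem_map_of_mem (Finset.mem_toList.mpr hc)) hx
    simp [F, this]
  have hne : ∃ y, ‖y‖ < min r (min ρ₀ ρ₁) ∧ (‖y‖ < r →
      zeroCount I w (fun q => F l q - y) Ω = zeroCount I w (fun q => D₀ q - y) Ω) := by
    have hd := (Measure.dense_of_ae (main l hl)).inter_open_nonempty (ball 0 (min r (min ρ₀ ρ₁)))
      isOpen_ball ⟨0, by simp [hr, hρ₀, hρ₁]⟩
    obtain ⟨y, hy1, hy2⟩ := hd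
    exact ⟨y, mem_ball_zero_iff.mp hy1, hy2⟩
  obtain ⟨y, hy, hyF⟩ := hne
  obtain ⟨hyr, hy'⟩ := lt_min_iff.mp hy
  obtain ⟨hy0, hy1⟩ := lt_min_iff.mp hy'
  rw [← h₀ y hy0, ← h₁ y hy1, ← hyF hyr, hend y hyr]

end LinearHomotopy
end LinkMaps

namespace LinkMaps

/-! ### Signs of frames and coherent weights -/

section Cylinder

universe u v

/-- The model space of the cylinder `ℝ × P₁ × P₂`. -/
abbrev CylModel (p₁ p₂ : ℕ) : Type :=
  ℝ × EuclideanSpace ℝ (Fin p₁) × EuclideanSpace ℝ (Fin p₂)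

/-- The model with corners of the cylinder `ℝ × P₁ × P₂`. -/
noncomputable abbrev cylCorners (p₁ p₂ : ℕ) :
    ModelWithCorners ℝ (CylModel p₁ p₂)
      (ModelProd ℝ (ModelProd (EuclideanSpace ℝ (Fin p₁)) (EuclideanSpace ℝ (Fin p₂)))) :=
  𝓘(ℝ, ℝ).prod ((𝓡 p₁).prod (𝓡 p₂))

/-- The ordering of the coordinates of `ℝ × ℝ ^ p₁ × ℝ ^ p₂`. -/
def cylIndexEquiv (p₁ p₂ : ℕ) : Unit ⊕ (Fin p₁ ⊕ Fin p₂) ≃ Fin (p₁ + p₂ + 1) :=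
  (Equiv.sumCongr (Equiv.refl Unit) finSumFinEquiv).trans
    ((Equiv.sumComm _ _).trans
      ((Equiv.optionEquivSumPUnit _).symm.trans (finSuccEquiv _).symm))

/-- The standard basis of `ℝ × ℝ ^ p₁ × ℝ ^ p₂`. -/
noncomputable def cylBasis (p₁ p₂ : ℕ) : Module.Basis (Fin (p₁ + p₂ + 1)) ℝ (CylModel p₁ p₂) :=
  ((Module.Basis.singleton Unit ℝ).prod
    ((EuclideanSpace.basisFun (Fin p₁) ℝ).toBasis.prod
      (EuclideanSpace.basisFun (Fin p₂) ℝ).toBasis)).reindex (cylIndexEquiv p₁ p₂)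

theorem cylBasis_eq (p₁ p₂ : ℕ) : (cylBasis p₁ p₂ : Fin (p₁ + p₂ + 1) → CylModel p₁ p₂) =
    Fin.cons (1, 0, 0) (Fin.append
      (fun i => (0, (EuclideanSpace.basisFun (Fin p₁) ℝ).toBasis i, 0))
      (fun j => (0, 0, (EuclideanSpace.basisFun (Fin p₂) ℝ).toBasis j))) := by
  ext1 k
  rw [cylBasis, Module.Basis.reindex_apply]
  refine Fin.cases ?_ (fun k => ?_) k
  · have : (cylIndexEquiv p₁ p₂).symm 0 = Sum.inl () := by
      rw [Equiv.symm_apply_eq]; simp [cylIndexEquiv]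
    rw [this]
    simp [Prod.ext_iff]
  · refine Fin.addCases (fun i => ?_) (fun j => ?_) k
    · have : (cylIndexEquiv p₁ p₂).symm (Fin.succ (Fin.castAdd p₂ i)) = Sum.inr (Sum.inl i) := by
        rw [Equiv.symm_apply_eq]; simp [cylIndexEquiv]
      rw [this]
      simp
    · have : (cylIndexEquiv p₁ p₂).symm (Fin.succ (Fin.natAdd p₁ j)) = Sum.inr (Sum.inr j) := by
        rw [Equiv.symm_apply_eq]; simp [cylIndexEquiv]
      rw [this]
      simp

/-- The standard basis of the ambient Euclidean space. -/
noncomputable abbrev ambBasis (p₁ p₂ : ℕ) : Module.Basis (Fin (p₁ + p₂ + 1)) ℝ (Amb p₁ p₂) :=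
  (EuclideanSpace.basisFun (Fin (p₁ + p₂ + 1)) ℝ).toBasis

/-- The identification of the ambient space with the model space of the cylinder. -/
noncomputable def ambEquiv (p₁ p₂ : ℕ) : Amb p₁ p₂ ≃L[ℝ] CylModel p₁ p₂ :=
  ((ambBasis p₁ p₂).equiv (cylBasis p₁ p₂) (Equiv.refl _)).toContinuousLinearEquiv

/-- Jacobians are defined for maps to the model space, signs by frames in the ambient space. Since
`ambEquiv` carries one standard basis to the other, the two determinants coincide. -/
theorem det_ambEquiv_comp {p₁ p₂ : ℕ} (A : CylModel p₁ p₂ →ₗ[ℝ] Amb p₁ p₂) :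
    LinearMap.det ((ambEquiv p₁ p₂).toLinearEquiv.toLinearMap ∘ₗ A) =
      (ambBasis p₁ p₂).det (A ∘ cylBasis p₁ p₂) := by
  set e : Amb p₁ p₂ ≃ₗ[ℝ] CylModel p₁ p₂ := (ambEquiv p₁ p₂).toLinearEquiv
  have h1 : (cylBasis p₁ p₂ : _ → CylModel p₁ p₂) = e ∘ ambBasis p₁ p₂ := by
    ext1 k
    exact (Module.Basis.equiv_apply (ambBasis p₁ p₂) k (cylBasis p₁ p₂) (Equiv.refl _)).symm
  have h2 := (ambBasis p₁ p₂).det_comp (A ∘ₗ e.toLinearMap) (ambBasis p₁ p₂)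
  rw [Module.Basis.det_self, mul_one] at h2
  have h3 : A ∘ cylBasis p₁ p₂ = (A ∘ₗ e.toLinearMap) ∘ ambBasis p₁ p₂ := by
    rw [h1]; rfl
  rw [h3, h2, ← LinearMap.det_conj (A ∘ₗ e.toLinearMap) e]
  congr 1
  ext x <;> simp

theorem comp_cylBasis {p₁ p₂ : ℕ} (A : CylModel p₁ p₂ →ₗ[ℝ] Amb p₁ p₂) :
    A ∘ cylBasis p₁ p₂ = Fin.cons (A (1, 0)) (Fin.append
      (fun i => A (0, (EuclideanSpace.basisFun (Fin p₁) ℝ).toBasis i, 0))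
      (fun j => A (0, 0, (EuclideanSpace.basisFun (Fin p₂) ℝ).toBasis j))) := by
  rw [cylBasis_eq]
  ext1 k
  refine Fin.cases ?_ (fun k => ?_) k
  · rfl
  · refine Fin.addCases (fun i => ?_) (fun j => ?_) k <;> simp

theorem bijective_iff_det_ne_zero {p₁ p₂ : ℕ} (A : CylModel p₁ p₂ →ₗ[ℝ] Amb p₁ p₂) :
    Function.Bijective A ↔ (ambBasis p₁ p₂).det (A ∘ cylBasis p₁ p₂) ≠ 0 := by
  rw [← det_ambEquiv_comp, ← isUnit_iff_ne_zero, ← LinearMap.isUnit_iff_isUnit_det,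
    Module.End.isUnit_iff]
  exact (Function.Bijective.of_comp_iff' (ambEquiv p₁ p₂).bijective A).symm

variable {p₁ p₂ : ℕ}
  {P₁ : Type u} [TopologicalSpace P₁] [ChartedSpace (EuclideanSpace ℝ (Fin p₁)) P₁]
  {P₂ : Type v} [TopologicalSpace P₂] [ChartedSpace (EuclideanSpace ℝ (Fin p₂)) P₂]

/-- The determinant of the frame that consists of `e` and the images of the reference bases. -/
noncomputable def frameDet (x₁ : P₁) (x₂ : P₂) (e : Amb p₁ p₂)
    (A : TangentSpace (𝓡 p₁) x₁ × TangentSpace (𝓡 p₂) x₂ →ₗ[ℝ] Amb p₁ p₂) : ℝ :=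
  (ambBasis p₁ p₂).det (Fin.cons e (Fin.append (fun i => A (tangentBasis x₁ i, 0))
    (fun j => A (0, tangentBasis x₂ j))))

theorem frameSign_eq (x₁ : P₁) (x₂ : P₂) (o₁ : Orientation ℝ (TangentSpace (𝓡 p₁) x₁) (Fin p₁))
    (o₂ : Orientation ℝ (TangentSpace (𝓡 p₂) x₂) (Fin p₂)) (e : Amb p₁ p₂)
    (A : TangentSpace (𝓡 p₁) x₁ × TangentSpace (𝓡 p₂) x₂ →ₗ[ℝ] Amb p₁ p₂) :
    frameSign x₁ x₂ o₁ o₂ e A =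
      basisSign x₁ o₁ * basisSign x₂ o₂ * (SignType.sign (frameDet x₁ x₂ e A) : ℤ) := rfl

/-- A linear map on the tangent space of the cylinder, in the coordinates that Mathlib uses. -/
def inModel {x₁ : P₁} {x₂ : P₂}
    (A : ℝ × TangentSpace (𝓡 p₁) x₁ × TangentSpace (𝓡 p₂) x₂ →ₗ[ℝ] Amb p₁ p₂) :
    CylModel p₁ p₂ →ₗ[ℝ] Amb p₁ p₂ := A

theorem frameDet_eq_det (x₁ : P₁) (x₂ : P₂)
    (A : ℝ × TangentSpace (𝓡 p₁) x₁ × TangentSpace (𝓡 p₂) x₂ →ₗ[ℝ] Amb p₁ p₂) :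
    frameDet x₁ x₂ (A (1, 0)) (A ∘ₗ LinearMap.inr ℝ ℝ _) =
      (ambBasis p₁ p₂).det (inModel A ∘ cylBasis p₁ p₂) := by
  rw [comp_cylBasis]
  rfl

theorem hasMFDerivAt_prodMk_space {E H M F F' : Type*} [NormedAddCommGroup E] [NormedSpace ℝ E]
    [TopologicalSpace H] {I : ModelWithCorners ℝ E H} [TopologicalSpace M] [ChartedSpace H M]
    [NormedAddCommGroup F] [NormedSpace ℝ F] [NormedAddCommGroup F'] [NormedSpace ℝ F']
    {f : M → F} {g : M → F'} {q : M} {f' : TangentSpace I q →L[ℝ] F}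
    {g' : TangentSpace I q →L[ℝ] F'} (hf : HasMFDerivAt I 𝓘(ℝ, F) f q f')
    (hg : HasMFDerivAt I 𝓘(ℝ, F') g q g') :
    HasMFDerivAt I 𝓘(ℝ, F × F') (fun x => (f x, g x)) q (f'.prod g') :=
  ⟨hf.1.prodMk hg.1, hf.2.prodMk hg.2⟩

theorem jac_extChartAt_self {E H M : Type*} [NormedAddCommGroup E] [NormedSpace ℝ E]
    [TopologicalSpace H] {I : ModelWithCorners ℝ E H} [TopologicalSpace M] [ChartedSpace H M]
    [IsManifold I 1 M] (q : M) : jac I (extChartAt I q) q = 1 := by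
  unfold jac
  rw [mfderiv_extChartAt_self]
  exact LinearMap.det_id

theorem orientation_neg_neg {p : ℕ} {F : Type*} [AddCommGroup F] [Module ℝ F]
    (η : Orientation ℝ F (Fin p)) : - -η = η :=
  neg_neg (G := Module.Ray ℝ _) η

/-- A linear automorphism preserves or reverses orientation according to the sign of its
determinant, and there are only two orientations. -/
theorem ite_orientation_mul_sign_det {p : ℕ} (b : Module.Basis (Fin p) ℝ (EuclideanSpace ℝ (Fin p)))
    (T : EuclideanSpace ℝ (Fin p) ≃ₗ[ℝ] EuclideanSpace ℝ (Fin p))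
    {η η₀ : Orientation ℝ (EuclideanSpace ℝ (Fin p)) (Fin p)}
    (h : Orientation.map (Fin p) T η = η₀) [Decidable (b.orientation = η)]
    [Decidable (b.orientation = η₀)] :
    (if b.orientation = η then (1 : ℤ) else -1) * (SignType.sign (LinearMap.det T.toLinearMap) : ℤ) =
      if b.orientation = η₀ then 1 else -1 := by
  rcases lt_or_gt_of_ne (LinearEquiv.isUnit_det' T).ne_zero with hT | hT
  · have h1 : η₀ = -η := h.symm.trans ((η.map_eq_neg_iff_det_neg T (by simp)).mpr hT)
    rw [sign_neg hT]
    rcases b.orientation_eq_or_eq_neg η with h2 | h2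
    · have h3 : b.orientation ≠ η₀ := by
        rw [h1, h2]
        exact Module.Ray.ne_neg_self _
      rw [if_pos h2.symm, if_neg h3]
      rfl
    · have h3 : b.orientation ≠ η := by
        rw [h2]
        exact Module.Ray.ne_neg_self _
      rw [if_neg h3, if_pos (h1.trans ((congrArg Neg.neg h2).trans (orientation_neg_neg _))).symm]
      rfl
  · have h1 : η₀ = η := h.symm.trans ((η.map_eq_iff_det_pos T (by simp)).mpr hT)
    subst h1
    rw [sign_pos hT]
    simp only [SignType.coe_one, mul_one]
    congr

/-- Coherence for one factor: the trivialization at `x₀` is the derivative of the chart at `x₀`, so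
local constancy of the orientation becomes a transformation rule for the signs of the reference
bases. -/
theorem eventually_basisSign_mul {p : ℕ} {P : Type u} [TopologicalSpace P]
    [ChartedSpace (EuclideanSpace ℝ (Fin p)) P] [IsManifold (𝓡 p) ∞ P] (o : ManifoldOrientation p P)
    (x₀ : P) : ∀ᶠ x in 𝓝 x₀, basisSign x (o.atPoint x) *
      (SignType.sign (jac (𝓡 p) (extChartAt (𝓡 p) x₀) x) : ℤ) = basisSign x₀ (o.atPoint x₀) := by
  have : IsManifold (𝓡 p) 1 P := IsManifold.of_le (n := ∞) (WithTop.coe_le_coe.mpr le_top)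
  let e := trivializationAt (EuclideanSpace ℝ (Fin p)) (TangentSpace (𝓡 p) : P → Type) x₀
  have hb : ∀ {x}, x ∈ (chartAt (EuclideanSpace ℝ (Fin p)) x₀).source → x ∈ e.baseSet := by
    intro x hx
    simpa [e] using hx
  filter_upwards [o.locallyConstant x₀, (chartAt (EuclideanSpace ℝ (Fin p)) x₀).open_source.mem_nhds
    (mem_chart_source _ x₀)] with x hx hxs
  have hxx := hx (hb (mem_chart_source _ x₀)) (hb hxs)
  let b := (EuclideanSpace.basisFun (Fin p) ℝ).toBasis
  let T : ∀ x, x ∈ e.baseSet → (EuclideanSpace ℝ (Fin p) ≃ₗ[ℝ] EuclideanSpace ℝ (Fin p)) :=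
    fun x h => (e.continuousLinearEquivAt ℝ x h).toLinearEquiv
  have hdet : ∀ y (hy : y ∈ (chartAt (EuclideanSpace ℝ (Fin p)) x₀).source),
      LinearMap.det (T y (hb hy)).toLinearMap = jac (𝓡 p) (extChartAt (𝓡 p) x₀) y := by
    intro y hy
    unfold jac
    rw [← TangentBundle.continuousLinearMapAt_trivializationAt hy]
    have : (T y (hb hy)).toLinearMap =
        ContinuousLinearMap.toLinearMap (show EuclideanSpace ℝ (Fin p) →L[ℝ] EuclideanSpace ℝ (Fin p) from
          e.continuousLinearMapAt ℝ y) := by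
      ext1 v
      exact congrFun (Bundle.Trivialization.coe_continuousLinearEquivAt_eq (R := ℝ) e (hb hy)) v
    rw [this]
  -- At `x₀` itself the trivialization has determinant 1, so it may be dropped from the right-hand
  -- side of `locallyConstant`.
  have h0 : Orientation.map (Fin p) (T x₀ (hb (mem_chart_source _ x₀))) (o.atPoint x₀) =
      (show Orientation ℝ (EuclideanSpace ℝ (Fin p)) (Fin p) from o.atPoint x₀) := by
    refine (Orientation.map_eq_iff_det_pos _ _ (by simp)).mpr ?_
    rw [hdet _ (mem_chart_source _ x₀), jac_extChartAt_self]
    exact one_pos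
  classical
  have key := ite_orientation_mul_sign_det b (T x (hb hxs))
    (η := show Orientation ℝ (EuclideanSpace ℝ (Fin p)) (Fin p) from o.atPoint x)
    (η₀ := show Orientation ℝ (EuclideanSpace ℝ (Fin p)) (Fin p) from o.atPoint x₀)
    (hxx.trans h0)
  rw [hdet x hxs] at key
  unfold basisSign
  convert! key

variable [IsManifold (𝓡 p₁) ∞ P₁] [IsManifold (𝓡 p₂) ∞ P₂]

/-- In ℤ/2 the signs 1 and -1 coincide, and the Jacobian of a chart does not vanish. -/
theorem isCoherent_one : IsCoherent (M := ℝ × P₁ × P₂) (cylCorners p₁ p₂)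
    (fun _ => (1 : ZMod 2)) := by
  intro q₀
  filter_upwards [(chartAt (ModelProd ℝ (ModelProd (EuclideanSpace ℝ (Fin p₁))
    (EuclideanSpace ℝ (Fin p₂)))) q₀).open_source.mem_nhds (mem_chart_source _ q₀)] with q hq
  have := jac_extChartAt_ne_zero (I := cylCorners p₁ p₂) hq
  rcases lt_or_gt_of_ne this with h | h
  · rw [sign_neg h]; decide
  · rw [sign_pos h]; decide

/-- The weight on `ℝ × P₁ × P₂` that is given by orientations of `P₁` and `P₂`. -/
noncomputable def orientationWeight (o₁ : ManifoldOrientation p₁ P₁)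
    (o₂ : ManifoldOrientation p₂ P₂) (q : P₁ × P₂) : ℤ :=
  basisSign q.1 (o₁.atPoint q.1) * basisSign q.2 (o₂.atPoint q.2)

theorem jac_extChartAt_cylinder {q₀ q : ℝ × P₁ × P₂}
    (h₁ : q.2.1 ∈ (chartAt (EuclideanSpace ℝ (Fin p₁)) q₀.2.1).source)
    (h₂ : q.2.2 ∈ (chartAt (EuclideanSpace ℝ (Fin p₂)) q₀.2.2).source) :
    jac (cylCorners p₁ p₂) (extChartAt (cylCorners p₁ p₂) q₀) q =
      jac (𝓡 p₁) (extChartAt (𝓡 p₁) q₀.2.1) q.2.1 *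
        jac (𝓡 p₂) (extChartAt (𝓡 p₂) q₀.2.2) q.2.2 := by
  have : IsManifold (𝓡 p₁) 1 P₁ := IsManifold.of_le (n := ∞) (WithTop.coe_le_coe.mpr le_top)
  have : IsManifold (𝓡 p₂) 1 P₂ := IsManifold.of_le (n := ∞) (WithTop.coe_le_coe.mpr le_top)
  have e1 : (extChartAt (cylCorners p₁ p₂) q₀ : ℝ × P₁ × P₂ → CylModel p₁ p₂) =
      Prod.map id (Prod.map (extChartAt (𝓡 p₁) q₀.2.1) (extChartAt (𝓡 p₂) q₀.2.2)) := by
    rw [cylCorners, extChartAt_prod, extChartAt_prod]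
    rfl
  have d1 := (mdifferentiableAt_extChartAt (I := 𝓡 p₁) h₁).hasMFDerivAt
  have d2 := (mdifferentiableAt_extChartAt (I := 𝓡 p₂) h₂).hasMFDerivAt
  have f1 := hasMFDerivAt_fst (I := 𝓘(ℝ, ℝ)) (I' := (𝓡 p₁).prod (𝓡 p₂)) q
  have f2 := hasMFDerivAt_snd (I := 𝓘(ℝ, ℝ)) (I' := (𝓡 p₁).prod (𝓡 p₂)) q
  have d1' := d1.comp q ((hasMFDerivAt_fst (I := 𝓡 p₁) (I' := 𝓡 p₂) q.2).comp q f2)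
  have d2' := d2.comp q ((hasMFDerivAt_snd (I := 𝓡 p₁) (I' := 𝓡 p₂) q.2).comp q f2)
  have d3 := hasMFDerivAt_prodMk_space f1 (hasMFDerivAt_prodMk_space d1' d2')
  unfold jac
  rw [e1]
  refine (congrArg (fun A : CylModel p₁ p₂ →L[ℝ] CylModel p₁ p₂ => A.det) d3.mfderiv).trans ?_
  let A₁ : EuclideanSpace ℝ (Fin p₁) →L[ℝ] EuclideanSpace ℝ (Fin p₁) :=
    mfderiv (𝓡 p₁) 𝓘(ℝ, EuclideanSpace ℝ (Fin p₁)) (extChartAt (𝓡 p₁) q₀.2.1) q.2.1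
  let A₂ : EuclideanSpace ℝ (Fin p₂) →L[ℝ] EuclideanSpace ℝ (Fin p₂) :=
    mfderiv (𝓡 p₂) 𝓘(ℝ, EuclideanSpace ℝ (Fin p₂)) (extChartAt (𝓡 p₂) q₀.2.2) q.2.2
  refine (LinearMap.det_prodMap (LinearMap.id : ℝ →ₗ[ℝ] ℝ)
    (LinearMap.prodMap A₁.toLinearMap A₂.toLinearMap)).trans ?_
  rw [LinearMap.det_id, one_mul]
  exact LinearMap.det_prodMap _ _

theorem isCoherent_orientationWeight (o₁ : ManifoldOrientation p₁ P₁)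
    (o₂ : ManifoldOrientation p₂ P₂) :
    IsCoherent (M := ℝ × P₁ × P₂) (cylCorners p₁ p₂) (fun q => orientationWeight o₁ o₂ q.2) := by
  rintro ⟨t₀, x₀, y₀⟩
  have c1 : Filter.Tendsto (fun q : ℝ × P₁ × P₂ => q.2.1) (𝓝 (t₀, x₀, y₀)) (𝓝 x₀) :=
    (continuous_fst.comp continuous_snd).continuousAt
  have c2 : Filter.Tendsto (fun q : ℝ × P₁ × P₂ => q.2.2) (𝓝 (t₀, x₀, y₀)) (𝓝 y₀) :=
    (continuous_snd.comp continuous_snd).continuousAt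
  have c3 : ∀ᶠ q : ℝ × P₁ × P₂ in 𝓝 (t₀, x₀, y₀),
      q.2.1 ∈ (chartAt (EuclideanSpace ℝ (Fin p₁)) x₀).source :=
    c1 ((chartAt _ x₀).open_source.mem_nhds (mem_chart_source _ x₀))
  have c4 : ∀ᶠ q : ℝ × P₁ × P₂ in 𝓝 (t₀, x₀, y₀),
      q.2.2 ∈ (chartAt (EuclideanSpace ℝ (Fin p₂)) y₀).source :=
    c2 ((chartAt _ y₀).open_source.mem_nhds (mem_chart_source _ y₀))
  filter_upwards [c1.eventually (eventually_basisSign_mul o₁ x₀),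
    c2.eventually (eventually_basisSign_mul o₂ y₀), c3, c4] with q h1 h2 h3 h4
  rw [jac_extChartAt_cylinder h3 h4, sign_mul]
  simp only [orientationWeight, ← h1, ← h2, SignType.coe_mul, Int.cast_id]
  ring

end Cylinder
end LinkMaps

namespace LinkMaps

/-! ### Zeros of the difference of two maps -/

section Difference

universe u v

/-- By compactness the norm of Φ has a positive minimum r over C \ Ω (any r will do if this set is
empty). The points over which it drops to r/2 for some s form a compact set, which cannot meet C \
Ω. This turns nonvanishing at the ends into the uniform bound used by the homotopy argument. -/
theorem exists_isCompact_le_norm {X E : Type*} [TopologicalSpace X] [T2Space X]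
    [NormedAddCommGroup E] {C Ω : Set X} (hC : IsCompact C) (hΩ : IsOpen Ω) (hΩC : Ω ⊆ C)
    {Φ : X × ℝ → E} (hΦ : ContinuousOn Φ (C ×ˢ Icc 0 1))
    (h : ∀ q ∈ C \ Ω, ∀ s ∈ Icc (0 : ℝ) 1, Φ (q, s) ≠ 0) :
    ∃ r > 0, ∃ K, IsCompact K ∧ K ⊆ Ω ∧ ∀ q ∈ Ω \ K, ∀ s ∈ Icc (0 : ℝ) 1, r ≤ ‖Φ (q, s)‖ := by
  obtain ⟨r, hr, hr'⟩ : ∃ r > 0, ∀ p ∈ (C \ Ω) ×ˢ Icc (0 : ℝ) 1, r ≤ ‖Φ p‖ := by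
    have hc : IsCompact ((C \ Ω) ×ˢ Icc (0 : ℝ) 1) := (hC.diff hΩ).prod isCompact_Icc
    rcases ((C \ Ω) ×ˢ Icc (0 : ℝ) 1).eq_empty_or_nonempty with he | hne
    · exact ⟨1, one_pos, by simp [he]⟩
    · obtain ⟨p, hp, hmin⟩ := hc.exists_isMinOn hne
        (hΦ.norm.mono (prod_mono sdiff_subset subset_rfl))
      exact ⟨‖Φ p‖, norm_pos_iff.mpr (h p.1 hp.1 p.2 hp.2), fun q hq => hmin hq⟩
  have hCI : IsCompact (C ×ˢ Icc (0 : ℝ) 1) := hC.prod isCompact_Icc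
  refine ⟨r / 2, half_pos hr, Prod.fst '' ((C ×ˢ Icc (0 : ℝ) 1) ∩ (fun p => ‖Φ p‖) ⁻¹' Iic (r / 2)),
    (hCI.of_isClosed_subset (hΦ.norm.preimage_isClosed_of_isClosed hCI.isClosed isClosed_Iic)
      inter_subset_left).image continuous_fst, ?_, ?_⟩
  · rintro _ ⟨p, ⟨hp, hp'⟩, rfl⟩
    by_contra hn
    have h1 := hr' p ⟨⟨hp.1, hn⟩, hp.2⟩
    have h2 : ‖Φ p‖ ≤ r / 2 := hp'
    linarith
  · rintro q ⟨hq, hqK⟩ s hs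
    by_contra hn
    exact hqK ⟨(q, s), ⟨⟨hΩC hq, hs⟩, (not_le.mp hn).le⟩, rfl⟩

/-- The diagonal is the kernel of the surjection (a, b) ↦ b - a, so spanning together with it means
being onto the quotient. -/
theorem range_sup_range_diagonal_eq_top_iff {V N : Type*} [AddCommGroup V] [Module ℝ V]
    [AddCommGroup N] [Module ℝ N] (A : V →ₗ[ℝ] N × N) :
    LinearMap.range A ⊔ LinearMap.range (LinearMap.prod (LinearMap.id : N →ₗ[ℝ] N) LinearMap.id) =
      ⊤ ↔ Function.Surjective ((LinearMap.snd ℝ N N - LinearMap.fst ℝ N N) ∘ₗ A) := by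
  constructor
  · intro h y
    obtain ⟨_, ⟨v, rfl⟩, _, ⟨n, rfl⟩, hvn⟩ := Submodule.mem_sup.mp (h ▸ Submodule.mem_top :
      ((0, y) : N × N) ∈ _)
    refine ⟨v, ?_⟩
    have h1 : (A v).1 + n = 0 := congrArg Prod.fst hvn
    have h2 : (A v).2 + n = y := congrArg Prod.snd hvn
    simp only [LinearMap.comp_apply, LinearMap.sub_apply, LinearMap.snd_apply, LinearMap.fst_apply]
    rw [← h2, eq_neg_of_add_eq_zero_left h1]
    abel
  · intro h
    rw [eq_top_iff]
    rintro ⟨a, b⟩ -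
    obtain ⟨v, hv⟩ := h (b - a)
    simp only [LinearMap.comp_apply, LinearMap.sub_apply, LinearMap.snd_apply,
      LinearMap.fst_apply] at hv
    refine Submodule.mem_sup.mpr ⟨A v, ⟨v, rfl⟩, _, ⟨a - (A v).1, rfl⟩, ?_⟩
    ext1
    · simp
    · change (A v).2 + (a - (A v).1) = b
      rw [← sub_eq_zero] at hv ⊢
      rw [← hv]
      abel

variable {p₁ p₂ : ℕ}
  {P₁ : Type u} [TopologicalSpace P₁] [ChartedSpace (EuclideanSpace ℝ (Fin p₁)) P₁]
  {P₂ : Type v} [TopologicalSpace P₂] [ChartedSpace (EuclideanSpace ℝ (Fin p₂)) P₂]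

/-- The difference of the components of a map `F = (F₁, F₂)` to `N × N`, as a map to the model
space of the cylinder. -/
noncomputable def diffMap (F : ℝ × P₁ × P₂ → Amb p₁ p₂ × Amb p₁ p₂) (q : ℝ × P₁ × P₂) :
    CylModel p₁ p₂ :=
  ambEquiv p₁ p₂ ((F q).2 - (F q).1)

omit [TopologicalSpace P₁] [ChartedSpace (EuclideanSpace ℝ (Fin p₁)) P₁] [TopologicalSpace P₂]
  [ChartedSpace (EuclideanSpace ℝ (Fin p₂)) P₂] in
theorem diffMap_eq_zero_iff {F : ℝ × P₁ × P₂ → Amb p₁ p₂ × Amb p₁ p₂} {q : ℝ × P₁ × P₂} :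
    diffMap F q = 0 ↔ F q ∈ diagonal (Amb p₁ p₂) := by
  rw [diffMap, map_eq_zero_iff _ (ambEquiv p₁ p₂).injective, sub_eq_zero, mem_diagonal_iff, eq_comm]

theorem det_normalDeriv {F : ℝ × P₁ × P₂ → Amb p₁ p₂ × Amb p₁ p₂} {s : Set (ℝ × P₁ × P₂)}
    {q : ℝ × P₁ × P₂} (hF : MDifferentiableAt (cylCorners p₁ p₂) 𝓘(ℝ, Amb p₁ p₂ × Amb p₁ p₂) F q)
    (hs : s ∈ 𝓝 q) : (ambBasis p₁ p₂).det (inModel (normalDeriv F s q) ∘ cylBasis p₁ p₂) =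
      jac (cylCorners p₁ p₂) (diffMap F) q := by
  rw [← det_ambEquiv_comp]
  let S : Amb p₁ p₂ × Amb p₁ p₂ →L[ℝ] CylModel p₁ p₂ :=
    (ambEquiv p₁ p₂).toContinuousLinearMap ∘L
      (ContinuousLinearMap.snd ℝ (Amb p₁ p₂) (Amb p₁ p₂) -
        ContinuousLinearMap.fst ℝ (Amb p₁ p₂) (Amb p₁ p₂))
  have h1 : HasMFDerivAt (cylCorners p₁ p₂) 𝓘(ℝ, CylModel p₁ p₂) (diffMap F) q
      (S ∘L (mfderiv (cylCorners p₁ p₂) 𝓘(ℝ, Amb p₁ p₂ × Amb p₁ p₂) F q :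
        CylModel p₁ p₂ →L[ℝ] Amb p₁ p₂ × Amb p₁ p₂)) :=
    (S.hasMFDerivAt (x := F q)).comp q hF.hasMFDerivAt
  unfold jac
  refine Eq.trans ?_ (congrArg (fun A : CylModel p₁ p₂ →L[ℝ] CylModel p₁ p₂ => A.det)
    h1.mfderiv).symm
  unfold normalDeriv
  rw [mfderivWithin_of_mem_nhds hs]
  rfl

theorem frameDet_normalDeriv {F : ℝ × P₁ × P₂ → Amb p₁ p₂ × Amb p₁ p₂} {s : Set (ℝ × P₁ × P₂)}
    {q : ℝ × P₁ × P₂} (hF : MDifferentiableAt (cylCorners p₁ p₂) 𝓘(ℝ, Amb p₁ p₂ × Amb p₁ p₂) F q)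
    (hs : s ∈ 𝓝 q) : frameDet q.2.1 q.2.2 (normalDeriv F s q (1, 0))
      (normalDeriv F s q ∘ₗ LinearMap.inr ℝ ℝ _) = jac (cylCorners p₁ p₂) (diffMap F) q :=
  (frameDet_eq_det q.2.1 q.2.2 _).trans (det_normalDeriv hF hs)

theorem bijective_normalDeriv_iff {F : ℝ × P₁ × P₂ → Amb p₁ p₂ × Amb p₁ p₂}
    {s : Set (ℝ × P₁ × P₂)} {q : ℝ × P₁ × P₂}
    (hF : MDifferentiableAt (cylCorners p₁ p₂) 𝓘(ℝ, Amb p₁ p₂ × Amb p₁ p₂) F q) (hs : s ∈ 𝓝 q) :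
    Function.Bijective (normalDeriv F s q) ↔ jac (cylCorners p₁ p₂) (diffMap F) q ≠ 0 := by
  rw [← det_normalDeriv hF hs]
  exact bijective_iff_det_ne_zero (inModel (normalDeriv F s q))

theorem surjective_iff_bijective (A : CylModel p₁ p₂ →ₗ[ℝ] Amb p₁ p₂) :
    Function.Surjective A ↔ Function.Bijective A := by
  refine ⟨fun h => ⟨(LinearMap.injective_iff_surjective_of_finrank_eq_finrank ?_).mpr h, h⟩,
    fun h => h.2⟩
  exact (ambEquiv p₁ p₂).toLinearEquiv.finrank_eq.symm

end Difference

/-! ### Lifts -/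

namespace Lift

universe u v

variable {p₁ p₂ : ℕ}
  {P₁ : Type u} [TopologicalSpace P₁] [ChartedSpace (EuclideanSpace ℝ (Fin p₁)) P₁]
  {P₂ : Type v} [TopologicalSpace P₂] [ChartedSpace (EuclideanSpace ℝ (Fin p₂)) P₂]
  {g₁ f₁ g₁' : P₁ → Amb p₁ p₂} {g₂ f₂ g₂' : P₂ → Amb p₁ p₂}

/-- The interior of the cylinder. -/
def openCylinder (P₁ : Type u) (P₂ : Type v) : Set (ℝ × P₁ × P₂) := Ioo 0 1 ×ˢ univ

theorem isOpen_openCylinder : IsOpen (openCylinder P₁ P₂) := isOpen_Ioo.prod isOpen_univ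

omit [TopologicalSpace P₁] [TopologicalSpace P₂] in
theorem openCylinder_subset : openCylinder P₁ P₂ ⊆ cylinder P₁ P₂ :=
  prod_mono Ioo_subset_Icc_self subset_rfl

theorem isCompact_cylinder [CompactSpace P₁] [CompactSpace P₂] : IsCompact (cylinder P₁ P₂) :=
  isCompact_Icc.prod isCompact_univ

theorem contMDiffOn_total (α : Lift g₁ f₁ g₂ f₂) :
    ContMDiffOn (cylCorners p₁ p₂) 𝓘(ℝ, Amb p₁ p₂ × Amb p₁ p₂) ∞ α.total (cylinder P₁ P₂) := by
  refine ContMDiffOn.prodMk_space ?_ ?_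
  · exact α.smooth₁.comp (I := cylCorners p₁ p₂) (f := fun q : ℝ × P₁ × P₂ => (q.1, q.2.1))
      (contMDiff_fst.prodMk (contMDiff_fst.comp contMDiff_snd)).contMDiffOn
      fun q hq => ⟨hq.1, mem_univ _⟩
  · exact α.smooth₂.comp (I := cylCorners p₁ p₂) (f := fun q : ℝ × P₁ × P₂ => (q.1, q.2.2))
      (contMDiff_fst.prodMk (contMDiff_snd.comp contMDiff_snd)).contMDiffOn
      fun q hq => ⟨hq.1, mem_univ _⟩

theorem contMDiffOn_diffMap (α : Lift g₁ f₁ g₂ f₂) :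
    ContMDiffOn (cylCorners p₁ p₂) 𝓘(ℝ, CylModel p₁ p₂) ∞ (diffMap α.total) (cylinder P₁ P₂) := by
  have h : ContDiff ℝ ∞ (fun z : Amb p₁ p₂ × Amb p₁ p₂ => ambEquiv p₁ p₂ (z.2 - z.1)) :=
    (ambEquiv p₁ p₂).contDiff.comp (contDiff_snd.sub contDiff_fst)
  exact h.contMDiff.comp_contMDiffOn α.contMDiffOn_total

theorem mem_nhds_cylinder {q : ℝ × P₁ × P₂} (hq : q ∈ openCylinder P₁ P₂) :
    cylinder P₁ P₂ ∈ 𝓝 q :=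
  Filter.mem_of_superset (isOpen_openCylinder.mem_nhds hq) openCylinder_subset

theorem mdifferentiableAt_total (α : Lift g₁ f₁ g₂ f₂) {q : ℝ × P₁ × P₂}
    (hq : q ∈ openCylinder P₁ P₂) :
    MDifferentiableAt (cylCorners p₁ p₂) 𝓘(ℝ, Amb p₁ p₂ × Amb p₁ p₂) α.total q :=
  (α.contMDiffOn_total.contMDiffAt (mem_nhds_cylinder hq)).mdifferentiableAt (by simp)

theorem diffMap_total_zero (α : Lift g₁ f₁ g₂ f₂) {q : ℝ × P₁ × P₂} (h : q.1 = 0) :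
    diffMap α.total q = ambEquiv p₁ p₂ (g₂ q.2.2 - g₁ q.2.1) := by
  simp only [diffMap, total, h, α.map₁_zero, α.map₂_zero]

theorem diffMap_total_one (α : Lift g₁ f₁ g₂ f₂) {q : ℝ × P₁ × P₂} (h : q.1 = 1) :
    diffMap α.total q = ambEquiv p₁ p₂ (f₂ q.2.2 - f₁ q.2.1) := by
  simp only [diffMap, total, h, α.map₁_one, α.map₂_one]

omit [TopologicalSpace P₁] [TopologicalSpace P₂] in
theorem eq_zero_or_eq_one {q : ℝ × P₁ × P₂} (hq : q ∈ cylinder P₁ P₂ \ openCylinder P₁ P₂) :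
    q.1 = 0 ∨ q.1 = 1 := by
  by_contra! h
  exact hq.2 ⟨⟨lt_of_le_of_ne hq.1.1.1 h.1.symm, lt_of_le_of_ne hq.1.1.2 h.2⟩, mem_univ _⟩

/-- Zeros at t = 0 or t = 1 are excluded by disjointness at the ends. At all linking points,
derivatives relative to the cylinder are therefore ordinary derivatives. -/
theorem linkingSet_eq (α : Lift g₁ f₁ g₂ f₂) (hg : ∀ x y, g₂ y - g₁ x ≠ 0)
    (hf : ∀ x y, f₂ y - f₁ x ≠ 0) :
    α.linkingSet = {q ∈ openCylinder P₁ P₂ | diffMap α.total q = 0} := by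
  ext q
  refine ⟨fun h => ?_, fun h => ⟨openCylinder_subset h.1, diffMap_eq_zero_iff.mp h.2⟩⟩
  have h0 := diffMap_eq_zero_iff.mpr h.2
  refine ⟨?_, h0⟩
  by_contra hn
  rcases eq_zero_or_eq_one ⟨h.1, hn⟩ with h1 | h1
  · rw [α.diffMap_total_zero h1, map_eq_zero_iff _ (ambEquiv p₁ p₂).injective] at h0
    exact hg _ _ h0
  · rw [α.diffMap_total_one h1, map_eq_zero_iff _ (ambEquiv p₁ p₂).injective] at h0
    exact hf _ _ h0

/-- All zeros of the difference map of a lift in the interior of the cylinder are regular. -/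
def IsRegular (α : Lift g₁ f₁ g₂ f₂) : Prop :=
  ∀ q ∈ openCylinder P₁ P₂, diffMap α.total q = 0 → jac (cylCorners p₁ p₂) (diffMap α.total) q ≠ 0

theorem isTransverse_iff (α : Lift g₁ f₁ g₂ f₂) (hg : ∀ x y, g₂ y - g₁ x ≠ 0)
    (hf : ∀ x y, f₂ y - f₁ x ≠ 0) : α.IsTransverse ↔ α.IsRegular := by
  have key : ∀ q ∈ openCylinder P₁ P₂, (LinearMap.range (show ℝ × TangentSpace (𝓡 p₁) q.2.1 ×
        TangentSpace (𝓡 p₂) q.2.2 →ₗ[ℝ] Amb p₁ p₂ × Amb p₁ p₂ from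
      (mfderivWithin (𝓘(ℝ, ℝ).prod ((𝓡 p₁).prod (𝓡 p₂))) 𝓘(ℝ, Amb p₁ p₂ × Amb p₁ p₂) α.total
        (cylinder P₁ P₂) q).toLinearMap) ⊔
      LinearMap.range (LinearMap.prod (LinearMap.id : Amb p₁ p₂ →ₗ[ℝ] Amb p₁ p₂) LinearMap.id) = ⊤) ↔
      jac (cylCorners p₁ p₂) (diffMap α.total) q ≠ 0 := by
    intro q hq
    rw [← bijective_normalDeriv_iff (α.mdifferentiableAt_total hq) (mem_nhds_cylinder hq)]
    exact (range_sup_range_diagonal_eq_top_iff (V := CylModel p₁ p₂) (N := Amb p₁ p₂) _).trans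
      (surjective_iff_bijective _)
  have hset := α.linkingSet_eq hg hf
  constructor
  · intro h q hq h0
    exact (key q hq).mp (h q (openCylinder_subset hq) (diffMap_eq_zero_iff.mp h0))
  · intro h q hq hd
    have hq' : q ∈ {q ∈ openCylinder P₁ P₂ | diffMap α.total q = 0} := hset ▸ ⟨hq, hd⟩
    exact (key q hq'.1).mpr (h q hq'.1 hq'.2)

variable [CompactSpace P₁] [CompactSpace P₂] [T2Space P₁] [T2Space P₂]
  [IsManifold (𝓡 p₁) ∞ P₁] [IsManifold (𝓡 p₂) ∞ P₂]

omit [IsManifold (𝓡 p₁) ∞ P₁] [IsManifold (𝓡 p₂) ∞ P₂] in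
theorem exists_isCompact_bound (α : Lift g₁ f₁ g₂ f₂) (hg : ∀ x y, g₂ y - g₁ x ≠ 0)
    (hf : ∀ x y, f₂ y - f₁ x ≠ 0) : ∃ r > 0, ∃ K, IsCompact K ∧ K ⊆ openCylinder P₁ P₂ ∧
      ∀ q ∈ openCylinder P₁ P₂ \ K, r ≤ ‖diffMap α.total q‖ := by
  obtain ⟨r, hr, K, hK, hKΩ, hb⟩ := exists_isCompact_le_norm (E := CylModel p₁ p₂)
    (isCompact_cylinder (P₁ := P₁) (P₂ := P₂)) isOpen_openCylinder openCylinder_subset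
    (Φ := fun p => diffMap α.total p.1)
    (α.contMDiffOn_diffMap.continuousOn.comp continuousOn_fst fun p hp => hp.1) (by
      intro q hq s _ h0
      have h : q ∈ α.linkingSet := ⟨hq.1, diffMap_eq_zero_iff.mp h0⟩
      rw [α.linkingSet_eq hg hf] at h
      exact hq.2 h.1)
  exact ⟨r, hr, K, hK, hKΩ, fun q hq => hb q hq 0 (by simp)⟩

theorem finite_linkingSet (α : Lift g₁ f₁ g₂ f₂) (hg : ∀ x y, g₂ y - g₁ x ≠ 0)
    (hf : ∀ x y, f₂ y - f₁ x ≠ 0) (hα : α.IsRegular) : α.linkingSet.Finite := by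
  obtain ⟨r, hr, K, hK, hKΩ, hb⟩ := α.exists_isCompact_bound hg hf
  rw [α.linkingSet_eq hg hf]
  refine finite_zeros_of_regular (I := cylCorners p₁ p₂) isOpen_openCylinder hK hKΩ
    (α.contMDiffOn_diffMap.mono openCylinder_subset) (fun q hq h0 => ?_) hα
  by_contra hn
  have := hb q ⟨hq, hn⟩
  rw [h0, norm_zero] at this
  linarith

theorem isClosedFramed (α : Lift g₁ f₁ g₂ f₂) (hg : ∀ x y, g₂ y - g₁ x ≠ 0)
    (hf : ∀ x y, f₂ y - f₁ x ≠ 0) (hα : α.IsRegular) : α.linkingManifold.IsClosedFramed := by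
  refine ⟨α.finite_linkingSet hg hf hα, fun w => ?_⟩
  have hw : w.1 ∈ {q ∈ openCylinder P₁ P₂ | diffMap α.total q = 0} :=
    α.linkingSet_eq hg hf ▸ w.2
  exact (bijective_normalDeriv_iff (α.mdifferentiableAt_total hw.1) (mem_nhds_cylinder hw.1)).mpr
    (hα w.1 hw.1 hw.2)

omit [CompactSpace P₁] [CompactSpace P₂] [T2Space P₁] [T2Space P₂] in
theorem signedCount_eq (o₁ : ManifoldOrientation p₁ P₁) (o₂ : ManifoldOrientation p₂ P₂)
    (α : Lift g₁ f₁ g₂ f₂) (hg : ∀ x y, g₂ y - g₁ x ≠ 0) (hf : ∀ x y, f₂ y - f₁ x ≠ 0) :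
    α.linkingManifold.signedCount o₁ o₂ =
      zeroCount (cylCorners p₁ p₂) (fun q => orientationWeight o₁ o₂ q.2) (diffMap α.total)
        (openCylinder P₁ P₂) := by
  refine (finsum_set_coe_eq_finsum_mem (s := α.linkingSet) (f := fun q =>
    frameSign q.2.1 q.2.2 (o₁.atPoint _) (o₂.atPoint _)
      (normalDeriv α.total (cylinder P₁ P₂) q (1, 0))
      (normalDeriv α.total (cylinder P₁ P₂) q ∘ₗ LinearMap.inr ℝ ℝ _))).trans ?_
  rw [zeroCount, α.linkingSet_eq hg hf]
  refine finsum_mem_congr rfl fun q hq => ?_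
  rw [frameSign_eq, frameDet_normalDeriv (α.mdifferentiableAt_total hq.1) (mem_nhds_cylinder hq.1)]
  simp [signAt, orientationWeight]

theorem sum_sign_eq_ncard {X : Type*} {s : Set X} (hs : s.Finite) {f : X → ℝ}
    (hf : ∀ q ∈ s, f q ≠ 0) :
    ∑ᶠ q ∈ s, (1 : ZMod 2) * ((SignType.sign (f q) : ℤ) : ZMod 2) = s.ncard := by
  have h : ∀ q ∈ s, (1 : ZMod 2) * ((SignType.sign (f q) : ℤ) : ZMod 2) = 1 := by
    intro q hq
    rcases lt_or_gt_of_ne (hf q hq) with h | h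
    · rw [sign_neg h]; decide
    · rw [sign_pos h]; decide
  rw [finsum_mem_congr rfl h, finsum_mem_eq_finite_toFinset_sum _ hs, Finset.sum_const,
    Set.ncard_eq_toFinset_card s hs, nsmul_one]

theorem countModTwo_eq (α : Lift g₁ f₁ g₂ f₂) (hg : ∀ x y, g₂ y - g₁ x ≠ 0)
    (hf : ∀ x y, f₂ y - f₁ x ≠ 0) (hα : α.IsRegular) : α.linkingManifold.countModTwo =
      zeroCount (cylCorners p₁ p₂) (fun _ => (1 : ZMod 2)) (diffMap α.total)
        (openCylinder P₁ P₂) := by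
  have hfin := α.finite_linkingSet hg hf hα
  have heq := α.linkingSet_eq hg hf
  change (α.linkingSet.ncard : ZMod 2) = _
  rw [heq] at hfin ⊢
  exact (sum_sign_eq_ncard hfin fun q hq => hα q hq.1 hq.2).symm

/-- Sard's theorem gives a small regular value y of the difference map. The homotopy translates
`map₂` by multiples of ρ(t) y, where ρ vanishes at 0 and 1, so that the ends stay fixed, and equals
1 near the times at which zeros can occur. -/
theorem exists_homotopic_isRegular (α : Lift g₁ f₁ g₂ f₂) (hg : ∀ x y, g₂ y - g₁ x ≠ 0)
    (hf : ∀ x y, f₂ y - f₁ x ≠ 0) :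
    ∃ β : Lift g₁ f₁ g₂ f₂, α.Homotopic β ∧ β.IsRegular := by
  obtain ⟨r, hr, K, hK, hKΩ, hb⟩ := α.exists_isCompact_bound hg hf
  obtain ⟨ρ, hρ0, hρ1, hρ⟩ := exists_contMDiffMap_zero_one_nhds_of_isClosed 𝓘(ℝ, ℝ) (n := ⊤)
    (s := ({0, 1} : Set ℝ)) (t := Prod.fst '' K) (Set.toFinite _).isClosed
    (hK.image continuous_fst).isClosed (by
      rw [Set.disjoint_left]
      rintro _ h ⟨q, hq, rfl⟩
      have := (hKΩ hq).1
      rcases h with h | h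
      · exact this.1.ne' h
      · exact this.2.ne h)
  obtain ⟨y, hyr, hy⟩ : ∃ y : CylModel p₁ p₂, ‖y‖ < r ∧
      ∀ q ∈ K, diffMap α.total q = y → jac (cylCorners p₁ p₂) (diffMap α.total) q ≠ 0 := by
    let _ : MeasurableSpace (CylModel p₁ p₂) := borel _
    have _ : BorelSpace (CylModel p₁ p₂) := ⟨rfl⟩
    have h := ae_regular (MeasureTheory.Measure.addHaar (G := CylModel p₁ p₂)) isOpen_openCylinder
      hK hKΩ (α.contMDiffOn_diffMap.mono openCylinder_subset)
    obtain ⟨y, hy, hyr⟩ := (MeasureTheory.Measure.dense_of_ae h).exists_mem_open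
      (isOpen_ball (x := (0 : CylModel p₁ p₂)) (ε := r)) ⟨0, mem_ball_self hr⟩
    exact ⟨y, by simpa using hyr, hy⟩
  have hρs : ContMDiff 𝓘(ℝ, ℝ) 𝓘(ℝ, ℝ) ∞ ρ := ρ.contMDiff
  have hρ0' : ρ 0 = 0 := (hρ0.self_of_nhdsSet) 0 (by simp)
  have hρ1' : ρ 1 = 0 := (hρ0.self_of_nhdsSet) 1 (by simp)
  let v : Amb p₁ p₂ := (ambEquiv p₁ p₂).symm y
  let β : Lift g₁ f₁ g₂ f₂ :=
    { map₁ := α.map₁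
      map₂ := fun t x => α.map₂ t x - ρ t • v
      smooth₁ := α.smooth₁
      smooth₂ := α.smooth₂.sub
        ((hρs.comp contMDiff_fst).smul contMDiff_const).contMDiffOn
      map₁_zero := α.map₁_zero
      map₂_zero := by funext x; simp [hρ0', α.map₂_zero]
      map₁_one := α.map₁_one
      map₂_one := by funext x; simp [hρ1', α.map₂_one] }
  have hβ : ∀ q, diffMap β.total q = diffMap α.total q - ρ q.1 • y := by
    intro q
    simp only [diffMap, total, β, v, map_sub, map_smul, ContinuousLinearEquiv.apply_symm_apply]
    abel
  refine ⟨β, ⟨fun s x => α.map₁ s.2 x, fun s x => α.map₂ s.2 x - (s.1 * ρ s.2) • v, ?_, ?_, ?_, ?_⟩,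
    ?_⟩
  · exact α.smooth₁.comp (I := 𝓘(ℝ, ℝ × ℝ).prod (𝓡 p₁))
      (f := fun q : (ℝ × ℝ) × P₁ => (q.1.2, q.2))
      ((contDiff_snd.contMDiff.comp contMDiff_fst).prodMk contMDiff_snd).contMDiffOn
      fun q hq => ⟨hq.1.2, mem_univ _⟩
  · refine ContMDiffOn.sub (α.smooth₂.comp (I := 𝓘(ℝ, ℝ × ℝ).prod (𝓡 p₂))
      (f := fun q : (ℝ × ℝ) × P₂ => (q.1.2, q.2))
      ((contDiff_snd.contMDiff.comp contMDiff_fst).prodMk contMDiff_snd).contMDiffOn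
      fun q hq => ⟨hq.1.2, mem_univ _⟩) (ContMDiff.contMDiffOn ?_)
    exact ((contDiff_fst.contMDiff.comp contMDiff_fst).mul
      (hρs.comp (contDiff_snd.contMDiff.comp contMDiff_fst))).smul contMDiff_const
  · intro t _
    refine ⟨rfl, ?_, rfl, ?_⟩
    · funext x; simp
    · funext x; simp [β]
  · intro s _
    refine ⟨α.map₁_zero, ?_, α.map₁_one, ?_⟩
    · funext x; simp [hρ0', α.map₂_zero]
    · funext x; simp [hρ1', α.map₂_one]
  · intro q hq h0
    -- Off `K` the difference map of α has norm at least r, while the translation has norm at most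
    -- ‖y‖ < r.
    have hqK : q ∈ K := by
      by_contra hn
      have h1 := hb q ⟨hq, hn⟩
      rw [hβ, sub_eq_zero] at h0
      rw [h0, norm_smul, Real.norm_of_nonneg (hρ q.1).1] at h1
      nlinarith [(hρ q.1).2, norm_nonneg y]
    have h1 : ∀ᶠ t in 𝓝 q.1, ρ t = 1 := hρ1.filter_mono (nhds_le_nhdsSet (mem_image_of_mem _ hqK))
    have h2 : diffMap β.total =ᶠ[𝓝 q] fun q => diffMap α.total q - y := by
      filter_upwards [continuous_fst.continuousAt.eventually h1] with z hz
      rw [hβ, hz, one_smul]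
    rw [jac_congr h2, jac_sub_const]
    refine hy q hqK ?_
    rw [h2.self_of_nhds] at h0
    exact sub_eq_zero.mp h0

/-- The starts of the two lifts may differ: the linear homotopy between the difference maps is
constant at t = 1, and `hg` keeps it away from 0 at t = 0. -/
theorem zeroCount_eq {R : Type*} [CommRing R] {w : ℝ × P₁ × P₂ → R}
    (hw : IsCoherent (cylCorners p₁ p₂) w) (α : Lift g₁ f₁ g₂ f₂) (β : Lift g₁' f₁ g₂' f₂)
    (hf : ∀ x y, f₂ y - f₁ x ≠ 0)
    (hg : ∀ x y, ∀ s ∈ Icc (0 : ℝ) 1,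
      g₂ y - g₁ x + s • ((g₂' y - g₁' x) - (g₂ y - g₁ x)) ≠ 0)
    (hα : α.IsRegular) (hβ : β.IsRegular) :
    zeroCount (cylCorners p₁ p₂) w (diffMap α.total) (openCylinder P₁ P₂) =
      zeroCount (cylCorners p₁ p₂) w (diffMap β.total) (openCylinder P₁ P₂) := by
  obtain ⟨r, hr, K, hK, hKΩ, hb⟩ := exists_isCompact_le_norm (E := CylModel p₁ p₂)
    (isCompact_cylinder (P₁ := P₁) (P₂ := P₂)) isOpen_openCylinder openCylinder_subset
    (Φ := fun p => diffMap α.total p.1 + p.2 • (diffMap β.total p.1 - diffMap α.total p.1)) (by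
      have h1 : ContinuousOn (fun p : (ℝ × P₁ × P₂) × ℝ => diffMap α.total p.1)
        (cylinder P₁ P₂ ×ˢ Icc 0 1) :=
        α.contMDiffOn_diffMap.continuousOn.comp continuousOn_fst fun p hp => hp.1
      have h2 : ContinuousOn (fun p : (ℝ × P₁ × P₂) × ℝ => diffMap β.total p.1)
        (cylinder P₁ P₂ ×ˢ Icc 0 1) :=
        β.contMDiffOn_diffMap.continuousOn.comp continuousOn_fst fun p hp => hp.1
      exact h1.add (continuousOn_snd.smul (h2.sub h1))) (by
      rintro q hq s hs
      rcases eq_zero_or_eq_one hq with h | h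
      · dsimp only
        rw [α.diffMap_total_zero h, β.diffMap_total_zero h, ← map_sub, ← map_smul, ← map_add]
        exact (map_ne_zero_iff _ (ambEquiv p₁ p₂).injective).mpr (hg _ _ s hs)
      · dsimp only
        rw [α.diffMap_total_one h, β.diffMap_total_one h, sub_self, smul_zero, add_zero]
        exact (map_ne_zero_iff _ (ambEquiv p₁ p₂).injective).mpr (hf _ _))
  exact zeroCount_eq_of_linear_homotopy hw isOpen_openCylinder hK hKΩ
    (α.contMDiffOn_diffMap.mono openCylinder_subset)
    (β.contMDiffOn_diffMap.mono openCylinder_subset) hr hb hα hβ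

end Lift

end LinkMaps

namespace LinkMaps

/-! ### The derivative of the Gauss map -/

section GaussMap

universe u v

theorem hasMFDerivAt_smul_space {E H M F : Type*} [NormedAddCommGroup E] [NormedSpace ℝ E]
    [TopologicalSpace H] {I : ModelWithCorners ℝ E H} [TopologicalSpace M] [ChartedSpace H M]
    [NormedAddCommGroup F] [NormedSpace ℝ F] {c : M → ℝ} {f : M → F} {q : M}
    {c' : E →L[ℝ] ℝ} {f' : E →L[ℝ] F} (hc : HasMFDerivAt I 𝓘(ℝ, ℝ) c q c')
    (hf : HasMFDerivAt I 𝓘(ℝ, F) f q f') :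
    HasMFDerivAt I 𝓘(ℝ, F) (fun x => c x • f x) q (c q • f' + c'.smulRight (f q) : E →L[ℝ] F) := by
  refine ⟨hc.1.smul hf.1, ?_⟩
  simpa using! hc.2.smul hf.2

variable {p₁ p₂ : ℕ}
  {P₁ : Type u} [TopologicalSpace P₁] [ChartedSpace (EuclideanSpace ℝ (Fin p₁)) P₁]
  {P₂ : Type v} [TopologicalSpace P₂] [ChartedSpace (EuclideanSpace ℝ (Fin p₂)) P₂]
  {f₁ : P₁ → Amb p₁ p₂} {f₂ : P₂ → Amb p₁ p₂}

/-- The linear map `(s, v) ↦ s • e + A v` on the tangent space of the cylinder. -/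
noncomputable def frameMap {x₁ : P₁} {x₂ : P₂} (e : Amb p₁ p₂)
    (A : TangentSpace (𝓡 p₁) x₁ × TangentSpace (𝓡 p₂) x₂ →ₗ[ℝ] Amb p₁ p₂) :
    ℝ × TangentSpace (𝓡 p₁) x₁ × TangentSpace (𝓡 p₂) x₂ →ₗ[ℝ] Amb p₁ p₂ :=
  (LinearMap.toSpanSingleton ℝ _ e).coprod A

theorem frameDet_eq_det_frameMap (x₁ : P₁) (x₂ : P₂) (e : Amb p₁ p₂)
    (A : TangentSpace (𝓡 p₁) x₁ × TangentSpace (𝓡 p₂) x₂ →ₗ[ℝ] Amb p₁ p₂) :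
    frameDet x₁ x₂ e A = (ambBasis p₁ p₂).det (inModel (frameMap e A) ∘ cylBasis p₁ p₂) := by
  rw [← frameDet_eq_det]
  have h1 : frameMap e A (1, 0) = e := by simp [frameMap]
  have h2 : frameMap e A ∘ₗ LinearMap.inr ℝ ℝ _ = A := by ext v <;> simp [frameMap]
  rw [h1, h2]

theorem frameDet_eq_det_comp (x₁ : P₁) (x₂ : P₂) (e : Amb p₁ p₂)
    (A : TangentSpace (𝓡 p₁) x₁ × TangentSpace (𝓡 p₂) x₂ →ₗ[ℝ] Amb p₁ p₂) :
    frameDet x₁ x₂ e A = LinearMap.det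
      ((ambEquiv p₁ p₂).toLinearEquiv.toLinearMap ∘ₗ inModel (frameMap e A)) := by
  rw [frameDet_eq_det_frameMap, det_ambEquiv_comp]

/-- The multiples of x in the other p₁ + p₂ columns are removed by a transvection, of determinant 1;
what remains scales x by κ and those columns by μ. -/
theorem frameDet_smul_add (x₁ : P₁) (x₂ : P₂) (x : Amb p₁ p₂) {κ μ : ℝ}
    {A A' : TangentSpace (𝓡 p₁) x₁ × TangentSpace (𝓡 p₂) x₂ →ₗ[ℝ] Amb p₁ p₂}
    (l : TangentSpace (𝓡 p₁) x₁ × TangentSpace (𝓡 p₂) x₂ →ₗ[ℝ] ℝ) (hμ : μ ≠ 0)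
    (h : ∀ v, A' v = μ • A v + l v • x) :
    frameDet x₁ x₂ (κ • x) A' = κ * μ ^ (p₁ + p₂) * frameDet x₁ x₂ x A := by
  let V := EuclideanSpace ℝ (Fin p₁) × EuclideanSpace ℝ (Fin p₂)
  let l' : V →ₗ[ℝ] ℝ := l
  let B : V →ₗ[ℝ] Amb p₁ p₂ := A
  let B' : V →ₗ[ℝ] Amb p₁ p₂ := A'
  have hB : ∀ v, B' v = μ • B v + l' v • x := h
  let S : CylModel p₁ p₂ →ₗ[ℝ] CylModel p₁ p₂ :=
    LinearMap.transvection ((μ⁻¹ • l') ∘ₗ LinearMap.snd ℝ ℝ V) ((1, 0) : CylModel p₁ p₂)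
  let T : CylModel p₁ p₂ →ₗ[ℝ] CylModel p₁ p₂ :=
    LinearMap.prodMap (κ • (LinearMap.id : ℝ →ₗ[ℝ] ℝ)) (μ • (LinearMap.id : V →ₗ[ℝ] V))
  have hS : LinearMap.det S = 1 := by
    rw [LinearMap.transvection.det]
    simp
  have hT : LinearMap.det T = κ * μ ^ (p₁ + p₂) := by
    refine (LinearMap.det_prodMap _ _).trans ?_
    rw [LinearMap.det_smul, LinearMap.det_smul]
    simp [V]
  have hcomp : (ambEquiv p₁ p₂).toLinearEquiv.toLinearMap ∘ₗ inModel (frameMap (κ • x) A') =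
      ((ambEquiv p₁ p₂).toLinearEquiv.toLinearMap ∘ₗ inModel (frameMap x A)) ∘ₗ (S ∘ₗ T) := by
    refine LinearMap.ext fun z => congrArg (ambEquiv p₁ p₂) ?_
    obtain ⟨s, v⟩ := z
    have h1 : S (T (s, v)) = (κ * s + l' v, μ • v) := by
      simp [S, T, LinearMap.transvection.apply, hμ]
    change s • κ • x + B' v = inModel (frameMap x A) (S (T (s, v)))
    rw [h1, hB v]
    change _ = (κ * s + l' v) • x + B (μ • v)
    rw [map_smul, add_smul, mul_comm κ s, mul_smul]
    abel
  rw [frameDet_eq_det_comp, frameDet_eq_det_comp, hcomp, LinearMap.det_comp, LinearMap.det_comp, hS, hT]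
  ring

/-- The difference `f₂ x₂ - f₁ x₁`. -/
def sepMap (f₁ : P₁ → Amb p₁ p₂) (f₂ : P₂ → Amb p₁ p₂) (p : P₁ × P₂) : Amb p₁ p₂ := f₂ p.2 - f₁ p.1

theorem contMDiff_sepMap (hf : IsLinkMap f₁ f₂) :
    ContMDiff ((𝓡 p₁).prod (𝓡 p₂)) 𝓘(ℝ, Amb p₁ p₂) ∞ (sepMap f₁ f₂) :=
  (hf.smooth₂.comp contMDiff_snd).sub (hf.smooth₁.comp contMDiff_fst)

theorem norm_smul_gaussMap (hf : IsLinkMap f₁ f₂) (p : P₁ × P₂) :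
    ‖sepMap f₁ f₂ p‖ • (gaussMap hf p : Amb p₁ p₂) = sepMap f₁ f₂ p := by
  simp only [gaussMap, sepMap]
  rw [smul_smul, mul_inv_cancel₀ (norm_ne_zero_iff.mpr (hf.sub_ne_zero _ _)), one_smul]

theorem sepMap_norm_pos (hf : IsLinkMap f₁ f₂) (p : P₁ × P₂) : 0 < ‖sepMap f₁ f₂ p‖ :=
  norm_pos_iff.mpr (hf.sub_ne_zero _ _)

theorem gaussMap_eq_iff (hf : IsLinkMap f₁ f₂) {p : P₁ × P₂} {x : UnitSphere p₁ p₂} :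
    gaussMap hf p = x ↔ ∃ t : ℝ, 0 ≤ t ∧ sepMap f₁ f₂ p = t • (x : Amb p₁ p₂) := by
  constructor
  · rintro rfl
    exact ⟨_, norm_nonneg _, (norm_smul_gaussMap hf p).symm⟩
  · rintro ⟨t, ht, h⟩
    have h1 : ‖sepMap f₁ f₂ p‖ = t := by
      rw [h, norm_smul, norm_eq_of_mem_sphere, mul_one, Real.norm_of_nonneg ht]
    have h2 : t ≠ 0 := h1 ▸ (sepMap_norm_pos hf p).ne'
    have h3 := norm_smul_gaussMap hf p
    rw [h1, h] at h3
    exact Subtype.ext (smul_right_injective _ h2 h3)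

theorem contMDiff_norm_sepMap (hf : IsLinkMap f₁ f₂) :
    ContMDiff ((𝓡 p₁).prod (𝓡 p₂)) 𝓘(ℝ, ℝ) ∞ (fun p => ‖sepMap f₁ f₂ p‖) := fun p =>
  (contDiffAt_norm ℝ (hf.sub_ne_zero p.1 p.2)).contMDiffAt.comp p (contMDiff_sepMap hf p)

variable [IsManifold (𝓡 p₁) ∞ P₁] [IsManifold (𝓡 p₂) ∞ P₂]

theorem contMDiff_gaussMap (hf : IsLinkMap f₁ f₂) :
    ContMDiff ((𝓡 p₁).prod (𝓡 p₂)) (𝓡 (p₁ + p₂)) ∞ (gaussMap hf) := by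
  have : Fact (Module.finrank ℝ (Amb p₁ p₂) = p₁ + p₂ + 1) := ⟨by simp⟩
  refine ContMDiff.codRestrict_sphere (f := fun p => ‖sepMap f₁ f₂ p‖⁻¹ • sepMap f₁ f₂ p) ?_
    fun p => (gaussMap hf p).2
  exact ((contMDiff_norm_sepMap hf).inv₀ fun p => (sepMap_norm_pos hf p).ne').smul
    (contMDiff_sepMap hf)

/-- The derivative of the difference `f₂ x₂ - f₁ x₁`. -/
noncomputable def sepDeriv (f₁ : P₁ → Amb p₁ p₂) (f₂ : P₂ → Amb p₁ p₂) (p : P₁ × P₂) :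
    EuclideanSpace ℝ (Fin p₁) × EuclideanSpace ℝ (Fin p₂) →L[ℝ] Amb p₁ p₂ :=
  mfderiv ((𝓡 p₁).prod (𝓡 p₂)) 𝓘(ℝ, Amb p₁ p₂) (sepMap f₁ f₂) p

omit [IsManifold (𝓡 p₁) ∞ P₁] [IsManifold (𝓡 p₂) ∞ P₂] in
theorem hasMFDerivAt_sepMap (hf : IsLinkMap f₁ f₂) (p : P₁ × P₂) :
    HasMFDerivAt ((𝓡 p₁).prod (𝓡 p₂)) 𝓘(ℝ, Amb p₁ p₂) (sepMap f₁ f₂) p (sepDeriv f₁ f₂ p) :=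
  ((contMDiff_sepMap hf p).mdifferentiableAt (by simp)).hasMFDerivAt

/-- The product rule for f₂ - f₁ = ‖f₂ - f₁‖ G; `l` is the derivative of the norm. -/
theorem exists_sepDeriv_eq (hf : IsLinkMap f₁ f₂) (p : P₁ × P₂) :
    ∃ l : EuclideanSpace ℝ (Fin p₁) × EuclideanSpace ℝ (Fin p₂) →L[ℝ] ℝ, ∀ v,
      sepDeriv f₁ f₂ p v = ‖sepMap f₁ f₂ p‖ • sphereDeriv (gaussMap hf) p v +
        l v • (gaussMap hf p : Amb p₁ p₂) := by
  have : Fact (Module.finrank ℝ (Amb p₁ p₂) = p₁ + p₂ + 1) := ⟨by simp⟩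
  have h1 := ((contMDiff_norm_sepMap hf p).mdifferentiableAt (by simp)).hasMFDerivAt
  have h2 := (((contMDiff_coe_sphere (m := ∞) (n := p₁ + p₂) (gaussMap hf p)).mdifferentiableAt
    (by simp)).hasMFDerivAt).comp p
      ((contMDiff_gaussMap hf p).mdifferentiableAt (by simp)).hasMFDerivAt
  have h3 := hasMFDerivAt_smul_space h1 h2
  have h4 : (fun p => ‖sepMap f₁ f₂ p‖ • ((Subtype.val ∘ gaussMap hf) p : Amb p₁ p₂)) =
      sepMap f₁ f₂ := funext fun p => norm_smul_gaussMap hf p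
  rw [h4] at h3
  exact ⟨mfderiv ((𝓡 p₁).prod (𝓡 p₂)) 𝓘(ℝ, ℝ) (fun p => ‖sepMap f₁ f₂ p‖) p, fun v =>
    congrArg (fun A : EuclideanSpace ℝ (Fin p₁) × EuclideanSpace ℝ (Fin p₂) →L[ℝ]
      Amb p₁ p₂ => A v) h3.mfderiv⟩

/-- Since f₂ - f₁ = ‖f₂ - f₁‖ x at `p`, the derivative in t is a multiple of x, and along P₁ × P₂ it
is a multiple of DG plus a multiple of x. One computation serves three choices of (a, b): (t, 1) for
`raySet`, ((1 - t) T, 1) for `rayLift`, and (0, 1/t) for Sard's theorem on the sphere. -/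
theorem jac_scaled (hf : IsLinkMap f₁ f₂) {a b : ℝ → ℝ} {a' b' t : ℝ} (ha : HasDerivAt a a' t)
    (hb : HasDerivAt b b' t) (hbt : b t ≠ 0) {p : P₁ × P₂} {x : UnitSphere p₁ p₂}
    (hx : gaussMap hf p = x) :
    jac (cylCorners p₁ p₂)
        (fun q : ℝ × P₁ × P₂ => ambEquiv p₁ p₂ (b q.1 • sepMap f₁ f₂ q.2 - a q.1 • (x : Amb p₁ p₂)))
        (t, p) =
      (b' * ‖sepMap f₁ f₂ p‖ - a') * (b t * ‖sepMap f₁ f₂ p‖) ^ (p₁ + p₂) *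
        frameDet p.1 p.2 (x : Amb p₁ p₂) (sphereDeriv (gaussMap hf) p) := by
  have d1 : HasMFDerivAt (cylCorners p₁ p₂) 𝓘(ℝ, ℝ) (fun q : ℝ × P₁ × P₂ => b q.1) (t, p)
      ((ContinuousLinearMap.toSpanSingleton ℝ b' : ℝ →L[ℝ] ℝ) ∘L
        ContinuousLinearMap.fst ℝ ℝ (EuclideanSpace ℝ (Fin p₁) × EuclideanSpace ℝ (Fin p₂))) :=
    HasMFDerivAt.comp (t, p) (g := b) hb.hasFDerivAt.hasMFDerivAt (hasMFDerivAt_fst (t, p))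
  have d2 : HasMFDerivAt (cylCorners p₁ p₂) 𝓘(ℝ, ℝ) (fun q : ℝ × P₁ × P₂ => a q.1) (t, p)
      ((ContinuousLinearMap.toSpanSingleton ℝ a' : ℝ →L[ℝ] ℝ) ∘L
        ContinuousLinearMap.fst ℝ ℝ (EuclideanSpace ℝ (Fin p₁) × EuclideanSpace ℝ (Fin p₂))) :=
    HasMFDerivAt.comp (t, p) (g := a) ha.hasFDerivAt.hasMFDerivAt (hasMFDerivAt_fst (t, p))
  have d3 : HasMFDerivAt (cylCorners p₁ p₂) 𝓘(ℝ, Amb p₁ p₂)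
      (fun q : ℝ × P₁ × P₂ => sepMap f₁ f₂ q.2) (t, p)
      (sepDeriv f₁ f₂ p ∘L
        ContinuousLinearMap.snd ℝ ℝ (EuclideanSpace ℝ (Fin p₁) × EuclideanSpace ℝ (Fin p₂))) :=
    HasMFDerivAt.comp (t, p) (g := sepMap f₁ f₂) (hasMFDerivAt_sepMap hf p) (hasMFDerivAt_snd (t, p))
  have d4 : HasMFDerivAt (cylCorners p₁ p₂) 𝓘(ℝ, Amb p₁ p₂)
      (fun _ : ℝ × P₁ × P₂ => (x : Amb p₁ p₂)) (t, p) (0 : CylModel p₁ p₂ →L[ℝ] Amb p₁ p₂) :=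
    hasMFDerivAt_const _ _
  have d5 := (hasMFDerivAt_smul_space d1 d3).sub (hasMFDerivAt_smul_space d2 d4)
  have d6 := (ContinuousLinearMap.hasMFDerivAt (ambEquiv p₁ p₂).toContinuousLinearMap).comp (t, p) d5
  obtain ⟨l, hl⟩ := exists_sepDeriv_eq hf p
  have hsep := norm_smul_gaussMap hf p
  rw [hx] at hsep hl
  let A' : EuclideanSpace ℝ (Fin p₁) × EuclideanSpace ℝ (Fin p₂) →ₗ[ℝ] Amb p₁ p₂ :=
    b t • (sepDeriv f₁ f₂ p).toLinearMap
  let A : EuclideanSpace ℝ (Fin p₁) × EuclideanSpace ℝ (Fin p₂) →ₗ[ℝ] Amb p₁ p₂ :=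
    sphereDeriv (gaussMap hf) p
  have hA : ∀ v, A' v = (b t * ‖sepMap f₁ f₂ p‖) • A v + (b t • l.toLinearMap) v • (x : Amb p₁ p₂) := by
    intro v
    have h : sepDeriv f₁ f₂ p v = ‖sepMap f₁ f₂ p‖ • A v + l v • (x : Amb p₁ p₂) := hl v
    change b t • sepDeriv f₁ f₂ p v = _ + (b t * l v) • (x : Amb p₁ p₂)
    rw [h, smul_add, smul_smul, smul_smul]
  refine Eq.trans ?_ (frameDet_smul_add (κ := b' * ‖sepMap f₁ f₂ p‖ - a') p.1 p.2 (x : Amb p₁ p₂)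
    (b t • l.toLinearMap) (mul_ne_zero hbt (sepMap_norm_pos hf p).ne') hA)
  refine Eq.trans ?_ (frameDet_eq_det_comp _ _ _ _).symm
  unfold jac
  refine (congrArg (fun A : CylModel p₁ p₂ →L[ℝ] CylModel p₁ p₂ => A.det) d6.mfderiv).trans ?_
  refine congrArg (LinearMap.det (M := CylModel p₁ p₂)) (LinearMap.ext fun z =>
    congrArg (ambEquiv p₁ p₂) ?_)
  obtain ⟨s, v⟩ := z
  change (b t • sepDeriv f₁ f₂ p v + (s • b') • sepMap f₁ f₂ p) -
    (a t • (0 : Amb p₁ p₂) + (s • a') • (x : Amb p₁ p₂)) =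
    s • ((b' * ‖sepMap f₁ f₂ p‖ - a') • (x : Amb p₁ p₂)) + b t • sepDeriv f₁ f₂ p v
  nth_rewrite 1 [← hsep]
  simp only [smul_eq_mul]
  module

omit [IsManifold (𝓡 p₁) ∞ P₁] [IsManifold (𝓡 p₂) ∞ P₂] in
-- The tangent space of the sphere at x is the orthogonal complement of x, so x completes a
-- surjective DG to a surjective map onto the ambient space; the converse is a dimension count.
theorem isRegularValue_iff (hf : IsLinkMap f₁ f₂) {x : UnitSphere p₁ p₂} :
    IsRegularValue (gaussMap hf) x ↔ ∀ p, gaussMap hf p = x →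
      frameDet p.1 p.2 (x : Amb p₁ p₂) (sphereDeriv (gaussMap hf) p) ≠ 0 := by
  refine forall₂_congr fun p hp => ?_
  subst hp
  rw [frameDet_eq_det_frameMap, ← bijective_iff_det_ne_zero]
  let ι : EuclideanSpace ℝ (Fin (p₁ + p₂)) →L[ℝ] Amb p₁ p₂ :=
    mfderiv (𝓡 (p₁ + p₂)) 𝓘(ℝ, Amb p₁ p₂) (fun y : UnitSphere p₁ p₂ => (y : Amb p₁ p₂)) (gaussMap hf p)
  let B : EuclideanSpace ℝ (Fin p₁) × EuclideanSpace ℝ (Fin p₂) →L[ℝ]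
      EuclideanSpace ℝ (Fin (p₁ + p₂)) :=
    mfderiv ((𝓡 p₁).prod (𝓡 p₂)) (𝓡 (p₁ + p₂)) (gaussMap hf) p
  change Function.Surjective B ↔ _
  have hC : ∀ (s : ℝ) v, inModel (frameMap (gaussMap hf p : Amb p₁ p₂)
      (sphereDeriv (gaussMap hf) p)) (s, v) = s • (gaussMap hf p : Amb p₁ p₂) + ι (B v) :=
    fun s v => rfl
  constructor
  · intro hB
    rw [← surjective_iff_bijective]
    intro y
    have : Fact (Module.finrank ℝ (Amb p₁ p₂) = p₁ + p₂ + 1) := ⟨by simp⟩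
    have hι : ι.range = (Submodule.span ℝ {(gaussMap hf p : Amb p₁ p₂)})ᗮ := by
      convert! range_mvfderiv_subtypeVal (gaussMap hf p)
    obtain ⟨z, hz, z', hz', rfl⟩ := (Submodule.span ℝ
      {(gaussMap hf p : Amb p₁ p₂)}).exists_add_mem_mem_orthogonal y
    rw [← hι] at hz'
    obtain ⟨w, rfl⟩ := hz'
    obtain ⟨v, rfl⟩ := hB w
    obtain ⟨s, rfl⟩ := Submodule.mem_span_singleton.mp hz
    exact ⟨(s, v), hC s v⟩
  · intro h
    have hinj : Function.Injective B := by
      refine (injective_iff_map_eq_zero B).mpr fun v hv => ?_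
      have h1 := hC 0 v
      rw [hv, map_zero, zero_smul, add_zero] at h1
      exact congrArg Prod.snd (h.1 (h1.trans (map_zero _).symm))
    refine (LinearMap.injective_iff_surjective_of_finrank_eq_finrank (f := B.toLinearMap) ?_).mp hinj
    simp

end GaussMap

end LinkMaps

namespace LinkMaps

/-! ### Linking numbers -/

section LinkingNumber

universe u v

variable {p₁ p₂ : ℕ}
  {P₁ : Type u} [TopologicalSpace P₁] [ChartedSpace (EuclideanSpace ℝ (Fin p₁)) P₁]
  {P₂ : Type v} [TopologicalSpace P₂] [ChartedSpace (EuclideanSpace ℝ (Fin p₂)) P₂]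
  {f₁ g₁ : P₁ → Amb p₁ p₂} {f₂ g₂ : P₂ → Amb p₁ p₂}

theorem sign_mul_of_pos {c : ℝ} (hc : 0 < c) (d : ℝ) :
    SignType.sign (c * d) = SignType.sign d := by
  rw [sign_mul, sign_pos hc, one_mul]

/-- An equation f₂ - f₁ = t x with t ≥ 0 determines t and says that the Gauss map has the value x.
-/
theorem raySet_bijOn (hf : IsLinkMap f₁ f₂) (x : UnitSphere p₁ p₂) :
    BijOn Prod.snd (raySet f₁ f₂ x) (gaussMap hf ⁻¹' {x}) := by
  have key : ∀ q ∈ raySet f₁ f₂ x, 0 ≤ q.1 ∧ sepMap f₁ f₂ q.2 = q.1 • (x : Amb p₁ p₂) := by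
    rintro q ⟨⟨h1, -⟩, h2⟩
    have h3 : f₁ q.2.1 = f₂ q.2.2 - q.1 • (x : Amb p₁ p₂) := h2
    exact ⟨h1, by rw [sepMap, h3]; abel⟩
  refine ⟨fun q hq => ?_, ?_, ?_⟩
  · exact (gaussMap_eq_iff hf).mpr ⟨q.1, key q hq⟩
  · intro q hq q' hq' h
    have h1 := (key q hq).2
    rw [h, (key q' hq').2] at h1
    exact Prod.ext (smul_left_injective ℝ (ne_zero_of_mem_unit_sphere x) h1).symm h
  · intro p hp
    obtain ⟨t, ht, h⟩ := (gaussMap_eq_iff hf).mp hp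
    refine ⟨(t, p), ⟨⟨ht, mem_univ _⟩, ?_⟩, rfl⟩
    change f₁ p.1 = f₂ p.2 - t • (x : Amb p₁ p₂)
    rw [← h, sepMap]
    abel

theorem contMDiff_rayMap (hf : IsLinkMap f₁ f₂) (x : Amb p₁ p₂) :
    ContMDiff (cylCorners p₁ p₂) 𝓘(ℝ, Amb p₁ p₂ × Amb p₁ p₂) ∞ (rayMap f₁ f₂ x) := by
  refine ContMDiff.prodMk_space (hf.smooth₁.comp (contMDiff_fst.comp contMDiff_snd)) ?_
  exact (hf.smooth₂.comp (contMDiff_snd.comp contMDiff_snd)).sub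
    (contMDiff_fst.smul contMDiff_const)

variable [IsManifold (𝓡 p₁) ∞ P₁] [IsManifold (𝓡 p₂) ∞ P₂]

/-- Two minus signs cancel: one because `rayMap` moves `f₂` in the direction -x, the other because
[0, ∞) is oriented towards 0. -/
theorem raySign_eq (o₁ : ManifoldOrientation p₁ P₁) (o₂ : ManifoldOrientation p₂ P₂)
    (hf : IsLinkMap f₁ f₂) {x : UnitSphere p₁ p₂} {q : ℝ × P₁ × P₂} (hq : q ∈ raySet f₁ f₂ x) :
    raySign o₁ o₂ f₁ f₂ x q = sphereSign o₁ o₂ (gaussMap hf) q.2 := by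
  have hG : gaussMap hf q.2 = x := (raySet_bijOn hf x).mapsTo hq
  have hpos := sepMap_norm_pos hf q.2
  -- At t = 0 the images would meet. Hence the point is interior, and the derivative relative to the
  -- half cylinder is the ordinary one.
  have ht : 0 < q.1 := by
    refine lt_of_le_of_ne hq.1.1 fun h0 => ?_
    have h3 : f₁ q.2.1 = f₂ q.2.2 - q.1 • (x : Amb p₁ p₂) := hq.2
    rw [← h0, zero_smul, sub_zero] at h3
    exact hf.sub_ne_zero q.2.1 q.2.2 (sub_eq_zero.mpr h3.symm)
  have hs : halfCylinder P₁ P₂ ∈ 𝓝 q :=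
    Filter.mem_of_superset ((isOpen_Ioi.prod isOpen_univ).mem_nhds ⟨ht, mem_univ _⟩)
      (prod_mono Ioi_subset_Ici_self subset_rfl)
  let N := normalDeriv (rayMap f₁ f₂ x) (halfCylinder P₁ P₂) q
  have h1 : N (-1, 0) = (-1 : ℝ) • N (1, 0) := by
    rw [← map_smul]
    simp
  have h2 := frameDet_smul_add q.2.1 q.2.2 (N (1, 0)) (κ := -1) (A := N ∘ₗ LinearMap.inr ℝ ℝ _)
    (A' := N ∘ₗ LinearMap.inr ℝ ℝ _) 0 one_ne_zero (by simp)
  rw [← h1] at h2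
  have h3 := frameDet_normalDeriv ((contMDiff_rayMap hf x q).mdifferentiableAt (by simp)) hs
  have h4 : diffMap (rayMap f₁ f₂ x) = fun q : ℝ × P₁ × P₂ =>
      ambEquiv p₁ p₂ ((fun _ : ℝ => (1 : ℝ)) q.1 • sepMap f₁ f₂ q.2 -
        (fun t : ℝ => t) q.1 • (x : Amb p₁ p₂)) := by
    funext q
    simp only [diffMap, rayMap, sepMap, one_smul]
    congr 1
    abel
  have h5 := jac_scaled hf (hasDerivAt_id' q.1) (hasDerivAt_const q.1 (1 : ℝ)) one_ne_zero hG
  rw [← h4] at h5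
  have h6 : frameDet q.2.1 q.2.2 (N (-1, 0)) (N ∘ₗ LinearMap.inr ℝ ℝ _) =
      ‖sepMap f₁ f₂ q.2‖ ^ (p₁ + p₂) *
        frameDet q.2.1 q.2.2 (x : Amb p₁ p₂) (sphereDeriv (gaussMap hf) q.2) := by
    refine h2.trans ?_
    rw [h3]
    refine (congrArg _ h5).trans ?_
    ring
  rw [raySign, sphereSign, frameSign_eq, frameSign_eq, h6, sign_mul_of_pos (pow_pos hpos _), hG]

/-- The number of points in the inverse image of `x` under the Gauss map, counted with weights and
signs. -/
noncomputable def degreeCount {R : Type*} [CommRing R] (w : P₁ × P₂ → R) (hf : IsLinkMap f₁ f₂)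
    (x : UnitSphere p₁ p₂) : R :=
  ∑ᶠ p ∈ gaussMap hf ⁻¹' {x}, w p *
    ((SignType.sign (frameDet p.1 p.2 (x : Amb p₁ p₂) (sphereDeriv (gaussMap hf) p)) : ℤ) : R)

/-- The lift of a link map that moves `f₂` along a ray. -/
noncomputable def rayLift (hf : IsLinkMap f₁ f₂) (T : ℝ) (x : Amb p₁ p₂) :
    Lift f₁ f₁ (fun y => f₂ y - T • x) f₂ where
  map₁ _ := f₁
  map₂ t y := f₂ y - ((1 - t) * T) • x
  smooth₁ := (hf.smooth₁.comp contMDiff_snd).contMDiffOn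
  smooth₂ := ((hf.smooth₂.comp contMDiff_snd).sub
    (((contMDiff_const.sub contMDiff_fst).mul contMDiff_const).smul contMDiff_const)).contMDiffOn
  map₁_zero := rfl
  map₂_zero := by simp
  map₁_one := rfl
  map₂_one := by simp

omit [IsManifold (𝓡 p₁) ∞ P₁] [IsManifold (𝓡 p₂) ∞ P₂] in
theorem diffMap_rayLift (hf : IsLinkMap f₁ f₂) (T : ℝ) (x : Amb p₁ p₂) :
    diffMap (rayLift hf T x).total = fun q : ℝ × P₁ × P₂ =>
      ambEquiv p₁ p₂ ((fun _ : ℝ => (1 : ℝ)) q.1 • sepMap f₁ f₂ q.2 -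
        (fun t : ℝ => (1 - t) * T) q.1 • x) := by
  funext q
  simp only [diffMap, Lift.total, rayLift, sepMap, one_smul]
  congr 1
  abel

omit [IsManifold (𝓡 p₁) ∞ P₁] [IsManifold (𝓡 p₂) ∞ P₂] in
theorem diffMap_rayLift_eq_zero_iff (hf : IsLinkMap f₁ f₂) {T : ℝ} {x : Amb p₁ p₂}
    {q : ℝ × P₁ × P₂} : diffMap (rayLift hf T x).total q = 0 ↔
      sepMap f₁ f₂ q.2 = ((1 - q.1) * T) • x := by
  rw [diffMap_rayLift, map_eq_zero_iff _ (ambEquiv p₁ p₂).injective, one_smul, sub_eq_zero]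

omit [IsManifold (𝓡 p₁) ∞ P₁] [IsManifold (𝓡 p₂) ∞ P₂] in
-- The zero over `p` lies at the time t with (1 - t) T = ‖f₂ - f₁‖, and the bound on T puts this
-- time strictly between 0 and 1.
theorem rayLift_bijOn (hf : IsLinkMap f₁ f₂) {T : ℝ} {x : UnitSphere p₁ p₂}
    (hT : ∀ p, ‖sepMap f₁ f₂ p‖ < T) :
    BijOn Prod.snd {q ∈ Lift.openCylinder P₁ P₂ | diffMap (rayLift hf T x).total q = 0}
      (gaussMap hf ⁻¹' {x}) := by
  -- If P₁ × P₂ is empty, `hT` says nothing about T; therefore positivity is stated only in the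
  -- presence of a point.
  have hT0 : ∀ _ : P₁ × P₂, 0 < T := fun p => (norm_nonneg _).trans_lt (hT p)
  refine ⟨?_, ?_, ?_⟩
  · rintro q ⟨hq, h0⟩
    exact (gaussMap_eq_iff hf).mpr ⟨_, mul_nonneg (sub_nonneg.mpr hq.1.2.le) (hT0 q.2).le,
      (diffMap_rayLift_eq_zero_iff hf).mp h0⟩
  · rintro q ⟨hq, h0⟩ q' ⟨hq', h0'⟩ h
    have h1 := (diffMap_rayLift_eq_zero_iff hf).mp h0
    rw [h, (diffMap_rayLift_eq_zero_iff hf).mp h0'] at h1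
    have h2 := mul_right_cancel₀ (hT0 q.2).ne'
      (smul_left_injective ℝ (ne_zero_of_mem_unit_sphere x) h1)
    exact Prod.ext (by linarith) h
  · intro p hp
    have hp' : gaussMap hf p = x := hp
    have hTp := hT0 p
    refine ⟨(1 - ‖sepMap f₁ f₂ p‖ / T, p), ⟨⟨⟨?_, ?_⟩, mem_univ _⟩, ?_⟩, rfl⟩
    · exact sub_pos.mpr ((div_lt_one hTp).mpr (hT p))
    · exact sub_lt_self _ (div_pos (sepMap_norm_pos hf p) hTp)
    · rw [diffMap_rayLift_eq_zero_iff, ← hp', sub_sub_cancel, div_mul_cancel₀ _ hTp.ne',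
        norm_smul_gaussMap hf p]

theorem jac_rayLift (hf : IsLinkMap f₁ f₂) (T : ℝ) {x : UnitSphere p₁ p₂} {q : ℝ × P₁ × P₂}
    (hq : gaussMap hf q.2 = x) :
    jac (cylCorners p₁ p₂) (diffMap (rayLift hf T x).total) q =
      T * ‖sepMap f₁ f₂ q.2‖ ^ (p₁ + p₂) *
        frameDet q.2.1 q.2.2 (x : Amb p₁ p₂) (sphereDeriv (gaussMap hf) q.2) := by
  have h := jac_scaled hf (((hasDerivAt_id' q.1).const_sub 1).mul_const T)
    (hasDerivAt_const q.1 (1 : ℝ)) one_ne_zero hq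
  rw [diffMap_rayLift]
  refine h.trans ?_
  ring

theorem isRegular_rayLift (hf : IsLinkMap f₁ f₂) {T : ℝ} {x : UnitSphere p₁ p₂}
    (hT : ∀ p, ‖sepMap f₁ f₂ p‖ < T) (hx : IsRegularValue (gaussMap hf) x) :
    (rayLift hf T (x : Amb p₁ p₂)).IsRegular := by
  intro q hq h0
  have hG : gaussMap hf q.2 = x := (rayLift_bijOn hf hT).mapsTo ⟨hq, h0⟩
  rw [jac_rayLift hf T hG]
  exact mul_ne_zero (mul_ne_zero ((norm_nonneg _).trans_lt (hT q.2)).ne'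
    (pow_ne_zero _ (sepMap_norm_pos hf q.2).ne')) ((isRegularValue_iff hf).mp hx q.2 hG)

theorem zeroCount_rayLift {R : Type*} [CommRing R] (w : P₁ × P₂ → R) (hf : IsLinkMap f₁ f₂) {T : ℝ}
    {x : UnitSphere p₁ p₂} (hT : ∀ p, ‖sepMap f₁ f₂ p‖ < T) :
    zeroCount (cylCorners p₁ p₂) (fun q => w q.2) (diffMap (rayLift hf T x).total)
      (Lift.openCylinder P₁ P₂) = degreeCount w hf x := by
  refine finsum_mem_eq_of_bijOn Prod.snd (rayLift_bijOn hf hT) fun q hq => ?_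
  have hG : gaussMap hf q.2 = x := (rayLift_bijOn hf hT).mapsTo hq
  rw [signAt, jac_rayLift hf T hG, sign_mul_of_pos (mul_pos ((norm_nonneg _).trans_lt (hT q.2))
    (pow_pos (sepMap_norm_pos hf q.2) _))]

omit [TopologicalSpace P₁] [ChartedSpace (EuclideanSpace ℝ (Fin p₁)) P₁] [TopologicalSpace P₂]
  [ChartedSpace (EuclideanSpace ℝ (Fin p₂)) P₂]
  [IsManifold (𝓡 p₁) ∞ P₁] [IsManifold (𝓡 p₂) ∞ P₂] in
theorem rayLift_start_ne_zero {T : ℝ} {x : UnitSphere p₁ p₂}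
    (hT : ∀ p, ‖sepMap f₁ f₂ p‖ < T) (y₁ : P₁) (y₂ : P₂) :
    f₂ y₂ - T • (x : Amb p₁ p₂) - f₁ y₁ ≠ 0 := by
  intro h
  have h1 : sepMap f₁ f₂ (y₁, y₂) = T • (x : Amb p₁ p₂) := by
    refine sub_eq_zero.mp (Eq.trans ?_ h)
    simp only [sepMap]
    abel
  have h2 := hT (y₁, y₂)
  rw [h1, norm_smul, norm_eq_of_mem_sphere, mul_one] at h2
  exact absurd h2 (not_lt.mpr (le_abs_self T))

variable [CompactSpace P₁] [CompactSpace P₂]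

omit [IsManifold (𝓡 p₁) ∞ P₁] [IsManifold (𝓡 p₂) ∞ P₂] in
theorem exists_norm_sepMap_bounds (hf : IsLinkMap f₁ f₂) :
    ∃ m > 0, ∃ M > 0, ∀ p, m ≤ ‖sepMap f₁ f₂ p‖ ∧ ‖sepMap f₁ f₂ p‖ ≤ M := by
  have hc : Continuous fun p => ‖sepMap f₁ f₂ p‖ := (contMDiff_sepMap hf).continuous.norm
  rcases isEmpty_or_nonempty (P₁ × P₂) with he | hne
  · exact ⟨1, one_pos, 1, one_pos, fun p => he.elim p⟩
  · obtain ⟨a, -, ha⟩ := isCompact_univ.exists_isMinOn univ_nonempty hc.continuousOn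
    obtain ⟨b, -, hb⟩ := isCompact_univ.exists_isMaxOn univ_nonempty hc.continuousOn
    exact ⟨_, sepMap_norm_pos hf a, _, sepMap_norm_pos hf b,
      fun p => ⟨ha (mem_univ p), hb (mem_univ p)⟩⟩

/-- The map Ψ(t, p) = (f₂ - f₁)/t reduces Sard's theorem for G to equal dimensions: its Jacobian is
a nonzero multiple of the frame determinant of (x, DG), so a regular value of Ψ projects radially to
a regular value of G. It is chosen in an open set that contains -u/‖u‖. -/
theorem exists_isRegularValue_inner_neg (hf : IsLinkMap f₁ f₂) {u : Amb p₁ p₂} (hu : u ≠ 0) :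
    ∃ x : UnitSphere p₁ p₂, IsRegularValue (gaussMap hf) x ∧ inner ℝ (x : Amb p₁ p₂) u < 0 := by
  obtain ⟨m, hm, M, hM, hb⟩ := exists_norm_sepMap_bounds hf
  let Ψ : ℝ × P₁ × P₂ → CylModel p₁ p₂ := fun q => ambEquiv p₁ p₂
    ((fun t : ℝ => t⁻¹) q.1 • sepMap f₁ f₂ q.2)
  have hΨ : ContMDiffOn (cylCorners p₁ p₂) 𝓘(ℝ, CylModel p₁ p₂) ∞ Ψ (Ioi 0 ×ˢ univ) := by
    intro q hq
    refine ContMDiffAt.contMDiffWithinAt ?_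
    have h1 : ContMDiffAt (cylCorners p₁ p₂) 𝓘(ℝ, ℝ) ∞ (fun q : ℝ × P₁ × P₂ => q.1⁻¹) q :=
      contMDiffAt_fst.inv₀ hq.1.ne'
    exact (ambEquiv p₁ p₂).contDiff.contMDiff.contMDiffAt.comp q
      (h1.smul ((contMDiff_sepMap hf).comp contMDiff_snd q))
  -- A point of Ψ⁻¹(y) to be tested has t = ‖f₂ - f₁‖/‖z‖ with m ≤ ‖f₂ - f₁‖ ≤ M and 1/2 < ‖z‖ < 2,
  -- hence m/2 ≤ t ≤ 2M.
  let K : Set (ℝ × P₁ × P₂) := Icc (m / 2) (2 * M) ×ˢ univ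
  have hK : IsCompact K := isCompact_Icc.prod isCompact_univ
  obtain ⟨y, ⟨hy1, hy2, hy3⟩, hy⟩ : ∃ y : CylModel p₁ p₂,
      (1 / 2 < ‖(ambEquiv p₁ p₂).symm y‖ ∧ ‖(ambEquiv p₁ p₂).symm y‖ < 2 ∧
        inner ℝ ((ambEquiv p₁ p₂).symm y) u < 0) ∧
      ∀ q ∈ K, Ψ q = y → jac (cylCorners p₁ p₂) Ψ q ≠ 0 := by
    let _ : MeasurableSpace (CylModel p₁ p₂) := borel _
    have _ : BorelSpace (CylModel p₁ p₂) := ⟨rfl⟩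
    have h := ae_regular (MeasureTheory.Measure.addHaar (G := CylModel p₁ p₂))
      (isOpen_Ioi.prod isOpen_univ) hK
      (prod_mono (fun t ht => (half_pos hm).trans_le ht.1) subset_rfl) hΨ
    have hc := (ambEquiv p₁ p₂).symm.continuous
    have hi : Continuous fun y : CylModel p₁ p₂ => inner ℝ ((ambEquiv p₁ p₂).symm y) u :=
      hc.inner continuous_const
    have hopen : IsOpen {y : CylModel p₁ p₂ | 1 / 2 < ‖(ambEquiv p₁ p₂).symm y‖ ∧
        ‖(ambEquiv p₁ p₂).symm y‖ < 2 ∧ inner ℝ ((ambEquiv p₁ p₂).symm y) u < 0} :=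
      (isOpen_lt continuous_const hc.norm).inter ((isOpen_lt hc.norm continuous_const).inter
        (isOpen_lt hi continuous_const))
    obtain ⟨y, hy, hyr⟩ := (MeasureTheory.Measure.dense_of_ae h).exists_mem_open hopen
      ⟨ambEquiv p₁ p₂ (-(‖u‖⁻¹ • u)), by
        have hu' := norm_pos_iff.mpr hu
        have h1 : ‖-(‖u‖⁻¹ • u)‖ = 1 := by
          rw [norm_neg, norm_smul, norm_inv, norm_norm, inv_mul_cancel₀ hu'.ne']
        refine ⟨?_, ?_, ?_⟩
        · rw [ContinuousLinearEquiv.symm_apply_apply, h1]; norm_num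
        · rw [ContinuousLinearEquiv.symm_apply_apply, h1]; norm_num
        · rw [ContinuousLinearEquiv.symm_apply_apply, inner_neg_left, real_inner_smul_left,
            real_inner_self_eq_norm_sq]
          exact neg_lt_zero.mpr (by positivity)⟩
    exact ⟨y, hyr, hy⟩
  set z := (ambEquiv p₁ p₂).symm y
  have hz : 0 < ‖z‖ := by linarith
  let x : UnitSphere p₁ p₂ := ⟨‖z‖⁻¹ • z, by
    rw [mem_sphere_zero_iff_norm, norm_smul, norm_inv, norm_norm, inv_mul_cancel₀ hz.ne']⟩
  refine ⟨x, (isRegularValue_iff hf).mpr fun p hp h0 => ?_, ?_⟩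
  · have hρ := sepMap_norm_pos hf p
    have ht : ‖sepMap f₁ f₂ p‖ / ‖z‖ ≠ 0 := (div_pos hρ hz).ne'
    have h1 : ‖sepMap f₁ f₂ p‖ • ‖z‖⁻¹ • z = sepMap f₁ f₂ p :=
      (congrArg (fun x : UnitSphere p₁ p₂ => ‖sepMap f₁ f₂ p‖ • (x : Amb p₁ p₂)) hp).symm.trans
        (norm_smul_gaussMap hf p)
    refine hy (‖sepMap f₁ f₂ p‖ / ‖z‖, p) ⟨⟨?_, ?_⟩, mem_univ _⟩ ?_ ?_
    · rw [le_div_iff₀ hz]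
      nlinarith [(hb p).1]
    · rw [div_le_iff₀ hz]
      nlinarith [(hb p).2]
    · have h2 : (‖sepMap f₁ f₂ p‖ / ‖z‖)⁻¹ • sepMap f₁ f₂ p = z := by
        nth_rewrite 2 [← h1]
        rw [smul_smul, smul_smul, inv_div, div_mul_eq_mul_div, mul_div_assoc, div_self hρ.ne',
          mul_one, mul_inv_cancel₀ hz.ne', one_smul]
      exact (congrArg (ambEquiv p₁ p₂) h2).trans (ContinuousLinearEquiv.apply_symm_apply _ _)
    · have h3 := jac_scaled hf (hasDerivAt_const (‖sepMap f₁ f₂ p‖ / ‖z‖) (0 : ℝ))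
        (hasDerivAt_inv ht) (inv_ne_zero ht) hp
      simp only [zero_smul, sub_zero] at h3
      refine h3.trans ?_
      rw [h0, mul_zero]
  · change inner ℝ (‖z‖⁻¹ • z) u < 0
    rw [real_inner_smul_left]
    exact mul_neg_of_pos_of_neg (inv_pos.mpr hz) hy3

variable [T2Space P₁] [T2Space P₂] {R : Type*} [CommRing R] {w : P₁ × P₂ → R}

theorem finite_gaussMap_preimage (hf : IsLinkMap f₁ f₂) {x : UnitSphere p₁ p₂}
    (hx : IsRegularValue (gaussMap hf) x) : (gaussMap hf ⁻¹' {x}).Finite := by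
  obtain ⟨_, _, M, _, hb⟩ := exists_norm_sepMap_bounds hf
  have hT : ∀ p, ‖sepMap f₁ f₂ p‖ < M + 1 := fun p => (hb p).2.trans_lt (lt_add_one M)
  have h := (rayLift hf (M + 1) (x : Amb p₁ p₂)).finite_linkingSet (rayLift_start_ne_zero hT)
    hf.sub_ne_zero (isRegular_rayLift hf hT hx)
  rw [Lift.linkingSet_eq _ (rayLift_start_ne_zero hT) hf.sub_ne_zero] at h
  rw [← (rayLift_bijOn hf hT).image_eq]
  exact h.image _

omit [T2Space P₁] [T2Space P₂] [IsManifold (𝓡 p₁) ∞ P₁] [IsManifold (𝓡 p₂) ∞ P₂] in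
theorem exists_inner_rayLift_pos (hf : IsLinkMap f₁ f₂) {x : UnitSphere p₁ p₂} {u : Amb p₁ p₂}
    (hxu : inner ℝ (x : Amb p₁ p₂) u < 0) : ∃ T, (∀ p, ‖sepMap f₁ f₂ p‖ < T) ∧
      ∀ y₁ y₂, 0 < inner ℝ (f₂ y₂ - T • (x : Amb p₁ p₂) - f₁ y₁) u := by
  obtain ⟨_, _, M, hM, hb⟩ := exists_norm_sepMap_bounds hf
  obtain ⟨T, hT1, hT2⟩ : ∃ T, M < T ∧ M * ‖u‖ < T * -inner ℝ (x : Amb p₁ p₂) u := by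
    refine ⟨max M (M * ‖u‖ / -inner ℝ (x : Amb p₁ p₂) u) + 1,
      (le_max_left _ _).trans_lt (lt_add_one _), ?_⟩
    rw [← div_lt_iff₀ (neg_pos.mpr hxu)]
    exact (le_max_right _ _).trans_lt (lt_add_one _)
  refine ⟨T, fun p => (hb p).2.trans_lt hT1, fun y₁ y₂ => ?_⟩
  have h3 : f₂ y₂ - T • (x : Amb p₁ p₂) - f₁ y₁ = sepMap f₁ f₂ (y₁, y₂) - T • (x : Amb p₁ p₂) := by
    simp only [sepMap]
    abel
  rw [h3, inner_sub_left, real_inner_smul_left]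
  have h4 := (abs_le.mp (abs_real_inner_le_norm (sepMap f₁ f₂ (y₁, y₂)) u)).1
  have h5 := mul_le_mul_of_nonneg_right (hb (y₁, y₂)).2 (norm_nonneg u)
  linarith

/-- The ray lift along x with T large also starts in the half-space ⟨·, u⟩ > 0. By convexity the
segment between the two starting differences avoids 0, so `Lift.zeroCount_eq` applies. -/
theorem zeroCount_eq_degreeCount
    (hw : IsCoherent (cylCorners p₁ p₂) fun q : ℝ × P₁ × P₂ => w q.2)
    (hf : IsLinkMap f₁ f₂) (α : Lift g₁ f₁ g₂ f₂) (hα : α.IsRegular) {u : Amb p₁ p₂}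
    (hu : ∀ y₁ y₂, 0 < inner ℝ (g₂ y₂ - g₁ y₁) u) {x : UnitSphere p₁ p₂}
    (hx : IsRegularValue (gaussMap hf) x) (hxu : inner ℝ (x : Amb p₁ p₂) u < 0) :
    zeroCount (cylCorners p₁ p₂) (fun q => w q.2) (diffMap α.total) (Lift.openCylinder P₁ P₂) =
      degreeCount w hf x := by
  obtain ⟨T, hT, hTu⟩ := exists_inner_rayLift_pos hf hxu
  rw [← zeroCount_rayLift w hf hT]
  refine Lift.zeroCount_eq hw α (rayLift hf T x) hf.sub_ne_zero (fun y₁ y₂ s hs h => ?_) hα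
    (isRegular_rayLift hf hT hx)
  have h1 := hu y₁ y₂
  have h2 := hTu y₁ y₂
  have h3 : (1 - s) * inner ℝ (g₂ y₂ - g₁ y₁) u +
      s * inner ℝ (f₂ y₂ - T • (x : Amb p₁ p₂) - f₁ y₁) u = 0 := by
    refine Eq.trans ?_ ((congrArg (fun v => inner ℝ v u) h).trans (inner_zero_left u))
    rw [inner_add_left, real_inner_smul_left, inner_sub_left _ (g₂ y₂ - g₁ y₁)]
    ring
  rcases hs.1.eq_or_lt with h0 | h0
  · rw [← h0] at h3
    linarith
  · have h4 := mul_nonneg (sub_nonneg.mpr hs.2) h1.le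
    have h5 := mul_pos h0 h2
    linarith

/-- Both values have negative inner product with u = -(x + x'), because 1 + ⟨x, x'⟩ > 0. So the ray
lift along x is itself a lift that can be compared with the value x'. -/
theorem degreeCount_eq_of_ne_neg
    (hw : IsCoherent (cylCorners p₁ p₂) fun q : ℝ × P₁ × P₂ => w q.2)
    (hf : IsLinkMap f₁ f₂) {x x' : UnitSphere p₁ p₂} (hx : IsRegularValue (gaussMap hf) x)
    (hx' : IsRegularValue (gaussMap hf) x') (h : (x : Amb p₁ p₂) ≠ -x') :
    degreeCount w hf x = degreeCount w hf x' := by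
  have h1 : ‖(x : Amb p₁ p₂)‖ = 1 := norm_eq_of_mem_sphere x
  have h2 : ‖(x' : Amb p₁ p₂)‖ = 1 := norm_eq_of_mem_sphere x'
  have hlt : 0 < 1 + inner ℝ (x : Amb p₁ p₂) x' := by
    have h3 : 0 < ‖(x : Amb p₁ p₂) + x'‖ ^ 2 := by
      have := norm_pos_iff.mpr (fun h0 => h (eq_neg_of_add_eq_zero_left h0))
      positivity
    rw [norm_add_sq_real, h1, h2] at h3
    linarith
  let u : Amb p₁ p₂ := -((x : Amb p₁ p₂) + x')
  have hxu : inner ℝ (x : Amb p₁ p₂) u < 0 := by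
    rw [inner_neg_right, inner_add_right, real_inner_self_eq_norm_sq, h1]
    linarith
  have hxu' : inner ℝ (x' : Amb p₁ p₂) u < 0 := by
    rw [inner_neg_right, inner_add_right, real_inner_self_eq_norm_sq, h2, real_inner_comm]
    linarith
  obtain ⟨T, hT, hTu⟩ := exists_inner_rayLift_pos hf hxu
  rw [← zeroCount_rayLift w hf hT]
  exact zeroCount_eq_degreeCount hw hf _ (isRegular_rayLift hf hT hx) hTu hx' hxu'

theorem degreeCount_eq (hw : IsCoherent (cylCorners p₁ p₂) fun q : ℝ × P₁ × P₂ => w q.2)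
    (hf : IsLinkMap f₁ f₂) (hp : 0 < p₁ + p₂) {x x' : UnitSphere p₁ p₂}
    (hx : IsRegularValue (gaussMap hf) x) (hx' : IsRegularValue (gaussMap hf) x') :
    degreeCount w hf x = degreeCount w hf x' := by
  by_cases h : (x : Amb p₁ p₂) = -x'
  -- A vector u orthogonal to x exists because the ambient dimension is at least 2. A regular value
  -- z with ⟨z, u⟩ < 0 is antipodal to neither x nor x' and links the two.
  · obtain ⟨u, hu, hxu⟩ : ∃ u : Amb p₁ p₂, u ≠ 0 ∧ inner ℝ (x : Amb p₁ p₂) u = 0 := by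
      have hlt : (Submodule.span ℝ {(x : Amb p₁ p₂)}) ≠ ⊤ := by
        intro ht
        have h1 := finrank_span_singleton (K := ℝ) (ne_zero_of_mem_unit_sphere x)
        rw [ht, finrank_top, finrank_euclideanSpace_fin] at h1
        omega
      obtain ⟨u, hu, hu0⟩ := Submodule.exists_mem_ne_zero_of_ne_bot
        (mt (Submodule.orthogonal_eq_bot_iff).mp hlt)
      exact ⟨u, hu0, Submodule.mem_orthogonal_singleton_iff_inner_right.mp hu⟩
    obtain ⟨z, hz, hzu⟩ := exists_isRegularValue_inner_neg hf hu
    have hxu' : inner ℝ (x' : Amb p₁ p₂) u = 0 := by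
      rw [h, inner_neg_left] at hxu
      linarith
    have h1 : (x : Amb p₁ p₂) ≠ -z := by
      intro h1
      rw [h1, inner_neg_left] at hxu
      linarith
    have h2 : (z : Amb p₁ p₂) ≠ -x' := by
      intro h2
      rw [h2, inner_neg_left] at hzu
      linarith
    exact (degreeCount_eq_of_ne_neg hw hf hx hz h1).trans (degreeCount_eq_of_ne_neg hw hf hz hx' h2)
  · exact degreeCount_eq_of_ne_neg hw hf hx hx' h

end LinkingNumber

/-! ### Separating directions of unlinks and the common value of all counts. -/

section Unlink

universe u v

variable {p₁ p₂ : ℕ}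
  {P₁ : Type u} [TopologicalSpace P₁] [ChartedSpace (EuclideanSpace ℝ (Fin p₁)) P₁]
  {P₂ : Type v} [TopologicalSpace P₂] [ChartedSpace (EuclideanSpace ℝ (Fin p₂)) P₂]
  {f₁ g₁ : P₁ → Amb p₁ p₂} {f₂ g₂ : P₂ → Amb p₁ p₂}

theorem exists_amb_ne_zero (p₁ p₂ : ℕ) : ∃ u : Amb p₁ p₂, u ≠ 0 :=
  exists_ne 0

theorem IsUnlink.exists_inner_pos (hg : IsUnlink g₁ g₂) :
    ∃ u : Amb p₁ p₂, u ≠ 0 ∧ ∀ y₁ y₂, 0 < inner ℝ (g₂ y₂ - g₁ y₁) u := by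
  -- If a manifold is empty, the radii need not be positive and the centres may coincide, but then
  -- any nonzero direction will do. Otherwise c₂ - c₁ works, since r₁ + r₂ ≤ ‖c₂ - c₁‖.
  rcases isEmpty_or_nonempty P₁ with h1 | ⟨⟨x₁⟩⟩
  · obtain ⟨u, hu⟩ := exists_amb_ne_zero p₁ p₂
    exact ⟨u, hu, fun y₁ => h1.elim y₁⟩
  rcases isEmpty_or_nonempty P₂ with h2 | ⟨⟨x₂⟩⟩
  · obtain ⟨u, hu⟩ := exists_amb_ne_zero p₁ p₂
    exact ⟨u, hu, fun _ y₂ => h2.elim y₂⟩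
  obtain ⟨c₁, c₂, r₁, r₂, hd, h1, h2⟩ := hg.balls
  have hr₁ : 0 < r₁ := pos_of_mem_ball (h1 (mem_range_self x₁))
  have hr₂ : 0 < r₂ := pos_of_mem_ball (h2 (mem_range_self x₂))
  have hdist := (disjoint_ball_ball_iff hr₁ hr₂).mp hd
  rw [dist_comm, dist_eq_norm] at hdist
  have hu : 0 < ‖c₂ - c₁‖ := by linarith
  refine ⟨c₂ - c₁, norm_pos_iff.mp hu, fun y₁ y₂ => ?_⟩
  have e1 : ‖g₁ y₁ - c₁‖ < r₁ := mem_ball_iff_norm.mp (h1 (mem_range_self y₁))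
  have e2 : ‖g₂ y₂ - c₂‖ < r₂ := mem_ball_iff_norm.mp (h2 (mem_range_self y₂))
  have e3 : g₂ y₂ - g₁ y₁ = (c₂ - c₁) + (g₂ y₂ - c₂) - (g₁ y₁ - c₁) := by abel
  rw [e3, inner_sub_left, inner_add_left, real_inner_self_eq_norm_sq]
  have e4 := (abs_le.mp (abs_real_inner_le_norm (g₂ y₂ - c₂) (c₂ - c₁))).1
  have e5 := (abs_le.mp (abs_real_inner_le_norm (g₁ y₁ - c₁) (c₂ - c₁))).2
  nlinarith

theorem IsUnlink.sub_ne_zero (hg : IsUnlink g₁ g₂) (y₁ : P₁) (y₂ : P₂) : g₂ y₂ - g₁ y₁ ≠ 0 := by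
  obtain ⟨u, -, hu⟩ := hg.exists_inner_pos
  intro h
  have := hu y₁ y₂
  rw [h, inner_zero_left] at this
  exact lt_irrefl _ this

/-- The lift that is given by linear homotopies. -/
noncomputable def linearLift (hg : IsUnlink g₁ g₂) (hf : IsLinkMap f₁ f₂) : Lift g₁ f₁ g₂ f₂ where
  map₁ t y := g₁ y + t • (f₁ y - g₁ y)
  map₂ t y := g₂ y + t • (f₂ y - g₂ y)
  smooth₁ := ((hg.smooth₁.comp contMDiff_snd).add (contMDiff_fst.smul
    ((hf.smooth₁.comp contMDiff_snd).sub (hg.smooth₁.comp contMDiff_snd)))).contMDiffOn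
  smooth₂ := ((hg.smooth₂.comp contMDiff_snd).add (contMDiff_fst.smul
    ((hf.smooth₂.comp contMDiff_snd).sub (hg.smooth₂.comp contMDiff_snd)))).contMDiffOn
  map₁_zero := by simp
  map₂_zero := by simp
  map₁_one := by simp
  map₂_one := by simp

variable [CompactSpace P₁] [CompactSpace P₂] [T2Space P₁] [T2Space P₂]
  [IsManifold (𝓡 p₁) ∞ P₁] [IsManifold (𝓡 p₂) ∞ P₂]

/-- Linking numbers with respect to a coherent weight. -/
theorem exists_degreeCount_eq_zeroCount_eq {R : Type*} [CommRing R] {w : P₁ × P₂ → R}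
    (hw : IsCoherent (cylCorners p₁ p₂) fun q : ℝ × P₁ × P₂ => w q.2)
    (hf : IsLinkMap f₁ f₂) (hp : 0 < p₁ + p₂) :
    ∃ d : R, (∀ x, IsRegularValue (gaussMap hf) x → degreeCount w hf x = d) ∧
      ∀ (g₁ : P₁ → Amb p₁ p₂) (g₂ : P₂ → Amb p₁ p₂), IsUnlink g₁ g₂ →
        ∀ α : Lift g₁ f₁ g₂ f₂, α.IsRegular →
          zeroCount (cylCorners p₁ p₂) (fun q => w q.2) (diffMap α.total)
            (Lift.openCylinder P₁ P₂) = d := by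
  obtain ⟨u, hu⟩ := exists_amb_ne_zero p₁ p₂
  obtain ⟨x, hx, -⟩ := exists_isRegularValue_inner_neg hf hu
  refine ⟨degreeCount w hf x, fun x' hx' => degreeCount_eq hw hf hp hx' hx, fun g₁ g₂ hg α hα => ?_⟩
  -- Each unlink needs a regular value on the negative side of its own separating direction;
  -- `degreeCount_eq` then leads back to the fixed value x.
  obtain ⟨v, hv, hv'⟩ := hg.exists_inner_pos
  obtain ⟨x', hx', hxv⟩ := exists_isRegularValue_inner_neg hf hv
  rw [zeroCount_eq_degreeCount hw hf α hα hv' hx' hxv]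
  exact degreeCount_eq hw hf hp hx' hx

end Unlink

end LinkMaps

/-! ### The comparison of the linking numbers. -/

theorem mainTheorem4 {p₁ p₂ : ℕ} (hp : 0 < p₁ + p₂)
    {P₁ : Type*} [TopologicalSpace P₁] [T2Space P₁] [CompactSpace P₁]
    [ChartedSpace (EuclideanSpace ℝ (Fin p₁)) P₁] [IsManifold (𝓡 p₁) ∞ P₁]
    {P₂ : Type*} [TopologicalSpace P₂] [T2Space P₂] [CompactSpace P₂]
    [ChartedSpace (EuclideanSpace ℝ (Fin p₂)) P₂] [IsManifold (𝓡 p₂) ∞ P₂]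
    (f₁ : P₁ → LinkMaps.Amb p₁ p₂) (f₂ : P₂ → LinkMaps.Amb p₁ p₂)
    (hf : LinkMaps.IsLinkMap f₁ f₂) :
    -- `L` and `L₃` are isomorphic as point sets counted with signs
    (∀ x, LinkMaps.IsRegularValue (LinkMaps.gaussMap hf) x →
      BijOn Prod.snd (LinkMaps.raySet f₁ f₂ x) (LinkMaps.gaussMap hf ⁻¹' {x}) ∧
      ∀ (o₁ : LinkMaps.ManifoldOrientation p₁ P₁) (o₂ : LinkMaps.ManifoldOrientation p₂ P₂),
        ∀ q ∈ LinkMaps.raySet f₁ f₂ x,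
          LinkMaps.raySign o₁ o₂ f₁ f₂ x q =
            LinkMaps.sphereSign o₁ o₂ (LinkMaps.gaussMap hf) q.2) ∧
    -- over every unlink in disjoint balls there is a lift of the link map
    (∀ (g₁ : P₁ → LinkMaps.Amb p₁ p₂) (g₂ : P₂ → LinkMaps.Amb p₁ p₂), LinkMaps.IsUnlink g₁ g₂ →
      Nonempty (LinkMaps.Lift g₁ f₁ g₂ f₂)) ∧
    -- the linking numbers mod `2` agree, for every unlink and every lift
    (∃ lk : ZMod 2, LinkMaps.HasDegreeModTwo (LinkMaps.gaussMap hf) lk ∧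
      ∀ (g₁ : P₁ → LinkMaps.Amb p₁ p₂) (g₂ : P₂ → LinkMaps.Amb p₁ p₂), LinkMaps.IsUnlink g₁ g₂ →
        ∀ α : LinkMaps.Lift g₁ f₁ g₂ f₂, α.HasLinkingNumberModTwo lk) ∧
    -- if the manifolds are oriented, the integral linking numbers agree
    (∀ (o₁ : LinkMaps.ManifoldOrientation p₁ P₁) (o₂ : LinkMaps.ManifoldOrientation p₂ P₂),
      ∃ lk : ℤ, LinkMaps.HasDegree o₁ o₂ (LinkMaps.gaussMap hf) lk ∧
        ∀ (g₁ : P₁ → LinkMaps.Amb p₁ p₂) (g₂ : P₂ → LinkMaps.Amb p₁ p₂),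
          LinkMaps.IsUnlink g₁ g₂ →
          ∀ α : LinkMaps.Lift g₁ f₁ g₂ f₂, α.HasLinkingNumber o₁ o₂ lk) := by
  obtain ⟨u, hu⟩ := LinkMaps.exists_amb_ne_zero p₁ p₂
  obtain ⟨x₀, hx₀, -⟩ := LinkMaps.exists_isRegularValue_inner_neg hf hu
  refine ⟨fun x _ => ⟨LinkMaps.raySet_bijOn hf x, fun o₁ o₂ q hq => LinkMaps.raySign_eq o₁ o₂ hf hq⟩,
    fun g₁ g₂ hg => ⟨LinkMaps.linearLift hg hf⟩, ?_, fun o₁ o₂ => ?_⟩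
  -- The count mod 2 and the integral count below come from the same result, for the constant weight
  -- 1 and for the weight given by the orientations.
  · obtain ⟨d, hd, hd'⟩ := LinkMaps.exists_degreeCount_eq_zeroCount_eq
      (w := fun _ => (1 : ZMod 2)) LinkMaps.isCoherent_one hf hp
    refine ⟨d, ⟨⟨x₀, hx₀⟩, fun x hx => ⟨LinkMaps.finite_gaussMap_preimage hf hx, ?_⟩⟩,
      fun g₁ g₂ hg α => ⟨?_, fun β _ hβ => ?_⟩⟩
    · rw [← hd x hx]
      exact (LinkMaps.Lift.sum_sign_eq_ncard (LinkMaps.finite_gaussMap_preimage hf hx)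
        ((LinkMaps.isRegularValue_iff hf).mp hx)).symm
    · obtain ⟨β, hαβ, hβ⟩ := α.exists_homotopic_isRegular hg.sub_ne_zero hf.sub_ne_zero
      exact ⟨β, hαβ, (β.isTransverse_iff hg.sub_ne_zero hf.sub_ne_zero).mpr hβ⟩
    · have hβ' := (β.isTransverse_iff hg.sub_ne_zero hf.sub_ne_zero).mp hβ
      exact ⟨β.isClosedFramed hg.sub_ne_zero hf.sub_ne_zero hβ',
        (β.countModTwo_eq hg.sub_ne_zero hf.sub_ne_zero hβ').trans (hd' g₁ g₂ hg β hβ')⟩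
  · obtain ⟨d, hd, hd'⟩ := LinkMaps.exists_degreeCount_eq_zeroCount_eq
      (LinkMaps.isCoherent_orientationWeight o₁ o₂) hf hp
    refine ⟨d, ⟨⟨x₀, hx₀⟩, fun x hx => ⟨LinkMaps.finite_gaussMap_preimage hf hx, ?_⟩⟩,
      fun g₁ g₂ hg α => ⟨?_, fun β _ hβ => ?_⟩⟩
    · rw [← hd x hx]
      refine finsum_mem_congr rfl fun q hq => ?_
      have hq' : LinkMaps.gaussMap hf q = x := hq
      rw [LinkMaps.sphereSign, LinkMaps.frameSign_eq, hq', Int.cast_id]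
      rfl
    · obtain ⟨β, hαβ, hβ⟩ := α.exists_homotopic_isRegular hg.sub_ne_zero hf.sub_ne_zero
      exact ⟨β, hαβ, (β.isTransverse_iff hg.sub_ne_zero hf.sub_ne_zero).mpr hβ⟩
    · have hβ' := (β.isTransverse_iff hg.sub_ne_zero hf.sub_ne_zero).mp hβ
      exact ⟨β.isClosedFramed hg.sub_ne_zero hf.sub_ne_zero hβ',
        (β.signedCount_eq o₁ o₂ hg.sub_ne_zero hf.sub_ne_zero).trans (hd' g₁ g₂ hg β hβ')⟩
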